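/- All graphs are finite, simple and undirected; multigraphs are finite and undirected and may have parallel edges and loops. For a positive integer $k$, a $k$-path of a graph $G$ is a (not necessarily induced) subgraph of $G$ that is a path with exactly $k$ vertices. Let $\nu_k(G)$ be the maximum number of pairwise vertex-disjoint $k$-paths of $G$, and let $\tau_k(G)$ be the minimum cardinality of a set of vertices of $G$ that intersects every $k$-path of $G$. Let $\mathcal{G}_k$ be the set of all graphs $G$ such that $\nu_k(H)=\tau_k(H)$ for every induced subgraph $H$ of $G$. A cutvertex of $G$ is a vertex $x$ such that $G-x$ has more components than $G$. A block of $G$ is a maximal connected subgraph of $G$ that itself has no cutvertex; it is trivial if it is $K_1$ or $K_2$, and it is an endblock if it contains at most one cutvertex of $G$. For a bipartite (hence loopless) multigraph $H$, let $\mathrm{Sub}_2(H)$ be the graph that arises from $H$ by subdividing every edge exactly once. For a positive integer $p$, let $T(p)$ be the graph that arises from the complete bipartite graph $K_{2,p}$ by adding an edge between the two vertices in the partite set of order $2$. Let $\mathcal{H}_4$ be the set of all graphs $G$ such that every non-trivial block $B$ of $G$ satisfies at least one of the following conditions (equalities of graphs are up to isomorphism). (i) $B=\mathrm{Sub}_2(H)$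 for some bipartite multigraph $H$, and every cutvertex of $G$ that belongs to $B$ is a vertex of $H$. (ii) $B=K_4$ is an endblock. (iii) $B=T(2)$ is an endblock, and, if $B$ contains a cutvertex $x$ of $G$, then $x$ has degree $2$ in $B$. (iv) $B=T(p)$ for some positive integer $p$, at most two cutvertices of $G$ belong to $B$, every cutvertex of $G$ that belongs to $B$ has degree $p+1$ in $B$, and, if $B$ contains two cutvertices of $G$, then there is one cutvertex $x$ of $G$ in $B$ such that every neighbour of $x$ in $G$ outside of $B$ has degree $1$ in $G$. Theorem. $\mathcal{G}_4=\mathcal{H}_4$. -/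

import Mathlib

open scoped Graph

universe u

/-! Packing and covering of paths of order `k` in a simple graph. -/

/-- A `k`-path of `G`: a (not necessarily induced) subgraph of `G` that is a path with exactly `k`
vertices. -/
def IsKPath {V : Type u} (G : SimpleGraph V) (k : ℕ) (P : G.Subgraph) : Prop :=
  Nonempty (P.coe ≃g SimpleGraph.pathGraph k)

/-- A `k`-matching of `G`: a finite set of pairwise (vertex-)disjoint `k`-paths of `G`. -/
def IsKMatching {V : Type u} (G : SimpleGraph V) (k : ℕ) (M : Finset G.Subgraph) : Prop :=
  (∀ P ∈ M, IsKPath G k P) ∧ ∀ P ∈ M, ∀ Q ∈ M, P ≠ Q → Disjoint P.verts Q.verts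

/-- A `k`-vertex cover of `G`: a finite set of vertices that intersects every `k`-path of `G`. -/
def IsKVertexCover {V : Type u} (G : SimpleGraph V) (k : ℕ) (X : Finset V) : Prop :=
  ∀ P : G.Subgraph, IsKPath G k P → ∃ v ∈ X, v ∈ P.verts

/-- The `k`-matching number `ν_k(G)`: the maximum cardinality of a `k`-matching (for finite `G`). -/
noncomputable def kMatchingNumber {V : Type u} (G : SimpleGraph V) (k : ℕ) : ℕ :=
  sSup {n : ℕ | ∃ M : Finset G.Subgraph, IsKMatching G k M ∧ M.card = n}

/-- The `k`-vertex cover number `τ_k(G)`: the minimum cardinality of a `k`-vertex cover (for finite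
`G` and positive `k`). -/
noncomputable def kVertexCoverNumber {V : Type u} (G : SimpleGraph V) (k : ℕ) : ℕ :=
  sInf {n : ℕ | ∃ X : Finset V, IsKVertexCover G k X ∧ X.card = n}

/-- The class `𝒢_k` (on the vertex set `V`): the graphs `G` such that `ν_k = τ_k` for every induced
subgraph of `G`. -/
def classG (k : ℕ) (V : Type u) : Set (SimpleGraph V) :=
  {G | ∀ S : Set V, kMatchingNumber (G.induce S) k = kVertexCoverNumber (G.induce S) k}

/-! Cutvertices and blocks. -/

/-- `x` is a cutvertex of `G`: the graph `G - x` has more components than `G`. -/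
def IsCutvertex {V : Type u} (G : SimpleGraph V) (x : V) : Prop :=
  Nat.card G.ConnectedComponent < Nat.card (G.induce ({x}ᶜ : Set V)).ConnectedComponent

/-- A block of `G`: a maximal connected subgraph of `G` that itself has no cutvertex. -/
def IsBlock {V : Type u} (G : SimpleGraph V) (B : G.Subgraph) : Prop :=
  Maximal (fun C : G.Subgraph => C.Connected ∧ ∀ x : C.verts, ¬ IsCutvertex C.coe x) B

/-- The subgraph `B` is trivial: it is a `K₁` or a `K₂`. -/
def IsTrivialBlock {V : Type u} {G : SimpleGraph V} (B : G.Subgraph) : Prop :=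
  Nonempty (B.coe ≃g (⊤ : SimpleGraph (Fin 1))) ∨ Nonempty (B.coe ≃g (⊤ : SimpleGraph (Fin 2)))

/-- The set of cutvertices of the whole graph `G` that belong to `B`. -/
def cutverticesIn {V : Type u} {G : SimpleGraph V} (B : G.Subgraph) : Set V :=
  {x | x ∈ B.verts ∧ IsCutvertex G x}

/-! The building blocks. -/

/-- The multigraph `H` is bipartite: its vertex set splits into two parts such that every edge has
one end in each of the two parts. In particular, `H` has no loops. -/
def IsBipartiteMultigraph {α β : Type u} (H : Graph α β) : Prop :=
  ∃ A : Set α, ∀ e x y, H.IsLink e x y → (x ∈ A ↔ y ∉ A)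

/-- `Sub₂(H)` for a loopless multigraph `H`: every edge is subdivided exactly once. The vertices are
the vertices of `H` and, for every edge `e` of `H`, one new vertex, adjacent to the two ends of
`e`. -/
def sub2 {α β : Type u} (H : Graph α β) : SimpleGraph (V(H) ⊕ E(H)) where
  Adj
    | Sum.inl x, Sum.inr e => H.Inc e.1 x.1
    | Sum.inr e, Sum.inl x => H.Inc e.1 x.1
    | _, _ => False
  symm := ⟨by rintro (x | e) (y | f) h <;> exact h⟩
  loopless := ⟨by rintro (x | e) h <;> exact h⟩

/-- `T(p)`: the complete bipartite graph `K_{2,p}` with an additional edge between the two vertices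
in the partite set of order `2`. -/
def graphT (p : ℕ) : SimpleGraph (Fin 2 ⊕ Fin p) :=
  completeBipartiteGraph (Fin 2) (Fin p) ⊔ SimpleGraph.edge (Sum.inl 0) (Sum.inl 1)

/-! The conditions on a block `B` of `G`. -/

/-- `B = Sub₂(H)` for some bipartite multigraph `H`, and every cutvertex of `G` that belongs to `B`
is a vertex of `H`. -/
def IsSubdivisionBlock {V : Type u} {G : SimpleGraph V} (B : G.Subgraph) : Prop :=
  ∃ (α β : Type u) (H : Graph α β) (φ : B.coe ≃g sub2 H), IsBipartiteMultigraph H ∧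
    ∀ x : B.verts, IsCutvertex G x.1 → ∃ v : V(H), φ x = Sum.inl v

/-- `B = K₄` is an endblock, that is, it contains at most one cutvertex of `G`. -/
def IsK4Endblock {V : Type u} {G : SimpleGraph V} (B : G.Subgraph) : Prop :=
  Nonempty (B.coe ≃g (⊤ : SimpleGraph (Fin 4))) ∧ (cutverticesIn B).ncard ≤ 1

/-- `B = T(2)` is an endblock, and, if `B` contains a cutvertex `x` of `G`, then `x` has degree `2`
in `B`. -/
def IsT2Endblock {V : Type u} {G : SimpleGraph V} (B : G.Subgraph) : Prop :=
  Nonempty (B.coe ≃g graphT 2) ∧ (cutverticesIn B).ncard ≤ 1 ∧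
    ∀ x ∈ cutverticesIn B, (B.neighborSet x).ncard = 2

/-- `B = T(p)` for some positive integer `p`, at most two cutvertices of `G` belong to `B`, each of
them has degree `p + 1` in `B`, and, if there are two of them, then, for one of them, all
neighbours in `G` outside of `B` have degree `1` in `G`. -/
def IsTBlock {V : Type u} {G : SimpleGraph V} (B : G.Subgraph) : Prop :=
  ∃ p : ℕ, 0 < p ∧ Nonempty (B.coe ≃g graphT p) ∧ (cutverticesIn B).ncard ≤ 2 ∧
    (∀ x ∈ cutverticesIn B, (B.neighborSet x).ncard = p + 1) ∧
    ((cutverticesIn B).ncard = 2 →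
      ∃ x ∈ cutverticesIn B, ∀ y ∈ G.neighborSet x \ B.verts, (G.neighborSet y).ncard = 1)

/-- The class `ℋ₄` (on the vertex set `V`): the graphs all of whose non-trivial blocks satisfy one
of the four conditions. -/
def classH4 (V : Type u) : Set (SimpleGraph V) :=
  {G | ∀ B : G.Subgraph, IsBlock G B → ¬ IsTrivialBlock B →
    IsSubdivisionBlock B ∨ IsK4Endblock B ∨ IsT2Endblock B ∨ IsTBlock B}

/-! Both classes are identified with a third class, `Good`, given by forbidden (not necessarily
induced) subgraphs: cycles whose length is neither 3 nor a multiple of 4; a cycle of length 4k with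
neighbours off the cycle at two vertices of odd distance along it; a diamond with a further
neighbour at each of its two vertices of degree two; a triangle with a further neighbour at each
vertex; a triangle with a path of two further vertices at each of two vertices.

Membership in 𝒢₄ excludes these by counting: a set of fewer than 4(k+1) vertices has no k+1 disjoint
4-paths, but in each obstruction k vertices do not meet all 4-paths (`cov_of_mem_classG`,
`good_of_mem_classG`).

The equality of `Good` and ℋ₄ is a structure theorem for blocks. In a triangle-free block all cycle
lengths are divisible by 4. Hence cycles have no chords, the block is bipartite, and the vertices
with at least three neighbours lie in one colour class. The vertices of the other class subdivide
the edges of a multigraph whose cycles have half the length and so are even (`Good.exists_subS`). In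
a block with a triangle, congruences for the lengths of ears leave only K₄ and T(p), and the
remaining obstructions restrict the cutvertices (`Good.triangle_block`). Conversely, each
obstruction has a two-connected core, which lies in a single block, and no admissible block can
contain it (`good_of_shape`).

The min-max equality for `Good` graphs is an induction over vertex sets W (`Good.minMax`). Let D be
a smallest set that a vertex z separates from the rest of W such that D ∪ {z} contains a 4-path. If
D contains none, z meets all 4-paths close to D and D ∪ {z} is removed. Otherwise z lies in a block
B inside D ∪ {z}. If B has a triangle, one vertex again meets everything close to B. If B is the
subdivision of a bipartite multigraph H, then the 4-paths that meet D are, up to an exception at z,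
met by any vertex cover Y of H that contains all "heavy" vertices, those where a path with two
vertices hangs outside of B.

For a minimum such Y, a König-type exchange argument matches the non-heavy vertices of Y to vertices
outside of Y (`SubS.exists_matching`). Matching edges and hanging paths give |Y| disjoint paths with
three vertices. A second application of Hall's theorem (`exists_select`) extends all of them by
distinct subdivision vertices, because each path has two candidates and each subdivision vertex only
two ends. The exception at z occurs when no minimum cover contains z: then one subdivision vertex
next to z stays behind as a pendant vertex that represents D in the smaller instance
(`MinPiece.minMax_of_subS`). -/

namespace FourPath
open SimpleGraph

/-! ### Connection inside a vertex set, cycles, and the forbidden subgraphs -/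

section Basics
variable {V : Type u} {G : SimpleGraph V}

/-- `u` and `v` are joined by a walk all of whose vertices belong to `S`. -/
def Conn (G : SimpleGraph V) (S : Set V) (u v : V) : Prop :=
  ∃ p : G.Walk u v, ∀ w ∈ p.support, w ∈ S

namespace Conn
variable {S T : Set V} {u v w : V}

lemma refl (h : u ∈ S) : Conn G S u u := ⟨Walk.nil, by simpa using h⟩

lemma symm (h : Conn G S u v) : Conn G S v u := by
  obtain ⟨p, hp⟩ := h
  exact ⟨p.reverse, by simpa using hp⟩

lemma trans (h : Conn G S u v) (h' : Conn G S v w) : Conn G S u w := by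
  obtain ⟨p, hp⟩ := h
  obtain ⟨q, hq⟩ := h'
  refine ⟨p.append q, fun x hx => ?_⟩
  rw [Walk.mem_support_append_iff] at hx
  exact hx.elim (hp x) (hq x)

lemma mono (h : Conn G S u v) (hST : S ⊆ T) : Conn G T u v := by
  obtain ⟨p, hp⟩ := h
  exact ⟨p, fun x hx => hST (hp x hx)⟩

lemma of_adj (h : G.Adj u v) (hu : u ∈ S) (hv : v ∈ S) : Conn G S u v :=
  ⟨Walk.cons h Walk.nil, by simp [hu, hv]⟩

lemma mem_left (h : Conn G S u v) : u ∈ S := by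
  obtain ⟨p, hp⟩ := h
  exact hp u p.start_mem_support

lemma mem_right (h : Conn G S u v) : v ∈ S := h.symm.mem_left

lemma exists_path (h : Conn G S u v) :
    ∃ p : G.Walk u v, p.IsPath ∧ ∀ w ∈ p.support, w ∈ S := by
  classical
  obtain ⟨p, hp⟩ := h
  exact ⟨p.bypass, p.bypass_isPath, fun x hx => hp x (p.support_bypass_subset_support hx)⟩

/-- A set that is closed under taking neighbours inside `S` contains everything joined in `S`. -/
lemma mem_of_closed {K : Set V} (h : Conn G S u v) (hu : u ∈ K)
    (hK : ∀ x ∈ K, ∀ y ∈ S, G.Adj x y → y ∈ K) : v ∈ K := by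
  obtain ⟨p, hp⟩ := h
  induction p with
  | nil => exact hu
  | cons h p ih =>
    refine ih (hK _ hu _ ?_ h) fun w hw => hp w ?_
    · exact hp _ (by simp)
    · simp [hw]

/-- The initial part of a path up to its first vertex in `B`. -/
lemma exists_path_first {B : Set V} (h : Conn G S u v) (hv : v ∈ B) :
    ∃ t ∈ B, ∃ p : G.Walk u t, p.IsPath ∧ (∀ w ∈ p.support, w ∈ S) ∧
      ∀ w ∈ p.support, w ∈ B → w = t := by
  classical
  have key : ∀ {u v : V} (p : G.Walk u v), v ∈ B → ∃ t ∈ B, ∃ q : G.Walk u t,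
      (∀ w ∈ q.support, w ∈ p.support) ∧ ∀ w ∈ q.support, w ∈ B → w = t := by
    intro u v p
    induction p with
    | nil => intro hv; exact ⟨_, hv, Walk.nil, by simp, by simp⟩
    | @cons a b c h p ih =>
      intro hv
      by_cases ha : a ∈ B
      · exact ⟨a, ha, Walk.nil, by simp, by simp⟩
      · obtain ⟨t, ht, q, hq, hq'⟩ := ih hv
        refine ⟨t, ht, Walk.cons h q, ?_, ?_⟩
        · intro w hw
          rw [Walk.support_cons, List.mem_cons] at hw ⊢
          exact hw.imp id (hq w)
        · intro w hw hwB
          rw [Walk.support_cons, List.mem_cons] at hw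
          rcases hw with rfl | hw
          · exact absurd hwB ha
          · exact hq' w hw hwB
  obtain ⟨p, hp⟩ := h
  obtain ⟨t, ht, q, hq, hq'⟩ := key p hv
  exact ⟨t, ht, q.bypass, q.bypass_isPath,
    fun x hx => hp x (hq x (q.support_bypass_subset_support hx)),
    fun x hx => hq' x (q.support_bypass_subset_support hx)⟩

end Conn

/-- A cycle of length `n`, as an `n`-periodic sequence of vertices. -/
structure IsCyc (G : SimpleGraph V) (f : ℕ → V) (n : ℕ) : Prop where
  three_le : 3 ≤ n
  periodic : ∀ i, f (i + n) = f i
  inj : ∀ i < n, ∀ j < n, f i = f j → i = j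
  adj : ∀ i, G.Adj (f i) (f (i + 1))

namespace IsCyc
variable {f : ℕ → V} {n : ℕ}

lemma apply_mod (h : IsCyc G f n) (i : ℕ) : f (i % n) = f i := by
  have : ∀ k, f (i % n + n * k) = f (i % n) := by
    intro k
    induction k with
    | zero => simp
    | succ k ih => rw [Nat.mul_succ, ← Nat.add_assoc, h.periodic, ih]
  rw [← this (i / n), Nat.mod_add_div]

lemma eq_iff (h : IsCyc G f n) {i j : ℕ} : f i = f j ↔ i % n = j % n := by
  have hn : 0 < n := by have := h.three_le; omega
  constructor
  · intro hij
    rw [← h.apply_mod i, ← h.apply_mod j] at hij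
    exact h.inj _ (Nat.mod_lt _ hn) _ (Nat.mod_lt _ hn) hij
  · intro hij
    rw [← h.apply_mod i, ← h.apply_mod j, hij]

lemma shift (h : IsCyc G f n) (k : ℕ) : IsCyc G (fun i => f (i + k)) n where
  three_le := h.three_le
  periodic i := by
    show f (i + n + k) = f (i + k)
    rw [Nat.add_right_comm, h.periodic]
  inj i hi j hj hij := by
    have := h.eq_iff.1 hij
    have h2 : i ≡ j [MOD n] := Nat.ModEq.add_right_cancel' k this
    rwa [Nat.ModEq, Nat.mod_eq_of_lt hi, Nat.mod_eq_of_lt hj] at h2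
  adj i := by
    show G.Adj (f (i + k)) (f (i + 1 + k))
    rw [Nat.add_right_comm]
    exact h.adj _

lemma range_shift (h : IsCyc G f n) (k : ℕ) : Set.range (fun i => f (i + k)) = Set.range f := by
  ext x
  constructor
  · rintro ⟨i, rfl⟩
    exact ⟨i + k, rfl⟩
  · rintro ⟨i, rfl⟩
    -- Adding `n * k ≥ k` before subtracting keeps the truncated subtraction exact and does not
    -- change the residue.
    refine ⟨i + n * k - k, ?_⟩
    have : i + n * k - k + k = i + n * k := by
      have := h.three_le
      have : 1 * k ≤ n * k := Nat.mul_le_mul_right _ (by omega)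
      omega
    show f (i + n * k - k + k) = f i
    rw [this, h.eq_iff]
    simp

/-- Two internally disjoint paths with the same ends form a cycle. -/
lemma of_paths {u v : V} {p q : G.Walk u v} (hp : p.IsPath) (hq : q.IsPath)
    (hd : ∀ x ∈ p.support, x ∈ q.support → x = u ∨ x = v) (huv : u ≠ v)
    (hl : 3 ≤ p.length + q.length) :
    ∃ f, IsCyc G f (p.length + q.length) ∧ f 0 = u ∧ f p.length = v ∧
      ∀ i, f i ∈ p.support ∨ f i ∈ q.support := by
  have hq0 : 1 ≤ q.length := by
    rcases Nat.eq_zero_or_pos q.length with h | h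
    · exact absurd (Walk.eq_of_length_eq_zero h) huv
    · exact h
  have hp0 : 1 ≤ p.length := by
    rcases Nat.eq_zero_or_pos p.length with h | h
    · exact absurd (Walk.eq_of_length_eq_zero h) huv
    · exact h
  set a := p.length with ha
  set n := a + q.length with hn
  have hpi : ∀ i ≤ a, ∀ j ≤ a, p.getVert i = p.getVert j → i = j :=
    fun i hi j hj h => hp.getVert_injOn (by simpa using hi) (by simpa using hj) h
  have hqi : ∀ i ≤ q.length, ∀ j ≤ q.length, q.getVert i = q.getVert j → i = j :=
    fun i hi j hj h => hq.getVert_injOn (by simpa using hi) (by simpa using hj) h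
  -- `p` is traversed forwards and `q` backwards; composing with `% n` makes the sequence periodic.
  set g : ℕ → V := fun j => if j ≤ a then p.getVert j else q.getVert (n - j) with hg
  have hg1 : ∀ j ≤ a, g j = p.getVert j := fun j hj => if_pos hj
  have hg2 : ∀ j, a ≤ j → g j = q.getVert (n - j) := by
    intro j hj
    rcases hj.eq_or_lt with rfl | hj
    · rw [hg1 _ le_rfl, hn, Nat.add_sub_cancel_left, Walk.getVert_length, Walk.getVert_length]
    · exact if_neg (by omega)
  have hgn : g n = g 0 := by
    rw [hg2 n (by omega), hg1 0 (by omega)]; simp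
  have hgadj : ∀ j < n, G.Adj (g j) (g (j + 1)) := by
    intro j hj
    rcases Nat.lt_or_ge j a with h | h
    · rw [hg1 j h.le, hg1 (j + 1) h]
      exact p.adj_getVert_succ h
    · rw [hg2 j h, hg2 (j + 1) (by omega)]
      have := q.adj_getVert_succ (i := n - (j + 1)) (by omega)
      rw [show n - (j + 1) + 1 = n - j by omega] at this
      exact this.symm
  have hmix : ∀ i ≤ a, ∀ j, a < j → j < n → g i ≠ g j := by
    intro i hi j hj hjn h
    rw [hg1 i hi, hg2 j hj.le] at h
    rcases hd _ (p.getVert_mem_support i) (h ▸ q.getVert_mem_support _) with h0 | h0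
    · have := hqi (n - j) (by omega) 0 (by omega) (by rw [← h, h0]; simp)
      omega
    · have := hqi (n - j) (by omega) q.length le_rfl (by rw [← h, h0]; simp)
      omega
  refine ⟨fun i => g (i % n), ⟨hl, ?_, ?_, ?_⟩, ?_, ?_, ?_⟩
  · intro i; simp
  · intro i hi j hj h
    simp only [Nat.mod_eq_of_lt hi, Nat.mod_eq_of_lt hj] at h
    rcases Nat.lt_or_ge a i with h1 | h1 <;> rcases Nat.lt_or_ge a j with h2 | h2
    · rw [hg2 i h1.le, hg2 j h2.le] at h
      have := hqi _ (by omega) _ (by omega) h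
      omega
    · exact absurd h.symm (hmix j h2 i h1 hi)
    · exact absurd h (hmix i h1 j h2 hj)
    · rw [hg1 i h1, hg1 j h2] at h
      exact hpi _ h1 _ h2 h
  · intro i
    have hi : i % n < n := Nat.mod_lt _ (by omega)
    have := hgadj _ hi
    rcases Nat.lt_or_ge (i % n + 1) n with h | h
    · have e : (i + 1) % n = i % n + 1 := by
        rw [Nat.add_mod, Nat.mod_eq_of_lt (show 1 < n by omega), Nat.mod_eq_of_lt h]
      simpa only [e] using this
    · have e1 : i % n + 1 = n := by omega
      have e : (i + 1) % n = 0 := by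
        rw [Nat.add_mod, Nat.mod_eq_of_lt (show 1 < n by omega), e1, Nat.mod_self]
      rw [e1, hgn] at this
      simpa only [e] using this
  · show g (0 % n) = u
    rw [Nat.zero_mod, hg1 0 (by omega)]; simp
  · show g (a % n) = v
    rw [Nat.mod_eq_of_lt (by omega), hg1 a le_rfl, ha, Walk.getVert_length]
  · intro i
    show g (i % n) ∈ _ ∨ g (i % n) ∈ _
    rcases Nat.lt_or_ge a (i % n) with h | h
    · right; rw [hg2 _ h.le]; exact q.getVert_mem_support _
    · left; rw [hg1 _ h]; exact p.getVert_mem_support _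

end IsCyc

/-- The class of graphs without certain (not necessarily induced) subgraphs. -/
structure Good (G : SimpleGraph V) : Prop where
  cyc : ∀ f n, IsCyc G f n → n = 3 ∨ 4 ∣ n
  -- The two outside neighbours may coincide. As `n` is even, the parity of `j` depends only on the
  -- vertex `f j`.
  attach : ∀ f n j, IsCyc G f n → 4 ∣ n → Odd j → (∃ w, w ∉ Set.range f ∧ G.Adj (f 0) w) →
    (∃ w, w ∉ Set.range f ∧ G.Adj (f j) w) → False
  diamond : ∀ a b c d p q, [a, b, c, d, p, q].Nodup → G.Adj a b → G.Adj a c → G.Adj a d →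
    G.Adj b c → G.Adj b d → G.Adj c p → G.Adj d q → False
  net : ∀ a b c p q r, [a, b, c, p, q, r].Nodup → G.Adj a b → G.Adj a c → G.Adj b c →
    G.Adj a p → G.Adj b q → G.Adj c r → False
  long : ∀ a b c x x' y y', [a, b, c, x, x', y, y'].Nodup → G.Adj a b → G.Adj a c → G.Adj b c →
    G.Adj a x → G.Adj x x' → G.Adj b y → G.Adj y y' → False

lemma IsCyc.map {U : Type*} {K : SimpleGraph U} {f : ℕ → U} {n : ℕ} (h : IsCyc K f n) (φ : K ↪g G) :
    IsCyc G (φ ∘ f) n where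
  three_le := h.three_le
  periodic i := by simp [h.periodic]
  inj i hi j hj hij := h.inj i hi j hj (φ.injective hij)
  adj i := φ.map_adj_iff.2 (h.adj i)

lemma Good.comap {U : Type*} {K : SimpleGraph U} (h : Good G) (φ : K ↪g G) : Good K where
  cyc f n hf := h.cyc _ n (hf.map φ)
  attach f n j hf hn hj h0 h1 := by
    refine h.attach _ n j (hf.map φ) hn hj ?_ ?_
    · obtain ⟨w, hw, hw'⟩ := h0
      refine ⟨φ w, ?_, φ.map_adj_iff.2 hw'⟩
      rintro ⟨i, hi⟩
      exact hw ⟨i, φ.injective hi⟩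
    · obtain ⟨w, hw, hw'⟩ := h1
      refine ⟨φ w, ?_, φ.map_adj_iff.2 hw'⟩
      rintro ⟨i, hi⟩
      exact hw ⟨i, φ.injective hi⟩
  diamond a b c d p q hn h1 h2 h3 h4 h5 h6 h7 :=
    h.diamond (φ a) (φ b) (φ c) (φ d) (φ p) (φ q) (hn.map φ.injective)
      (φ.map_adj_iff.2 h1) (φ.map_adj_iff.2 h2) (φ.map_adj_iff.2 h3) (φ.map_adj_iff.2 h4)
      (φ.map_adj_iff.2 h5) (φ.map_adj_iff.2 h6) (φ.map_adj_iff.2 h7)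
  net a b c p q r hn h1 h2 h3 h4 h5 h6 :=
    h.net (φ a) (φ b) (φ c) (φ p) (φ q) (φ r) (hn.map φ.injective)
      (φ.map_adj_iff.2 h1) (φ.map_adj_iff.2 h2) (φ.map_adj_iff.2 h3) (φ.map_adj_iff.2 h4)
      (φ.map_adj_iff.2 h5) (φ.map_adj_iff.2 h6)
  long a b c x x' y y' hn h1 h2 h3 h4 h5 h6 h7 :=
    h.long (φ a) (φ b) (φ c) (φ x) (φ x') (φ y) (φ y') (hn.map φ.injective)
      (φ.map_adj_iff.2 h1) (φ.map_adj_iff.2 h2) (φ.map_adj_iff.2 h3) (φ.map_adj_iff.2 h4)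
      (φ.map_adj_iff.2 h5) (φ.map_adj_iff.2 h6) (φ.map_adj_iff.2 h7)

/-- The two cycle conditions of `Good` for a cycle given by two paths. -/
lemma Good.cyc_paths (hG : Good G) {u v : V} {p q : G.Walk u v} (hp : p.IsPath) (hq : q.IsPath)
    (hd : ∀ x ∈ p.support, x ∈ q.support → x = u ∨ x = v) (huv : u ≠ v)
    (hl : 3 ≤ p.length + q.length) : p.length + q.length = 3 ∨ 4 ∣ p.length + q.length := by
  obtain ⟨f, hf, -⟩ := IsCyc.of_paths hp hq hd huv hl
  exact hG.cyc f _ hf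

lemma Good.attach_paths (hG : Good G) {u v w w' : V} {p q : G.Walk u v} (hp : p.IsPath)
    (hq : q.IsPath) (hd : ∀ x ∈ p.support, x ∈ q.support → x = u ∨ x = v) (huv : u ≠ v)
    (hl : 3 ≤ p.length + q.length) (h4 : 4 ∣ p.length + q.length) (ho : Odd p.length)
    (hw : w ∉ p.support ∧ w ∉ q.support) (hw' : w' ∉ p.support ∧ w' ∉ q.support)
    (huw : G.Adj u w) (hvw : G.Adj v w') : False := by
  obtain ⟨f, hf, h0, h1, hr⟩ := IsCyc.of_paths hp hq hd huv hl
  refine hG.attach f _ p.length hf h4 ho ⟨w, ?_, by rwa [h0]⟩ ⟨w', ?_, by rwa [h1]⟩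
  · rintro ⟨i, rfl⟩
    exact (hr i).elim hw.1 hw.2
  · rintro ⟨i, rfl⟩
    exact (hr i).elim hw'.1 hw'.2

end Basics

/-! ### Two-connected vertex sets, ears, common cycles, and blocks -/

section TwoConnected
variable {V : Type u} {G : SimpleGraph V}

lemma isPath_append {u v w : V} {p : G.Walk u v} {q : G.Walk v w} (hp : p.IsPath) (hq : q.IsPath)
    (hd : ∀ x ∈ p.support, x ∈ q.support → x = v) : (p.append q).IsPath := by
  rw [Walk.isPath_def, Walk.support_append, List.nodup_append']
  refine ⟨hp.support_nodup, hq.support_nodup.tail, ?_⟩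
  intro x hx hx'
  have := hd x hx (List.mem_of_mem_tail hx')
  subst this
  have hn := hq.support_nodup
  rw [← q.cons_tail_support] at hn
  exact (List.nodup_cons.1 hn).1 hx'

lemma eq_of_mem_take_drop [DecidableEq V] {u v y x : V} {p : G.Walk u v} (hp : p.IsPath)
    (hy : y ∈ p.support) (h1 : x ∈ (p.takeUntil y hy).support)
    (h2 : x ∈ (p.dropUntil y hy).support) : x = y := by
  have hn := hp.support_nodup
  rw [← p.take_spec hy, Walk.support_append, List.nodup_append'] at hn
  rw [← (p.dropUntil y hy).cons_tail_support, List.mem_cons] at h2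
  exact h2.resolve_right fun h => hn.2.2 h1 h

/-- The vertex `x` lies on at most one of the two halves into which `y` divides the path, so the
other half survives the deletion of `x`. -/
lemma conn_of_isPath {u v x y : V} {p : G.Walk u v} (hp : p.IsPath) (hy : y ∈ p.support)
    (hxy : y ≠ x) : Conn G ({w | w ∈ p.support} \ {x}) y u ∨
      Conn G ({w | w ∈ p.support} \ {x}) y v := by
  classical
  by_cases h : x ∈ (p.takeUntil y hy).support
  · right
    refine ⟨p.dropUntil y hy, fun w hw => ⟨p.support_dropUntil_subset_support hy hw, ?_⟩⟩
    rintro rfl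
    exact hxy (eq_of_mem_take_drop hp hy h hw).symm
  · left
    refine Conn.symm ⟨p.takeUntil y hy, fun w hw =>
      ⟨p.support_takeUntil_subset_support hy hw, ?_⟩⟩
    rintro rfl
    exact h hw

/-- The set `B` induces a connected graph without cutvertex (or is empty). -/
def TwoConn (G : SimpleGraph V) (B : Set V) : Prop :=
  (∀ u ∈ B, ∀ v ∈ B, Conn G B u v) ∧
    ∀ x, ∀ u ∈ B, ∀ v ∈ B, u ≠ x → v ≠ x → Conn G (B \ {x}) u v

lemma exists_ne_ne {B : Set V} (h : 2 < B.ncard) (x y : V) : ∃ z ∈ B, z ≠ x ∧ z ≠ y := by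
  by_contra! hc
  have hs : B ⊆ {x, y} := by
    intro z hz
    by_cases hzx : z = x
    · exact Or.inl hzx
    · exact Or.inr (hc z hz hzx)
  have := Set.ncard_le_ncard hs
  have h2 := Set.ncard_insert_le x {y}
  rw [Set.ncard_singleton] at h2
  omega

lemma Conn.exists_adj {S : Set V} {u v : V} (h : Conn G S u v) (huv : u ≠ v) :
    ∃ s ∈ S, G.Adj u s := by
  obtain ⟨p, hp⟩ := h
  cases p with
  | nil => exact absurd rfl huv
  | cons h p => exact ⟨_, hp _ (by simp), h⟩

namespace TwoConn
variable {B : Set V}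

lemma exists_two_adj (h : TwoConn G B) (hB : 2 < B.ncard) {u : V} (hu : u ∈ B) :
    ∃ s ∈ B, ∃ t ∈ B, s ≠ t ∧ G.Adj u s ∧ G.Adj u t := by
  obtain ⟨v, hv, hvu, -⟩ := exists_ne_ne hB u u
  obtain ⟨s, hs, hus⟩ := (h.1 u hu v hv).exists_adj hvu.symm
  obtain ⟨w, hw, hwu, hws⟩ := exists_ne_ne hB u s
  obtain ⟨t, ht, hut⟩ := (h.2 s u hu w hw hus.ne hws).exists_adj hwu.symm
  exact ⟨s, hs, t, ht.1, fun e => ht.2 e.symm, hus, hut⟩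

/-- After the deletion of any vertex, each vertex of the added path still reaches one of the ends in
`B`. Combined with the maximality of a block, this forbids paths that leave the block and come back
elsewhere. -/
lemma union_path (h : TwoConn G B) {u v : V} (hu : u ∈ B) (hv : v ∈ B)
    {p : G.Walk u v} (hp : p.IsPath) : TwoConn G (B ∪ {x | x ∈ p.support}) := by
  have hsub : B ⊆ B ∪ {x | x ∈ p.support} := Set.subset_union_left
  constructor
  · have : ∀ y ∈ B ∪ {x | x ∈ p.support}, Conn G (B ∪ {x | x ∈ p.support}) y u := by
      classical
      rintro y (hy | hy)
      · exact (h.1 y hy u hu).mono hsub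
      · exact (Conn.symm ⟨p.takeUntil y hy, fun w hw =>
          p.support_takeUntil_subset_support hy hw⟩ :
            Conn G {x | x ∈ p.support} y u).mono Set.subset_union_right
    exact fun y hy z hz => (this y hy).trans (this z hz).symm
  · intro x
    have h1 : ∀ y ∈ B ∪ {x | x ∈ p.support}, y ≠ x →
        ∃ b ∈ B, b ≠ x ∧ Conn G ((B ∪ {x | x ∈ p.support}) \ {x}) y b := by
      rintro y (hy | hy) hyx
      · exact ⟨y, hy, hyx, Conn.refl ⟨Or.inl hy, hyx⟩⟩
      · have hs : {w | w ∈ p.support} \ {x} ⊆ (B ∪ {x | x ∈ p.support}) \ {x} :=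
          Set.sdiff_subset_sdiff_left Set.subset_union_right
        rcases conn_of_isPath hp hy hyx with h | h
        · exact ⟨u, hu, h.mem_right.2, h.mono hs⟩
        · exact ⟨v, hv, h.mem_right.2, h.mono hs⟩
    intro y hy z hz hyx hzx
    obtain ⟨b, hb, hbx, hyb⟩ := h1 y hy hyx
    obtain ⟨c, hc, hcx, hzc⟩ := h1 z hz hzx
    exact (hyb.trans ((h.2 x b hb c hc hbx hcx).mono
      (Set.sdiff_subset_sdiff_left hsub))).trans hzc.symm

/-- A proper subset with at least two elements of a two-connected set has an ear. -/
lemma exists_ear (h : TwoConn G B) {T : Set V} (hTB : T ⊆ B) (hT : T.Nontrivial)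
    (hne : ¬ B ⊆ T) : ∃ s ∈ T, ∃ t ∈ T, s ≠ t ∧ ∃ p : G.Walk s t, p.IsPath ∧ 2 ≤ p.length ∧
      (∀ x ∈ p.support, x ∈ B) ∧ ∀ x ∈ p.support, x ∈ T → x = s ∨ x = t := by
  have h1 : ∃ s ∈ T, ∃ w ∈ B, w ∉ T ∧ G.Adj s w := by
    by_contra! hc
    obtain ⟨a, ha⟩ := hT.nonempty
    refine hne fun b hb => (h.1 a (hTB ha) b hb).mem_of_closed ha fun x hx y hy hxy => ?_
    by_contra hyT
    exact hc x hx y hy hyT hxy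
  obtain ⟨s, hs, w, hw, hwT, hsw⟩ := h1
  obtain ⟨a, ha, has⟩ := hT.exists_ne s
  -- From a vertex `w` just outside of `T`, walk to the first vertex of `T`. The walk avoids `s`,
  -- which makes the ends of the ear distinct.
  obtain ⟨t, ht, q, hq, hqS, hqT⟩ :=
    (h.2 s w hw a (hTB ha) hsw.ne' has).exists_path_first ha
  refine ⟨s, hs, t, ht, ?_, Walk.cons hsw q, ?_, ?_, ?_, ?_⟩
  · rintro rfl
    exact (hqS _ q.end_mem_support).2 rfl
  · rw [Walk.cons_isPath_iff]
    exact ⟨hq, fun hs => (hqS _ hs).2 rfl⟩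
  · rw [Walk.length_cons]
    have : q.length ≠ 0 := fun h0 => hwT (Walk.eq_of_length_eq_zero h0 ▸ ht)
    omega
  · intro x hx
    rw [Walk.support_cons, List.mem_cons] at hx
    rcases hx with rfl | hx
    · exact hTB hs
    · exact (hqS x hx).1
  · intro x hx hxT
    rw [Walk.support_cons, List.mem_cons] at hx
    exact hx.imp id fun hx => hqT x hx hxT

/-- There are two internally disjoint paths from `u` to `v` in `B`, which form a cycle. -/
def CyclePair (G : SimpleGraph V) (B : Set V) {u v : V} (p q : G.Walk u v) : Prop :=
  p.IsPath ∧ q.IsPath ∧ (∀ x ∈ p.support, x ∈ q.support → x = u ∨ x = v) ∧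
    (∀ x ∈ p.support, x ∈ B) ∧ (∀ x ∈ q.support, x ∈ B) ∧ 3 ≤ p.length + q.length

lemma CyclePair.symm {u v : V} {p q : G.Walk u v} (h : CyclePair G B p q) : CyclePair G B q p :=
  ⟨h.2.1, h.1, fun x h1 h2 => h.2.2.1 x h2 h1, h.2.2.2.2.1, h.2.2.2.1, by
    have := h.2.2.2.2.2; omega⟩

lemma length_pos_of_ne {u v : V} (p : G.Walk u v) (h : u ≠ v) : 1 ≤ p.length := by
  rcases Nat.eq_zero_or_pos p.length with h0 | h0
  · exact absurd (Walk.eq_of_length_eq_zero h0) h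
  · exact h0

/-- The cycle through `u` and `s` contains `w ≠ u`, hence it is a cycle through `u` and `w`. -/
lemma CyclePair.of_mem {u s w : V} {p q : G.Walk u s} (h : CyclePair G B p q) (hw : w ∈ p.support)
    (hwu : w ≠ u) : ∃ p' q' : G.Walk u w, CyclePair G B p' q' := by
  classical
  obtain ⟨hp, hq, hd, hpB, hqB, hl⟩ := h
  have hspec := congrArg Walk.length (p.take_spec hw)
  rw [Walk.length_append] at hspec
  refine ⟨p.takeUntil w hw, q.append (p.dropUntil w hw).reverse, hp.takeUntil hw,
    isPath_append hq (hp.dropUntil hw).reverse ?_, ?_, ?_, ?_, ?_⟩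
  · intro x hx hx'
    rw [Walk.support_reverse, List.mem_reverse] at hx'
    rcases hd x (p.support_dropUntil_subset_support hw hx') hx with rfl | rfl
    · exact absurd (eq_of_mem_take_drop hp hw (Walk.start_mem_support _) hx').symm hwu
    · rfl
  · intro x hx hx'
    rw [Walk.mem_support_append_iff, Walk.support_reverse, List.mem_reverse] at hx'
    rcases hx' with hx' | hx'
    · rcases hd x (p.support_takeUntil_subset_support hw hx) hx' with rfl | rfl
      · exact Or.inl rfl
      · exact Or.inr (eq_of_mem_take_drop hp hw hx (Walk.end_mem_support _))
    · exact Or.inr (eq_of_mem_take_drop hp hw hx hx')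
  · exact fun x hx => hpB x (p.support_takeUntil_subset_support hw hx)
  · intro x hx
    rw [Walk.mem_support_append_iff, Walk.support_reverse, List.mem_reverse] at hx
    exact hx.elim (hqB x) fun h => hpB x (p.support_dropUntil_subset_support hw h)
  · rw [Walk.length_append, Walk.length_reverse]
    omega

/-- The edge `sw` followed by `r` is a detour from `s` to a vertex `t` of `p`. One path runs along
`p` to `t` and back along `r` to `w`; the other runs along `q` to `s` and uses the edge `sw`. -/
lemma CyclePair.of_ear {u s w t : V} {p q : G.Walk u s} (h : CyclePair G B p q) (hus : u ≠ s)
    (hsw : G.Adj s w)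
    (hwB : w ∈ B) (hwp : w ∉ p.support) (hwq : w ∉ q.support) (ht : t ∈ p.support) (hts : t ≠ s)
    {r : G.Walk w t} (hr : r.IsPath) (hrB : ∀ x ∈ r.support, x ∈ B \ {s})
    (hrC : ∀ x ∈ r.support, x ∈ p.support ∨ x ∈ q.support → x = t) :
    ∃ p' q' : G.Walk u w, CyclePair G B p' q' := by
  classical
  obtain ⟨hp, hq, hd, hpB, hqB, hl⟩ := h
  have hwt : w ≠ t := fun e => hwp (e ▸ ht)
  refine ⟨(p.takeUntil t ht).append r.reverse, q.append (Walk.cons hsw Walk.nil),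
    isPath_append (hp.takeUntil ht) hr.reverse ?_, isPath_append hq ?_ ?_, ?_, ?_, ?_, ?_⟩
  · intro x hx hx'
    rw [Walk.support_reverse, List.mem_reverse] at hx'
    exact hrC x hx' (Or.inl (p.support_takeUntil_subset_support ht hx))
  · simp [hsw.ne]
  · intro x hx hx'
    simp only [Walk.support_cons, Walk.support_nil, List.mem_cons, List.not_mem_nil, or_false] at hx'
    rcases hx' with rfl | rfl
    · rfl
    · exact absurd hx hwq
  · intro x hx hx'
    rw [Walk.mem_support_append_iff] at hx hx'
    rw [Walk.support_reverse, List.mem_reverse] at hx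
    simp only [Walk.support_cons, Walk.support_nil, List.mem_cons, List.not_mem_nil,
      or_false] at hx'
    have hsx : x ≠ s := by
      rintro rfl
      rcases hx with hx | hx
      · exact hts (eq_of_mem_take_drop hp ht hx (Walk.end_mem_support _)).symm
      · exact (hrB _ hx).2 rfl
    rcases hx' with hx' | rfl | rfl
    · rcases hx with hx | hx
      · exact (hd x (p.support_takeUntil_subset_support ht hx) hx').imp id fun e => absurd e hsx
      · have e := hrC x hx (Or.inr hx')
        subst e
        exact (hd x ht hx').imp id fun e => absurd e hsx
    · exact absurd rfl hsx
    · exact Or.inr rfl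
  · intro x hx
    rw [Walk.mem_support_append_iff, Walk.support_reverse, List.mem_reverse] at hx
    exact hx.elim (fun h => hpB x (p.support_takeUntil_subset_support ht h)) fun h => (hrB x h).1
  · intro x hx
    rw [Walk.mem_support_append_iff] at hx
    simp only [Walk.support_cons, Walk.support_nil, List.mem_cons, List.not_mem_nil,
      or_false] at hx
    rcases hx with hx | rfl | rfl
    · exact hqB x hx
    · exact hqB _ q.end_mem_support
    · exact hwB
  · rw [Walk.length_append, Walk.length_append, Walk.length_reverse, Walk.length_cons,
      Walk.length_nil]
    have := length_pos_of_ne q hus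
    have := length_pos_of_ne r hwt
    omega

/-- Any two vertices of a two-connected set lie on a common cycle. -/
lemma exists_cyclePair (h : TwoConn G B) (hB : 2 < B.ncard) {u v : V} (hu : u ∈ B) (hv : v ∈ B)
    (huv : u ≠ v) : ∃ p q : G.Walk u v, CyclePair G B p q := by
  -- It suffices that the set of vertices on a common cycle with `u`, together with `u`, is closed
  -- under taking neighbours in `B`.
  suffices hs : v ∈ {w | w = u ∨ ∃ p q : G.Walk u w, CyclePair G B p q} from
    hs.resolve_left huv.symm
  refine (h.1 u hu v hv).mem_of_closed (Or.inl rfl) ?_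
  intro s hs w hw hsw
  by_cases hwu : w = u
  · exact Or.inl hwu
  right
  by_cases hsu : s = u
  · subst hsu
    obtain ⟨a, ha, b, hb, hab, hsa, hsb⟩ := h.exists_two_adj hB hu
    obtain ⟨t, ht, htw, hst⟩ : ∃ t ∈ B, t ≠ w ∧ G.Adj s t := by
      by_cases haw : a = w
      · exact ⟨b, hb, fun e => hab (haw.trans e.symm), hsb⟩
      · exact ⟨a, ha, haw, hsa⟩
    obtain ⟨r, hr, hrB⟩ := (h.2 s t ht w hw hst.ne' hwu).exists_path
    refine ⟨Walk.cons hsw Walk.nil, Walk.cons hst r, by simp [hsw.ne], ?_, ?_, ?_, ?_, ?_⟩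
    · rw [Walk.cons_isPath_iff]
      exact ⟨hr, fun hx => (hrB _ hx).2 rfl⟩
    · intro x hx _
      simpa using hx
    · intro x hx
      simp only [Walk.support_cons, Walk.support_nil, List.mem_cons, List.not_mem_nil,
        or_false] at hx
      rcases hx with rfl | rfl
      exacts [hu, hw]
    · intro x hx
      rw [Walk.support_cons, List.mem_cons] at hx
      rcases hx with rfl | hx
      exacts [hu, (hrB x hx).1]
    · have := length_pos_of_ne r htw
      simp only [Walk.length_cons, Walk.length_nil]
      omega
  · obtain ⟨p, q, hpq⟩ := hs.resolve_left hsu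
    by_cases hwp : w ∈ p.support
    · exact hpq.of_mem hwp hwu
    by_cases hwq : w ∈ q.support
    · exact hpq.symm.of_mem hwq hwu
    -- Avoiding `s`, go from `w` towards `u` and stop at the first vertex of the known cycle through
    -- `u` and `s`.
    obtain ⟨t, ht, r, hr, hrB, hrC⟩ :=
      (h.2 s w hw u hu hsw.ne' (Ne.symm hsu)).exists_path_first
        (B := {x | x ∈ p.support ∨ x ∈ q.support}) (Or.inl p.start_mem_support)
    have hts : t ≠ s := (hrB _ r.end_mem_support).2
    rcases ht with ht | ht
    · exact hpq.of_ear (Ne.symm hsu) hsw hw hwp hwq ht hts hr hrB hrC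
    · exact hpq.symm.of_ear (Ne.symm hsu) hsw hw hwq hwp ht hts hr hrB
        fun x hx h => hrC x hx h.symm

end TwoConn

/-- `B` is a maximal two-connected subset of `W` and has at least three elements. -/
structure IsBlk (G : SimpleGraph V) (W B : Set V) : Prop where
  subset : B ⊆ W
  two_conn : TwoConn G B
  card : 2 < B.ncard
  max : ∀ B', B ⊆ B' → B' ⊆ W → TwoConn G B' → B' ⊆ B

namespace IsBlk
variable {W B : Set V}

/-- A connected set outside of a block has neighbours in at most one vertex of the block. -/
lemma eq_of_conn (h : IsBlk G W B) {K : Set V} (hK : K ⊆ W \ B) {s t k k' : V} (hs : s ∈ B)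
    (ht : t ∈ B) (hsk : G.Adj s k) (htk : G.Adj t k') (hkk : Conn G K k k') : s = t := by
  by_contra hst
  obtain ⟨p, hp, hpK⟩ := hkk.exists_path
  have hsK : s ∉ p.support := fun hx => (hK (hpK s hx)).2 hs
  have htK : t ∉ p.support := fun hx => (hK (hpK t hx)).2 ht
  have hq : ((Walk.cons hsk p).append (Walk.cons htk.symm Walk.nil)).IsPath := by
    refine isPath_append ?_ (by simp [htk.ne']) ?_
    · rw [Walk.cons_isPath_iff]
      exact ⟨hp, hsK⟩
    · intro x hx hx'
      simp only [Walk.support_cons, Walk.support_nil, List.mem_cons, List.not_mem_nil,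
        or_false] at hx hx'
      rcases hx' with rfl | rfl
      · rfl
      · rcases hx with rfl | hx
        · exact absurd rfl hst
        · exact absurd hx htK
  -- The path from `s` through `K` to `t` could be added to `B`, against maximality.
  have hk : k ∈ B := by
    refine h.max _ Set.subset_union_left ?_ (h.two_conn.union_path hs ht hq) (Or.inr ?_)
    · rintro x (hx | hx)
      · exact h.subset hx
      · simp only [Set.mem_ofPred_eq, Walk.mem_support_append_iff, Walk.support_cons,
          Walk.support_nil, List.mem_cons, List.not_mem_nil, or_false] at hx
        rcases hx with (rfl | hx) | rfl | rfl
        · exact h.subset hs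
        · exact (hK (hpK x hx)).1
        · exact (hK hkk.mem_right).1
        · exact h.subset ht
    · simp [Walk.mem_support_append_iff]
  exact (hK hkk.mem_left).2 hk

lemma eq_of_adj (h : IsBlk G W B) {s t k : V} (hs : s ∈ B) (ht : t ∈ B) (hkW : k ∈ W) (hk : k ∉ B)
    (hsk : G.Adj s k) (htk : G.Adj t k) : s = t :=
  h.eq_of_conn (K := {k}) (by rintro x rfl; exact ⟨hkW, hk⟩) hs ht hsk htk (Conn.refl rfl)

lemma exists_of_twoConn [Finite V] {C : Set V} (hC : TwoConn G C) (hCW : C ⊆ W)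
    (hc : 2 < C.ncard) : ∃ B, IsBlk G W B ∧ C ⊆ B := by
  obtain ⟨B, hCB, hB⟩ := (Set.toFinite {B : Set V | B ⊆ W ∧ TwoConn G B}).exists_le_maximal
    (show C ∈ _ from ⟨hCW, hC⟩)
  refine ⟨B, ⟨hB.prop.1, hB.prop.2, ?_, fun B' h1 h2 h3 => hB.le_of_ge ⟨h2, h3⟩ h1⟩, hCB⟩
  exact hc.trans_le (Set.ncard_le_ncard hCB (Set.toFinite B))

end IsBlk

end TwoConnected

/-! ### Triangle-free blocks are subdivisions of bipartite multigraphs -/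

section TriangleFree
variable {V : Type u} {G : SimpleGraph V}

/-- The hypothesis says that cycles are even. `Walk.bypass` turns a walk into a path by cutting out
closed pieces, each consisting of an edge and a path between its ends; these have even length. Hence
parity is preserved and closed walks are even. -/
lemma exists_coloring_of_odd_paths {U : Type*} {K : SimpleGraph U}
    (h : ∀ u v (p : K.Walk v u), p.IsPath → K.Adj u v → Odd p.length) :
    ∃ c : U → Bool, ∀ x y, K.Adj x y → c x ≠ c y := by
  classical
  have key : ∀ {u v : U} (p : K.Walk u v), Even p.length ↔ Even p.bypass.length := by
    intro u v p
    induction p with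
    | nil => simp [Walk.bypass]
    | @cons u w v huw p ih =>
      rw [Walk.length_cons, Walk.bypass]
      split_ifs with hu
      · have h1 := h u w (p.bypass.takeUntil u hu) (p.bypass_isPath.takeUntil hu) huw
        have h2 := congrArg Walk.length (p.bypass.take_spec hu)
        rw [Walk.length_append] at h2
        rw [← h2] at ih
        simp only [Nat.even_iff, Nat.odd_iff] at *
        omega
      · rw [Walk.length_cons]
        simp only [Nat.even_iff] at *
        omega
  have h2 : K.Colorable 2 := two_colorable_iff_forall_loop_even.2 fun u w => by
    rw [key, Walk.length_eq_zero_iff.2 (Walk.isPath_iff_nil.1 w.bypass_isPath)]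
    simp
  obtain ⟨c⟩ := h2
  refine ⟨fun x => finTwoEquiv (c x), fun x y hxy h => ?_⟩
  exact c.valid hxy (finTwoEquiv.injective h)

lemma even_length_iff {B : Set V} {c : V → Bool}
    (hc : ∀ x ∈ B, ∀ y ∈ B, G.Adj x y → c x ≠ c y) {u v : V} (p : G.Walk u v)
    (hp : ∀ x ∈ p.support, x ∈ B) : Even p.length ↔ c u = c v := by
  induction p with
  | nil => simp
  | @cons u w v h p ih =>
    have h1 := hc u (hp u (by simp)) w (hp w (by simp)) h
    have h2 := ih fun x hx => hp x (by simp [hx])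
    rw [Walk.length_cons, Nat.even_add_one, h2]
    revert h1
    cases c u <;> cases c w <;> cases c v <;> simp

/-- `B` contains no triangle of `G`. -/
def TriFree (G : SimpleGraph V) (B : Set V) : Prop :=
  ∀ a ∈ B, ∀ b ∈ B, ∀ c ∈ B, G.Adj a b → G.Adj b c → G.Adj c a → False

open TwoConn

variable {B W : Set V}

lemma TriFree.four_dvd (hB : TriFree G B) (hG : Good G) {u v : V} {p q : G.Walk u v}
    (h : CyclePair G B p q) (huv : u ≠ v) : 4 ∣ p.length + q.length := by
  obtain ⟨hp, hq, hd, hpB, hqB, hl⟩ := h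
  obtain ⟨f, hf, -, -, hr⟩ := IsCyc.of_paths hp hq hd huv hl
  refine (hG.cyc f _ hf).resolve_left fun h3 => ?_
  have hfB : ∀ i, f i ∈ B := fun i => (hr i).elim (hpB _) (hqB _)
  have h30 : f 3 = f 0 := by
    rw [h3] at hf
    exact hf.periodic 0
  exact hB _ (hfB 0) _ (hfB 1) _ (hfB 2) (hf.adj 0) (hf.adj 1) (h30 ▸ hf.adj 2)

/-- The cycles of a triangle-free set have no chord. -/
lemma TriFree.eq_of_adj (hB : TriFree G B) (hG : Good G) {u v w : V} {p q : G.Walk u v}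
    (h : CyclePair G B p q) (huv : u ≠ v) (huw : G.Adj u w) (hw : w ∈ p.support) :
    w = p.getVert 1 ∨ w = q.getVert 1 := by
  classical
  by_contra! hne
  have h4 := hB.four_dvd hG h huv
  obtain ⟨hp, hq, hd, hpB, hqB, hl⟩ := h
  have hspec := congrArg Walk.length (p.take_spec hw)
  rw [Walk.length_append] at hspec
  have hedge : (Walk.cons huw Walk.nil : G.Walk u w).IsPath := by simp [huw.ne]
  have hedgeB : ∀ x ∈ (Walk.cons huw Walk.nil : G.Walk u w).support, x = u ∨ x = w := by simp
  have hedgeB' : ∀ x ∈ (Walk.cons huw Walk.nil : G.Walk u w).support, x ∈ B := by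
    intro x hx
    rcases hedgeB x hx with rfl | rfl
    exacts [hpB _ p.start_mem_support, hpB _ hw]
  have h1 : 2 ≤ (p.takeUntil w hw).length := by
    have h0 := length_pos_of_ne (p.takeUntil w hw) huw.ne
    have h1 : (p.takeUntil w hw).length ≠ 1 := by
      intro h1
      have := Walk.getVert_length_takeUntil hw
      rw [h1] at this
      exact hne.1 this.symm
    omega
  have hq1 := length_pos_of_ne q huv
  have h2 : 2 ≤ q.length + (p.dropUntil w hw).length := by
    by_cases hwv : w = v
    · have h1 : q.length ≠ 1 := by
        intro h1
        have := q.getVert_length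
        rw [h1] at this
        exact hne.2 (hwv.trans this.symm)
      omega
    · have := length_pos_of_ne (p.dropUntil w hw) hwv
      omega
  have c1 : CyclePair G B (p.takeUntil w hw) (Walk.cons huw Walk.nil) :=
    ⟨hp.takeUntil hw, hedge, fun x _ hx => hedgeB x hx,
      fun x hx => hpB x (p.support_takeUntil_subset_support hw hx), hedgeB', by
        rw [Walk.length_cons, Walk.length_nil]; omega⟩
  have c2 : CyclePair G B (q.append (p.dropUntil w hw).reverse) (Walk.cons huw Walk.nil) := by
    refine ⟨isPath_append hq (hp.dropUntil hw).reverse ?_, hedge, fun x _ hx => hedgeB x hx, ?_,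
      hedgeB', ?_⟩
    · intro x hx hx'
      rw [Walk.support_reverse, List.mem_reverse] at hx'
      rcases hd x (p.support_dropUntil_subset_support hw hx') hx with rfl | rfl
      · exact absurd (eq_of_mem_take_drop hp hw (Walk.start_mem_support _) hx') huw.ne
      · rfl
    · intro x hx
      rw [Walk.mem_support_append_iff, Walk.support_reverse, List.mem_reverse] at hx
      exact hx.elim (hqB x) fun h => hpB x (p.support_dropUntil_subset_support hw h)
    · rw [Walk.length_append, Walk.length_reverse, Walk.length_cons, Walk.length_nil]; omega
  -- The chord divides the cycle into two cycles whose lengths add up to two more than the original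
  -- length, so the three lengths cannot all be divisible by 4.
  have d1 := hB.four_dvd hG c1 huw.ne
  have d2 := hB.four_dvd hG c2 huw.ne
  rw [Walk.length_append, Walk.length_reverse, Walk.length_cons, Walk.length_nil] at d2
  rw [Walk.length_cons, Walk.length_nil] at d1
  omega

/-- `x` has at least three neighbours in `W`. -/
def Big (G : SimpleGraph V) (W : Set V) (x : V) : Prop :=
  ∀ s t, ∃ w ∈ W, w ≠ s ∧ w ≠ t ∧ G.Adj x w

/-- As the cycle has no chord, only two neighbours of `u` are on it, and a third one must be
outside. This produces the configuration of `Good.attach`. -/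
lemma Big.exists_outside (hB : TriFree G B) (hG : Good G) {u v : V} (hu : Big G W u)
    {p q : G.Walk u v} (h : CyclePair G B p q) (huv : u ≠ v) :
    ∃ w, (w ∉ p.support ∧ w ∉ q.support) ∧ G.Adj u w := by
  obtain ⟨w, -, hwp, hwq, huw⟩ := hu (p.getVert 1) (q.getVert 1)
  refine ⟨w, ⟨fun hw => ?_, fun hw => ?_⟩, huw⟩
  · exact (hB.eq_of_adj hG h huv huw hw).elim hwp hwq
  · exact (hB.eq_of_adj hG h.symm huv huw hw).elim hwq hwp

lemma CyclePair.reverse {u v : V} {p q : G.Walk u v} (h : CyclePair G B p q) :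
    CyclePair G B p.reverse q.reverse := by
  obtain ⟨hp, hq, hd, hpB, hqB, hl⟩ := h
  refine ⟨hp.reverse, hq.reverse, ?_, ?_, ?_, ?_⟩
  · intro x hx hx'
    rw [Walk.support_reverse, List.mem_reverse] at hx hx'
    exact (hd x hx hx').symm
  · simpa using hpB
  · simpa using hqB
  · simpa using hl

/-- The set `B` is a subdivision `Sub₂(H)` of a bipartite multigraph `H` with parts `A₀` and `A₁`,
where the subdivision vertices `E` have no further neighbours in `W`. -/
structure SubS (G : SimpleGraph V) (W B A₀ A₁ E : Set V) : Prop where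
  union : B = A₀ ∪ A₁ ∪ E
  disj : Disjoint A₀ A₁
  disj₀ : Disjoint A₀ E
  disj₁ : Disjoint A₁ E
  indep : ∀ x ∈ A₀ ∪ A₁, ∀ y ∈ B, G.Adj x y → y ∈ E
  ends : ∀ e ∈ E, ∃ u ∈ A₀, ∃ v ∈ A₁, ∀ y ∈ W, G.Adj e y ↔ y = u ∨ y = v

/-- Each edge of the path in `K` is replaced by a two-edge path through a vertex of `E`. A vertex of
`E` has only two neighbours in `A`, so using it twice would make the path in `K` repeat a vertex.
Thus a cycle of `K` becomes a cycle of `G` of twice the length. -/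
lemma exists_lift {A E : Set V} {K : SimpleGraph V}
    (hK : ∀ x y, K.Adj x y → x ∈ A ∧ y ∈ A ∧ ∃ e ∈ E, G.Adj e x ∧ G.Adj e y)
    (hAE : Disjoint A E)
    (hE : ∀ e ∈ E, ∀ x ∈ A, ∀ y ∈ A, ∀ z ∈ A, G.Adj e x → G.Adj e y → G.Adj e z → y ≠ z →
      x = y ∨ x = z)
    {u v : V} (p : K.Walk u v) (hp : p.IsPath) (hv : v ∈ A) :
    ∃ P : G.Walk u v, P.IsPath ∧ P.length = 2 * p.length ∧ (∀ x ∈ P.support, x ∈ A ∪ E) ∧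
      (∀ x ∈ P.support, x ∈ A → x ∈ p.support) ∧
      ∀ x ∈ P.support, x ∈ E → ∃ a b, s(a, b) ∈ p.edges ∧ G.Adj x a ∧ G.Adj x b := by
  induction p with
  | nil =>
    refine ⟨Walk.nil, by simp, by simp, ?_, by simp, ?_⟩
    · simpa using Or.inl hv
    · intro x hx hxE
      simp only [Walk.support_nil, List.mem_cons, List.not_mem_nil, or_false] at hx
      subst hx
      exact absurd hxE (Set.disjoint_left.1 hAE hv)
  | @cons a b c h p ih =>
    rw [Walk.cons_isPath_iff] at hp
    obtain ⟨P, hP, hl, hAE', hA, hE'⟩ := ih hp.1 hv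
    obtain ⟨ha, hb, e, he, hea, heb⟩ := hK a b h
    have heP : e ∉ P.support := by
      intro heP
      obtain ⟨x, y, hxy, hex, hey⟩ := hE' e heP he
      have hadj := p.adj_of_mem_edges hxy
      have hKxy := hK x y hadj
      rcases hE e he a ha x hKxy.1 y hKxy.2.1 hea hex hey hadj.ne with rfl | rfl
      · exact hp.2 (p.fst_mem_support_of_mem_edges hxy)
      · exact hp.2 (p.snd_mem_support_of_mem_edges hxy)
    refine ⟨Walk.cons hea.symm (Walk.cons heb P), ?_, ?_, ?_, ?_, ?_⟩
    · rw [Walk.cons_isPath_iff, Walk.cons_isPath_iff]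
      refine ⟨⟨hP, heP⟩, ?_⟩
      rw [Walk.support_cons, List.mem_cons, not_or]
      exact ⟨hea.ne', fun haP => hp.2 (hA a haP ha)⟩
    · simp only [Walk.length_cons, hl]; ring
    · intro x hx
      simp only [Walk.support_cons, List.mem_cons] at hx
      rcases hx with rfl | rfl | hx
      exacts [Or.inl ha, Or.inr he, hAE' x hx]
    · intro x hx hxA
      simp only [Walk.support_cons, List.mem_cons] at hx ⊢
      rcases hx with rfl | rfl | hx
      · exact Or.inl rfl
      · exact absurd he (Set.disjoint_left.1 hAE hxA)
      · exact Or.inr (hA x hx hxA)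
    · intro x hx hxE
      simp only [Walk.support_cons, List.mem_cons] at hx
      rcases hx with rfl | rfl | hx
      · exact absurd hxE (Set.disjoint_left.1 hAE ha)
      · exact ⟨a, b, by simp, hea, heb⟩
      · obtain ⟨x', y', h1, h2⟩ := hE' x hx hxE
        exact ⟨x', y', by simp [h1], h2⟩

/-- All cycles in `B` have length divisible by 4, so `B` is bipartite, and the vertices with three
neighbours in `W` share one colour. The other colour class `E` then consists of vertices with
exactly two neighbours in `W`, that is, subdivision vertices. Cycles of the multigraph on the
remaining class `A` have half the length of cycles of `B`, hence even length, which splits `A` into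
`A₀` and `A₁`. -/
lemma Good.exists_subS (hG : Good G) (h : IsBlk G W B) (hB : TriFree G B) :
    ∃ A₀ A₁ E, SubS G W B A₀ A₁ E := by
  classical
  -- the bipartition of `B`
  obtain ⟨c, hc⟩ : ∃ c : V → Bool, ∀ x ∈ B, ∀ y ∈ B, G.Adj x y → c x ≠ c y := by
    let K : SimpleGraph V :=
      { Adj := fun x y => G.Adj x y ∧ x ∈ B ∧ y ∈ B
        symm := ⟨fun x y h => ⟨h.1.symm, h.2.2, h.2.1⟩⟩
        loopless := ⟨fun x h => G.loopless.irrefl x h.1⟩ }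
    have hKG : K ≤ G := fun x y h => h.1
    obtain ⟨c, hc⟩ := exists_coloring_of_odd_paths (K := K) (by
      intro u v p hp huv
      by_cases h1 : p.length = 1
      · rw [h1]; exact odd_one
      have h0 := length_pos_of_ne p huv.ne'
      have hpB : ∀ x ∈ p.support, x ∈ B := by
        have : ∀ {u v : V} (p : K.Walk u v), v ∈ B → ∀ x ∈ p.support, x ∈ B := by
          intro u v p hv
          induction p with
          | nil => simpa using hv
          | cons h p ih =>
            intro x hx
            rw [Walk.support_cons, List.mem_cons] at hx
            rcases hx with rfl | hx
            exacts [h.2.1, ih hv x hx]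
        exact this p huv.2.1
      have := hB.four_dvd hG (p := p.mapLe hKG) (q := Walk.cons huv.1.symm Walk.nil)
        ⟨hp.mapLe hKG, by simp [huv.1.ne'], by simp, by simpa using hpB,
          by simpa using ⟨huv.2.2, huv.2.1⟩, by simp; omega⟩ huv.ne'
      simp only [Walk.length_mapLe, Walk.length_cons, Walk.length_nil] at this
      rw [Nat.odd_iff]; omega)
    exact ⟨c, fun x hx y hy hxy => hc x y ⟨hxy, hx, hy⟩⟩
  -- Vertices of different colours have odd distance along a common cycle, and both have neighbours
  -- outside of it: the configuration of `Good.attach`.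
  have hbig : ∀ x ∈ B, ∀ y ∈ B, Big G W x → Big G W y → c x = c y := by
    intro x hx y hy hbx hby
    by_contra hne
    have hxy : x ≠ y := fun e => hne (e ▸ rfl)
    obtain ⟨p, q, hpq⟩ := h.two_conn.exists_cyclePair h.card hx hy hxy
    obtain ⟨w, hw, hxw⟩ := hbx.exists_outside hB hG hpq hxy
    obtain ⟨w', hw', hyw⟩ := hby.exists_outside hB hG (CyclePair.reverse hpq) hxy.symm
    simp only [Walk.support_reverse, List.mem_reverse] at hw'
    refine hG.attach_paths hpq.1 hpq.2.1 hpq.2.2.1 hxy hpq.2.2.2.2.2 (hB.four_dvd hG hpq hxy) ?_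
      hw hw' hxw hyw
    rw [← Nat.not_even_iff_odd, even_length_iff hc p hpq.2.2.2.1]
    exact hne
  -- Without vertices of large degree, `B` is a cycle and either colour will do.
  obtain ⟨b, hb⟩ : ∃ b, ∀ x ∈ B, Big G W x → c x = b := by
    by_cases hex : ∃ x ∈ B, Big G W x
    · obtain ⟨x, hx, hbx⟩ := hex
      exact ⟨c x, fun y hy hby => hbig y hy x hx hby hbx⟩
    · exact ⟨true, fun x hx hbx => absurd ⟨x, hx, hbx⟩ hex⟩
  set A : Set V := {x | x ∈ B ∧ c x = b} with hA
  set E : Set V := {x | x ∈ B ∧ c x ≠ b} with hE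
  have hAE : Disjoint A E := Set.disjoint_left.2 fun x h1 h2 => h2.2 h1.2
  have hends : ∀ e ∈ E, ∃ s ∈ A, ∃ t ∈ A, s ≠ t ∧ ∀ y ∈ W, G.Adj e y ↔ y = s ∨ y = t := by
    intro e he
    obtain ⟨s, hs, t, ht, hst, hes, het⟩ := h.two_conn.exists_two_adj h.card he.1
    have hcol : ∀ s ∈ B, G.Adj e s → s ∈ A := by
      intro s hs hes
      refine ⟨hs, ?_⟩
      have h1 := hc e he.1 s hs hes
      have h2 := he.2
      revert h1 h2
      cases c e <;> cases c s <;> cases b <;> simp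
    refine ⟨s, hcol s hs hes, t, hcol t ht het, hst, fun y hy => ⟨fun hey => ?_, ?_⟩⟩
    · by_contra! hne
      refine he.2 (hb e he.1 fun s' t' => ?_)
      by_contra! hcon
      have g1 := fun h1 h2 => hcon s (h.subset hs) h1 h2 hes
      have g2 := fun h1 h2 => hcon t (h.subset ht) h1 h2 het
      have g3 := fun h1 h2 => hcon y hy h1 h2 hey
      clear hcon hE hA hAE hcol hbig hb hc he hes het hey hB hG h hs ht
      by_cases h1 : s = s' <;> by_cases h2 : t = s' <;> grind
    · rintro (rfl | rfl)
      exacts [hes, het]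
  -- The simple graph underlying the multigraph; parallel edges need no care, since they do not
  -- affect bipartiteness.
  let K : SimpleGraph V :=
    { Adj := fun x y => x ≠ y ∧ x ∈ A ∧ y ∈ A ∧ ∃ e ∈ E, G.Adj e x ∧ G.Adj e y
      symm := ⟨fun x y ⟨h1, h2, h3, e, h4, h5, h6⟩ => ⟨h1.symm, h3, h2, e, h4, h6, h5⟩⟩
      loopless := ⟨fun x h => h.1 rfl⟩ }
  have hEu : ∀ e ∈ E, ∀ x ∈ A, ∀ y ∈ A, ∀ z ∈ A, G.Adj e x → G.Adj e y → G.Adj e z → y ≠ z →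
      x = y ∨ x = z := by
    intro e he x hx y hy z hz hex hey hez hyz
    obtain ⟨s, -, t, -, -, hst⟩ := hends e he
    rw [hst _ (h.subset hx.1)] at hex
    rw [hst _ (h.subset hy.1)] at hey
    rw [hst _ (h.subset hz.1)] at hez
    grind
  obtain ⟨d, hd⟩ := exists_coloring_of_odd_paths (K := K) (by
    intro u v p hp huv
    by_cases h1 : p.length = 1
    · rw [h1]; exact odd_one
    have h0 := length_pos_of_ne p huv.ne'
    obtain ⟨P, hP, hl, hPB, -, hPE⟩ :=
      exists_lift (G := G) (A := A) (E := E) (K := K) (fun x y h => h.2) hAE hEu p hp huv.2.1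
    obtain ⟨-, hu, hv, e, he, heu, hev⟩ := id huv
    -- If the lifted path used `e`, the edge `uv` of `K` would belong to the path `p` between `u`
    -- and `v`, which would then have length one.
    have heP : e ∉ P.support := by
      intro heP
      obtain ⟨x, y, hxy, hex, hey⟩ := hPE e heP he
      have hadj := p.adj_of_mem_edges hxy
      have e1 := hEu e he x hadj.2.1 u hu v hv hex heu hev huv.ne
      have e2 := hEu e he y hadj.2.2.1 u hu v hv hey heu hev huv.ne
      have e3 : s(v, u) ∈ p.edges := by
        have := hadj.ne
        rcases e1 with rfl | rfl <;> rcases e2 with rfl | rfl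
        · exact absurd rfl this
        · rwa [Sym2.eq_swap]
        · exact hxy
        · exact absurd rfl this
      exact h1 (hp.length_eq_one_of_mem_edges e3)
    have hPB' : ∀ x ∈ P.support, x ∈ B := fun x hx => (hPB x hx).elim And.left And.left
    have := hB.four_dvd hG (p := P) (q := Walk.cons hev.symm (Walk.cons heu Walk.nil))
      ⟨hP, by simp [hev.ne', heu.ne, huv.ne'], by
        intro x hx hx'
        simp only [Walk.support_cons, Walk.support_nil, List.mem_cons, List.not_mem_nil,
          or_false] at hx'
        rcases hx' with rfl | rfl | rfl
        · exact Or.inl rfl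
        · exact absurd hx heP
        · exact Or.inr rfl, hPB', by
        intro x hx'
        simp only [Walk.support_cons, Walk.support_nil, List.mem_cons, List.not_mem_nil,
          or_false] at hx'
        rcases hx' with rfl | rfl | rfl
        exacts [hv.1, he.1, hu.1], by simp; omega⟩ huv.ne'
    simp only [hl, Walk.length_cons, Walk.length_nil] at this
    rw [Nat.odd_iff]; omega)
  refine ⟨{x | x ∈ A ∧ d x = true}, {x | x ∈ A ∧ d x ≠ true}, E, ?_, ?_, ?_, ?_, ?_, ?_⟩
  · ext x
    simp only [hA, hE, Set.mem_union, Set.mem_ofPred_eq]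
    tauto
  · exact Set.disjoint_left.2 fun x h1 h2 => h2.2 h1.2
  · exact hAE.mono_left fun x hx => hx.1
  · exact hAE.mono_left fun x hx => hx.1
  · intro x hx y hy hxy
    have hxA : x ∈ A := hx.elim And.left And.left
    exact ⟨hy, fun e => hc x hxA.1 y hy hxy (hxA.2.trans e.symm)⟩
  · intro e he
    obtain ⟨s, hs, t, ht, hst, hy⟩ := hends e he
    have hes := (hy s (h.subset hs.1)).2 (Or.inl rfl)
    have het := (hy t (h.subset ht.1)).2 (Or.inr rfl)
    have := hd s t ⟨hst, hs, ht, e, he, hes, het⟩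
    cases hds : d s
    · refine ⟨t, ⟨ht, ?_⟩, s, ⟨hs, by simp [hds]⟩, fun y hyW => (hy y hyW).trans Or.comm⟩
      rw [hds] at this
      exact (Bool.eq_not_of_ne this.symm)
    · refine ⟨s, ⟨hs, hds⟩, t, ⟨ht, ?_⟩, hy⟩
      rw [hds] at this
      exact this.symm

end TriangleFree

/-! ### Blocks with a triangle: ears, K₄, and T(p) -/

section Triangles
variable {V : Type u} {G : SimpleGraph V} {B W : Set V}

open TwoConn

lemma Good.attach_four (hG : Good G) {x y m m' w w' : V} (hn : [x, y, m, m'].Nodup)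
    (h1 : G.Adj x y) (h2 : G.Adj y m) (h3 : G.Adj m m') (h4 : G.Adj m' x)
    (hw : w ∉ [x, y, m, m']) (hw' : w' ∉ [x, y, m, m']) (hxw : G.Adj x w) (hyw : G.Adj y w') :
    False := by
  simp only [List.nodup_cons, List.mem_cons, List.not_mem_nil, or_false, not_or,
    List.nodup_nil, and_true, not_false_eq_true] at hn hw hw'
  obtain ⟨⟨n1, n2, n3⟩, ⟨n4, n5⟩, n6⟩ := hn
  refine hG.attach_paths (p := Walk.cons h1 Walk.nil)
    (q := Walk.cons h4.symm (Walk.cons h3.symm (Walk.cons h2.symm Walk.nil)))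
    (w := w) (w' := w') ?_ ?_ ?_ n1 ?_ ?_ ?_ ?_ ?_ hxw hyw
  · simp [n1]
  · simp [n1, n2, n3, Ne.symm n4, Ne.symm n5, Ne.symm n6]
  · intro z hz _
    simpa using hz
  · simp
  · simp
  · simp
  · simp [hw.1, hw.2.1, hw.2.2]
  · simp [hw'.1, hw'.2.1, hw'.2.2]

/-- There is an ear of length `l` of `T` in `B` from `s` to `t`. -/
def HasEar (G : SimpleGraph V) (B T : Set V) (s t : V) (l : ℕ) : Prop :=
  ∃ p : G.Walk s t, p.IsPath ∧ p.length = l ∧ 2 ≤ l ∧ (∀ x ∈ p.support, x ∈ B) ∧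
    ∀ x ∈ p.support, x ∈ T → x = s ∨ x = t

namespace HasEar
variable {T : Set V} {s t m m' : V} {l : ℕ}

lemma symm (h : HasEar G B T s t l) : HasEar G B T t s l := by
  obtain ⟨p, hp, hl, h2, hB, hT⟩ := h
  refine ⟨p.reverse, hp.reverse, by simpa using hl, h2, by simpa using hB, ?_⟩
  intro x hx hxT
  rw [Walk.support_reverse, List.mem_reverse] at hx
  exact (hT x hx hxT).symm

lemma cyc (h : HasEar G B T s t l) (hG : Good G) {r : G.Walk s t} (hr : r.IsPath)
    (hrT : ∀ x ∈ r.support, x ∈ T) (hst : s ≠ t) : l + r.length = 3 ∨ 4 ∣ l + r.length := by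
  obtain ⟨p, hp, rfl, h2, hB, hT⟩ := h
  have := length_pos_of_ne r hst
  exact hG.cyc_paths hp hr (fun x hx hx' => hT x hx (hrT x hx')) hst (by omega)

lemma one (h : HasEar G B T s t l) (hG : Good G) (hs : s ∈ T) (ht : t ∈ T) (hst : G.Adj s t) :
    l = 2 ∨ 4 ∣ l + 1 := by
  have := h.cyc hG (r := Walk.cons hst Walk.nil) (by simp [hst.ne])
    (by intro x hx; simp at hx; rcases hx with rfl | rfl <;> assumption) hst.ne
  simp only [Walk.length_cons, Walk.length_nil] at this
  omega

lemma two (h : HasEar G B T s t l) (hG : Good G) (hs : s ∈ T) (ht : t ∈ T) (hm : m ∈ T)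
    (hst : s ≠ t) (h1 : G.Adj s m) (h2 : G.Adj m t) : 4 ∣ l + 2 := by
  have := h.cyc hG (r := Walk.cons h1 (Walk.cons h2 Walk.nil)) (by simp [h1.ne, h2.ne, hst])
    (by intro x hx; simp at hx; rcases hx with rfl | rfl | rfl <;> assumption) hst
  simp only [Walk.length_cons, Walk.length_nil] at this
  obtain ⟨p, -, -, hl, -⟩ := h
  omega

lemma three (h : HasEar G B T s t l) (hG : Good G) (hs : s ∈ T) (ht : t ∈ T) (hm : m ∈ T)
    (hm' : m' ∈ T) (hst : s ≠ t) (h1 : G.Adj s m) (h2 : G.Adj m m') (h3 : G.Adj m' t)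
    (hsm : s ≠ m') (hmt : m ≠ t) : 4 ∣ l + 3 := by
  have := h.cyc hG (r := Walk.cons h1 (Walk.cons h2 (Walk.cons h3 Walk.nil)))
    (by simp [h1.ne, h2.ne, h3.ne, hst, hsm, hmt])
    (by intro x hx; simp at hx; rcases hx with rfl | rfl | rfl | rfl <;> assumption) hst
  simp only [Walk.length_cons, Walk.length_nil] at this
  obtain ⟨p, -, -, hl, -⟩ := h
  omega

lemma exists_mid (h : HasEar G B T s t 2) :
    ∃ d ∈ B, d ∉ T ∧ G.Adj s d ∧ G.Adj d t := by
  obtain ⟨p, hp, hl, -, hB, hT⟩ := h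
  have h0 := p.adj_getVert_succ (i := 0) (by omega)
  have h1 := p.adj_getVert_succ (i := 1) (by omega)
  rw [Walk.getVert_zero] at h0
  rw [show (1 : ℕ) + 1 = p.length by omega, Walk.getVert_length] at h1
  refine ⟨p.getVert 1, hB _ (p.getVert_mem_support _), fun hd => ?_, h0, h1⟩
  rcases hT _ (p.getVert_mem_support _) hd with e | e
  · exact h0.ne e.symm
  · exact h1.ne e

end HasEar

lemma TwoConn.exists_hasEar {T : Set V} (h : TwoConn G B) (hTB : T ⊆ B) (hT : T.Nontrivial)
    (hne : ¬ B ⊆ T) : ∃ s ∈ T, ∃ t ∈ T, s ≠ t ∧ ∃ l, HasEar G B T s t l := by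
  obtain ⟨s, hs, t, ht, hst, p, hp, hl, hB, hT⟩ := h.exists_ear hTB hT hne
  exact ⟨s, hs, t, ht, hst, p.length, p, hp, rfl, hl, hB, hT⟩

/-- A two-connected set with a complete graph on four vertices has no further vertices. -/
lemma Good.subset_of_clique (hG : Good G) (h : TwoConn G B) {a b c d : V}
    (hab : G.Adj a b) (hac : G.Adj a c) (had : G.Adj a d) (hbc : G.Adj b c) (hbd : G.Adj b d)
    (hcd : G.Adj c d) (hB : {a, b, c, d} ⊆ B) : B = {a, b, c, d} := by
  refine Set.Subset.antisymm ?_ hB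
  by_contra hne
  obtain ⟨s, hs, t, ht, hst, l, he⟩ := h.exists_hasEar hB ⟨a, by simp, b, by simp, hab.ne⟩ hne
  -- Any two vertices of a K₄ are joined inside it by paths of two and of three edges, whose
  -- congruences contradict each other.
  have key : ∀ m ∈ ({a, b, c, d} : Set V), ∀ m' ∈ ({a, b, c, d} : Set V), G.Adj s t →
      G.Adj s m → G.Adj m t → G.Adj m m' → G.Adj m' t → s ≠ m' → False := by
    intro m hm m' hm' h1 h2 h3 h4 h5 h6
    have e1 := he.one hG hs ht h1
    have e2 := he.two hG hs ht hm hst h2 h3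
    have e3 := he.three hG hs ht hm hm' hst h2 h4 h5 h6 h3.ne
    omega
  have n1 := hab.ne
  have n2 := hac.ne
  have n3 := had.ne
  have n4 := hbc.ne
  have n5 := hbd.ne
  have n6 := hcd.ne
  have ha : a ∈ ({a, b, c, d} : Set V) := by simp
  have hb : b ∈ ({a, b, c, d} : Set V) := by simp
  have hc : c ∈ ({a, b, c, d} : Set V) := by simp
  have hd : d ∈ ({a, b, c, d} : Set V) := by simp
  rcases hs with rfl | rfl | rfl | rfl <;> rcases ht with rfl | rfl | rfl | rfl
  · exact hst rfl
  · exact key c hc d hd hab hac hbc.symm hcd hbd.symm n3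
  · exact key b hb d hd hac hab hbc hbd hcd.symm n3
  · exact key b hb c hc had hab hbd hbc hcd n2
  · exact key c hc d hd hab.symm hbc hac.symm hcd had.symm n5
  · exact hst rfl
  · exact key a ha d hd hbc hab.symm hac had hcd.symm n5
  · exact key a ha c hc hbd hab.symm had hac hcd n4
  · exact key b hb d hd hac.symm hbc.symm hab.symm hbd had.symm n6
  · exact key a ha d hd hbc.symm hac.symm hab had hbd.symm n6
  · exact hst rfl
  · exact key a ha b hb hcd hac.symm had hab hbd n4.symm
  · exact key b hb c hc had.symm hbd.symm hab.symm hbc hac.symm n6.symm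
  · exact key a ha c hc hbd.symm had.symm hab hac hbc.symm n6.symm
  · exact key a ha b hb hcd.symm had.symm hac hab hbc n5.symm
  · exact hst rfl

/-- `B` is the graph `T(p)` with the two adjacent vertices `a` and `b` and the `p` vertices `C`. -/
structure IsT (G : SimpleGraph V) (B : Set V) (a b : V) (C : Set V) : Prop where
  eq : B = {a, b} ∪ C
  nonempty : C.Nonempty
  left : a ∉ C
  right : b ∉ C
  adj : G.Adj a b
  adj_left : ∀ c ∈ C, G.Adj a c
  adj_right : ∀ c ∈ C, G.Adj b c
  indep : ∀ c ∈ C, ∀ d ∈ C, ¬ G.Adj c d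

lemma IsT.swap {a b : V} {C : Set V} (h : IsT G B a b C) : IsT G B b a C :=
  ⟨by rw [h.eq, Set.pair_comm], h.nonempty, h.right, h.left, h.adj.symm, h.adj_right, h.adj_left,
    h.indep⟩

/-- An ear of `{a, b} ∪ C` from `a` to `b` has length two, so its midpoint already is a common
neighbour, that is, in `C`. Any other pair of ends is joined in `{a, b} ∪ C` by paths of both two
and three edges; for a hub and a vertex of `C` this needs a second vertex in `C`, whence the
assumption on `C` or the case of a bare triangle. -/
lemma Good.isT_of_subset (hG : Good G) (h : TwoConn G B) {a b : V}
    (hab : G.Adj a b) (ha : a ∈ B) (hb : b ∈ B) (hcl : ∀ c ∈ B, ∀ d ∈ B, G.Adj a c → G.Adj b c →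
      G.Adj a d → G.Adj b d → ¬ G.Adj c d)
    (hC : {x | x ∈ B ∧ G.Adj a x ∧ G.Adj b x}.Nontrivial ∨
      (∃ c, G.Adj a c ∧ G.Adj b c ∧ B = {a, b, c})) :
    IsT G B a b {x | x ∈ B ∧ G.Adj a x ∧ G.Adj b x} := by
  set C := {x | x ∈ B ∧ G.Adj a x ∧ G.Adj b x} with hCdef
  have haC : a ∉ C := fun h => h.2.1.ne rfl
  have hbC : b ∉ C := fun h => h.2.2.ne rfl
  have hne : C.Nonempty := by
    rcases hC with hC | ⟨c, h1, h2, h3⟩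
    · exact hC.nonempty
    · exact ⟨c, by rw [h3]; simp, h1, h2⟩
  have hTB : {a, b} ∪ C ⊆ B := by
    rintro x ((rfl | rfl) | hx)
    exacts [ha, hb, hx.1]
  refine ⟨Set.Subset.antisymm ?_ hTB, hne, haC, hbC, hab, fun c hc => hc.2.1,
    fun c hc => hc.2.2, fun c hc d hd =>
      hcl c hc.1 d hd.1 hc.2.1 hc.2.2 hd.2.1 hd.2.2⟩
  rcases hC with hC | ⟨c, h1, h2, h3⟩
  swap
  · rw [h3]
    rintro x (rfl | rfl | rfl)
    · exact Or.inl (by simp)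
    · exact Or.inl (by simp)
    · exact Or.inr ⟨by rw [h3]; simp, h1, h2⟩
  by_contra hnot
  obtain ⟨s, hs, t, ht, hst, l, he⟩ :=
    h.exists_hasEar hTB ⟨a, by simp, b, by simp, hab.ne⟩ hnot
  have haT : a ∈ {a, b} ∪ C := by simp
  have hbT : b ∈ {a, b} ∪ C := by simp
  have hhub : ∀ l, HasEar G B ({a, b} ∪ C) a b l → False := by
    intro l he
    obtain ⟨c, hc⟩ := hne
    have e1 := he.one hG haT hbT hab
    have e2 := he.two hG haT hbT (Or.inr hc) hab.ne hc.2.1 hc.2.2.symm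
    have e3 : l = 2 := by omega
    subst e3
    obtain ⟨d, hd, hdT, had, hdb⟩ := he.exists_mid
    exact hdT (Or.inr ⟨hd, had, hdb.symm⟩)
  have hac : ∀ l, ∀ c ∈ C, HasEar G B ({a, b} ∪ C) a c l → False := by
    intro l c hc he
    obtain ⟨d, hd, hdc⟩ := hC.exists_ne c
    have e1 := he.one hG haT (Or.inr hc) hc.2.1
    have e2 := he.two hG haT (Or.inr hc) hbT hc.2.1.ne hab hc.2.2
    have e3 := he.three hG haT (Or.inr hc) (Or.inr hd) hbT hc.2.1.ne hd.2.1 hd.2.2.symm hc.2.2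
      hab.ne hdc
    omega
  have hbc : ∀ l, ∀ c ∈ C, HasEar G B ({a, b} ∪ C) b c l → False := by
    intro l c hc he
    obtain ⟨d, hd, hdc⟩ := hC.exists_ne c
    have e1 := he.one hG hbT (Or.inr hc) hc.2.2
    have e2 := he.two hG hbT (Or.inr hc) haT hc.2.2.ne hab.symm hc.2.1
    have e3 := he.three hG hbT (Or.inr hc) (Or.inr hd) haT hc.2.2.ne hd.2.2 hd.2.1.symm hc.2.1
      hab.ne' hdc
    omega
  rcases hs with (rfl | rfl) | hs <;> rcases ht with (rfl | rfl) | ht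
  · exact hst rfl
  · exact hhub l he
  · exact hac l t ht he
  · exact hhub l he.symm
  · exact hst rfl
  · exact hbc l t ht he
  · exact hac l s hs he.symm
  · exact hbc l s hs he.symm
  · have e2 := he.two hG (Or.inr hs) (Or.inr ht) haT hst hs.2.1.symm ht.2.1
    have e3 := he.three hG (Or.inr hs) (Or.inr ht) haT hbT hst hs.2.1.symm hab ht.2.2
      hs.2.2.ne' ht.2.1.ne
    omega

/-- The structure of a two-connected set that contains a triangle. -/
lemma Good.clique_or_isT (hG : Good G) (h : TwoConn G B) (hB : ¬ TriFree G B) :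
    (∃ a b c d, G.Adj a b ∧ G.Adj a c ∧ G.Adj a d ∧ G.Adj b c ∧ G.Adj b d ∧ G.Adj c d ∧
      B = {a, b, c, d}) ∨ ∃ a b C, IsT G B a b C := by
  by_cases hK : ∃ a ∈ B, ∃ b ∈ B, ∃ c ∈ B, ∃ d ∈ B,
      G.Adj a b ∧ G.Adj a c ∧ G.Adj a d ∧ G.Adj b c ∧ G.Adj b d ∧ G.Adj c d
  · obtain ⟨a, ha, b, hb, c, hc, d, hd, h1, h2, h3, h4, h5, h6⟩ := hK
    refine Or.inl ⟨a, b, c, d, h1, h2, h3, h4, h5, h6, hG.subset_of_clique h h1 h2 h3 h4 h5 h6 ?_⟩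
    rintro x (rfl | rfl | rfl | rfl) <;> assumption
  · right
    have hcl : ∀ a ∈ B, ∀ b ∈ B, G.Adj a b → ∀ c ∈ B, ∀ d ∈ B, G.Adj a c → G.Adj b c →
        G.Adj a d → G.Adj b d → ¬ G.Adj c d := fun a ha b hb hab c hc d hd h1 h2 h3 h4 h5 =>
      hK ⟨a, ha, b, hb, c, hc, d, hd, hab, h1, h3, h2, h4, h5⟩
    simp only [TriFree, not_forall, not_false_eq_true] at hB
    obtain ⟨a, ha, b, hb, c, hc, hab, hbc, hca, -⟩ := hB
    by_cases hsub : B ⊆ {a, b, c}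
    · refine ⟨a, b, _, hG.isT_of_subset h hab ha hb (hcl a ha b hb hab)
        (Or.inr ⟨c, hca.symm, hbc, hsub.antisymm ?_⟩)⟩
      rintro x (rfl | rfl | rfl) <;> assumption
    · have hTB : {a, b, c} ⊆ B := by rintro x (rfl | rfl | rfl) <;> assumption
      obtain ⟨s, hs, t, ht, hst, l, he⟩ :=
        h.exists_hasEar hTB ⟨a, by simp, b, by simp, hab.ne⟩ hsub
      -- An ear of a triangle has length two. Its midpoint and the third vertex of the triangle are
      -- two common neighbours of `s` and `t`, which become the hubs of T(p).
      have key : ∀ m ∈ ({a, b, c} : Set V), G.Adj s t → G.Adj s m → G.Adj m t →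
          ∃ a b C, IsT G B a b C := by
        intro m hm hst' hsm hmt
        have e1 := he.one hG hs ht hst'
        have e2 := he.two hG hs ht hm hst hsm hmt
        have e3 : l = 2 := by omega
        subst e3
        obtain ⟨d, hd, hdT, hsd, hdt⟩ := he.exists_mid
        refine ⟨s, t, _, hG.isT_of_subset h hst' (hTB hs) (hTB ht)
          (hcl s (hTB hs) t (hTB ht) hst') (Or.inl ⟨m, ⟨hTB hm, hsm, hmt.symm⟩, d,
            ⟨hd, hsd, hdt.symm⟩, ?_⟩)⟩
        rintro rfl
        exact hdT hm
      rcases hs with rfl | rfl | rfl <;> rcases ht with rfl | rfl | rfl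
      · exact absurd rfl hst
      · exact key c (by simp) hab hca.symm hbc.symm
      · exact key b (by simp) hca.symm hab hbc
      · exact key c (by simp) hab.symm hbc hca
      · exact absurd rfl hst
      · exact key a (by simp) hbc hab.symm hca.symm
      · exact key b (by simp) hca hbc.symm hab.symm
      · exact key a (by simp) hbc.symm hca hab
      · exact absurd rfl hst

/-- The vertex `x` has a neighbour in `W` outside of `B`. -/
def Att (G : SimpleGraph V) (W B : Set V) (x : V) : Prop := ∃ w ∈ W, w ∉ B ∧ G.Adj x w

/-- `B` induces a `K₄` with at most one attached vertex. -/
def K4S (G : SimpleGraph V) (W B : Set V) : Prop :=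
  ∃ a b c d, G.Adj a b ∧ G.Adj a c ∧ G.Adj a d ∧ G.Adj b c ∧ G.Adj b d ∧ G.Adj c d ∧
    B = {a, b, c, d} ∧ ∀ x ∈ B, ∀ y ∈ B, Att G W B x → Att G W B y → x = y

/-- `B` induces a `T(2)` where at most one vertex, of degree two, is attached. -/
def T2S (G : SimpleGraph V) (W B : Set V) : Prop :=
  ∃ a b c d, c ≠ d ∧ IsT G B a b {c, d} ∧ ∀ x ∈ B, Att G W B x → x = c

/-- `B` induces a `T(p)` where at most the two vertices of large degree are attached, and all
neighbours outside of `B` of one of them have degree one in `W`. -/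
def TS (G : SimpleGraph V) (W B : Set V) : Prop :=
  ∃ a b C, IsT G B a b C ∧ (∀ x ∈ B, Att G W B x → x = a ∨ x = b) ∧
    ∀ w ∈ W, w ∉ B → G.Adj b w → ∀ w' ∈ W, G.Adj w w' → w' = b

/-- Two vertices of a triangle of a block are not both attached to a path of order two. -/
lemma Good.not_long (hG : Good G) (h : IsBlk G W B) {a b c : V} (ha : a ∈ B) (hb : b ∈ B)
    (hc : c ∈ B) (hab : G.Adj a b) (hac : G.Adj a c) (hbc : G.Adj b c) :
    (∀ w ∈ W, w ∉ B → G.Adj a w → ∀ w' ∈ W, G.Adj w w' → w' = a) ∨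
      ∀ w ∈ W, w ∉ B → G.Adj b w → ∀ w' ∈ W, G.Adj w w' → w' = b := by
  by_contra! hcon
  obtain ⟨⟨x, hx, hxB, hax, x', hx', hxx, hxa⟩, y, hy, hyB, hby, y', hy', hyy, hyb⟩ := hcon
  have hx'B : x' ∉ B := fun hB => hxa (h.eq_of_adj hB ha hx hxB hxx.symm hax)
  have hy'B : y' ∉ B := fun hB => hyb (h.eq_of_adj hB hb hy hyB hyy.symm hby)
  have hsep : ¬ Conn G (W \ B) x y := fun hxy =>
    hab.ne (h.eq_of_conn Set.Subset.rfl ha hb hax hby hxy)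
  have cx : Conn G (W \ B) x x' := Conn.of_adj hxx ⟨hx, hxB⟩ ⟨hx', hx'B⟩
  have cy : Conn G (W \ B) y y' := Conn.of_adj hyy ⟨hy, hyB⟩ ⟨hy', hy'B⟩
  have n1 : x ≠ y := by rintro rfl; exact hsep (Conn.refl ⟨hx, hxB⟩)
  have n2 : x ≠ y' := by rintro rfl; exact hsep cy.symm
  have n3 : x' ≠ y := by rintro rfl; exact hsep cx
  have n4 : x' ≠ y' := by rintro rfl; exact hsep (cx.trans cy.symm)
  have ne : ∀ {s t : V}, s ∈ B → t ∉ B → s ≠ t := fun hs ht e => ht (e ▸ hs)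
  refine hG.long a b c x x' y y' ?_ hab hac hbc hax hxx hby hyy
  simp only [List.nodup_cons, List.mem_cons, List.not_mem_nil, or_false, not_or,
    List.nodup_nil, and_true, not_false_eq_true]
  exact ⟨⟨hab.ne, hac.ne, ne ha hxB, ne ha hx'B, ne ha hyB, ne ha hy'B⟩,
    ⟨hbc.ne, ne hb hxB, ne hb hx'B, ne hb hyB, ne hb hy'B⟩,
    ⟨ne hc hxB, ne hc hx'B, ne hc hyB, ne hc hy'B⟩, ⟨hxx.ne, n1, n2⟩, ⟨n3, n4⟩, hyy.ne⟩

/-- By `Good.not_long` one of the two hubs has only leaves outside of `B`; the names are exchanged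
if necessary so that it is the second one. -/
lemma Good.ts_of_isT (hG : Good G) (h : IsBlk G W B) {a b : V} {C : Set V} (hT : IsT G B a b C)
    (hatt : ∀ x ∈ B, Att G W B x → x = a ∨ x = b) : TS G W B := by
  obtain ⟨c, hc⟩ := hT.nonempty
  have ha : a ∈ B := by rw [hT.eq]; simp
  have hb : b ∈ B := by rw [hT.eq]; simp
  have hcB : c ∈ B := by rw [hT.eq]; exact Or.inr hc
  rcases hG.not_long h ha hb hcB hT.adj (hT.adj_left c hc) (hT.adj_right c hc) with hl | hl
  · exact ⟨b, a, C, hT.swap, fun x hx hxa => (hatt x hx hxa).symm, hl⟩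
  · exact ⟨a, b, C, hT, hatt, hl⟩

lemma IsT.triangle {a b c : V} (hab : G.Adj a b) (hac : G.Adj a c) (hbc : G.Adj b c)
    (hB : B = {a, b, c}) : IsT G B a b {c} where
  eq := by rw [hB]; ext x; simp; tauto
  nonempty := Set.singleton_nonempty c
  left := by simpa using hac.ne
  right := by simpa using hbc.ne
  adj := hab
  adj_left := by rintro _ rfl; exact hac
  adj_right := by rintro _ rfl; exact hbc
  indep := by rintro _ rfl _ rfl; exact G.loopless.irrefl _

/-- The blocks with a triangle in the graphs of the class. -/
theorem Good.triangle_block (hG : Good G) (h : IsBlk G W B) (hB : ¬ TriFree G B) :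
    K4S G W B ∨ T2S G W B ∨ TS G W B := by
  have ne : ∀ {s t : V}, s ∈ B → t ∉ B → t ≠ s := fun hs ht e => ht (e ▸ hs)
  -- Two consecutive vertices of a 4-cycle in `B` are not both attached: this is `Good.attach` with
  -- `j = 1`.
  have h4 : ∀ x y m m', x ∈ B → y ∈ B → m ∈ B → m' ∈ B → G.Adj x y → G.Adj y m → G.Adj m m' →
      G.Adj m' x → x ≠ m → y ≠ m' → Att G W B x → Att G W B y → False := by
    rintro x y m m' hx hy hm hm' h1 h2 h3 h4 h5 h6 ⟨w, -, hw, hxw⟩ ⟨w', -, hw', hyw⟩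
    refine hG.attach_four (x := x) (y := y) (m := m) (m' := m') ?_ h1 h2 h3 h4 ?_ ?_ hxw hyw
    · simp [h1.ne, h2.ne, h3.ne, h4.ne', h5, h6]
    · simp [ne hx hw, ne hy hw, ne hm hw, ne hm' hw]
    · simp [ne hx hw', ne hy hw', ne hm hw', ne hm' hw']
  rcases hG.clique_or_isT h.two_conn hB with
    ⟨a, b, c, d, hab, hac, had, hbc, hbd, hcd, rfl⟩ | ⟨a, b, C, hT⟩
  · left
    refine ⟨a, b, c, d, hab, hac, had, hbc, hbd, hcd, rfl, ?_⟩
    have key : ∀ x y m m', x ∈ ({a, b, c, d} : Set V) → y ∈ ({a, b, c, d} : Set V) →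
      m ∈ ({a, b, c, d} : Set V) → m' ∈ ({a, b, c, d} : Set V) → G.Adj x y → G.Adj y m →
      G.Adj m m' → G.Adj m' x → G.Adj x m → G.Adj y m' → Att G W {a, b, c, d} x →
      Att G W {a, b, c, d} y → x = y := fun x y m m' hx hy hm hm' h1 h2 h3 h5 h6 h7 h8 h9 =>
        (h4 x y m m' hx hy hm hm' h1 h2 h3 h5 h6.ne h7.ne h8 h9).elim
    have ha : a ∈ ({a, b, c, d} : Set V) := by simp
    have hb : b ∈ ({a, b, c, d} : Set V) := by simp
    have hc : c ∈ ({a, b, c, d} : Set V) := by simp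
    have hd : d ∈ ({a, b, c, d} : Set V) := by simp
    have k1 := key a b c d ha hb hc hd hab hbc hcd had.symm hac hbd
    have k2 := key a c b d ha hc hb hd hac hbc.symm hbd had.symm hab hcd
    have k3 := key a d b c ha hd hb hc had hbd.symm hbc hac.symm hab hcd.symm
    have k4 := key b c a d hb hc ha hd hbc hac.symm had hbd.symm hab.symm hcd
    have k5 := key b d a c hb hd ha hc hbd had.symm hac hbc.symm hab.symm hcd.symm
    have k6 := key c d a b hc hd ha hb hcd had.symm hab hbc hac.symm hbd.symm
    rintro x (rfl | rfl | rfl | rfl) y (rfl | rfl | rfl | rfl) hx hy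
    exacts [rfl, k1 hx hy, k2 hx hy, k3 hx hy, (k1 hy hx).symm, rfl, k4 hx hy, k5 hx hy,
      (k2 hy hx).symm, (k4 hy hx).symm, rfl, k6 hx hy, (k3 hy hx).symm, (k5 hy hx).symm,
      (k6 hy hx).symm, rfl]
  right
  have ha : a ∈ B := by rw [hT.eq]; simp
  have hb : b ∈ B := by rw [hT.eq]; simp
  have hC : ∀ c ∈ C, c ∈ B := fun c hc => by rw [hT.eq]; exact Or.inr hc
  by_cases hCn : C.Nontrivial
  swap
  · right
    rw [Set.not_nontrivial_iff] at hCn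
    obtain ⟨c, rfl⟩ := (Set.exists_eq_singleton_iff_nonempty_subsingleton.2 ⟨hT.nonempty, hCn⟩)
    have hac := hT.adj_left c rfl
    have hbc := hT.adj_right c rfl
    have hab := hT.adj
    have hcB := hC c rfl
    have hBeq : B = {a, b, c} := by rw [hT.eq]; ext x; simp; tauto
    -- In the case `p = 1` all three vertices play the same role. The net excludes three attached
    -- vertices, and the hubs are then chosen so as to include the attached ones.
    have hnet : ¬ (Att G W B a ∧ Att G W B b ∧ Att G W B c) := by
      rintro ⟨⟨p, hpW, hp, hap⟩, ⟨q, hqW, hq, hbq⟩, ⟨r, hrW, hr, hcr⟩⟩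
      refine hG.net a b c p q r ?_ hab hac hbc hap hbq hcr
      have m1 : p ≠ q := by rintro rfl; exact hab.ne (h.eq_of_adj ha hb hpW hp hap hbq)
      have m2 : p ≠ r := by rintro rfl; exact hac.ne (h.eq_of_adj ha hcB hpW hp hap hcr)
      have m3 : q ≠ r := by rintro rfl; exact hbc.ne (h.eq_of_adj hb hcB hqW hq hbq hcr)
      simp only [List.nodup_cons, List.mem_cons, List.not_mem_nil, or_false, not_or,
        List.nodup_nil, and_true, not_false_eq_true]
      exact ⟨⟨hab.ne, hac.ne, (ne ha hp).symm, (ne ha hq).symm, (ne ha hr).symm⟩,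
        ⟨hbc.ne, (ne hb hp).symm, (ne hb hq).symm, (ne hb hr).symm⟩,
        ⟨(ne hcB hp).symm, (ne hcB hq).symm, (ne hcB hr).symm⟩, ⟨m1, m2⟩, m3⟩
    have hBx : ∀ x ∈ B, x = a ∨ x = b ∨ x = c := fun x hx => by rw [hBeq] at hx; exact hx
    by_cases h1 : Att G W B a
    · by_cases h2 : Att G W B b
      · refine hG.ts_of_isT h hT fun x hx hxa => ?_
        rcases hBx x hx with rfl | rfl | rfl
        exacts [Or.inl rfl, Or.inr rfl, absurd ⟨h1, h2, hxa⟩ hnet]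
      · refine hG.ts_of_isT h (IsT.triangle hac hab hbc.symm
          (by rw [hBeq, Set.pair_comm b c])) fun x hx hxa => ?_
        rcases hBx x hx with rfl | rfl | rfl
        exacts [Or.inl rfl, absurd hxa h2, Or.inr rfl]
    · refine hG.ts_of_isT h (IsT.triangle hbc hab.symm hac.symm
          (by rw [hBeq, Set.pair_comm c a, Set.insert_comm])) fun x hx hxa => ?_
      rcases hBx x hx with rfl | rfl | rfl
      exacts [absurd hxa h1, Or.inl rfl, Or.inr rfl]
  by_cases hex : ∃ c ∈ C, Att G W B c
  swap
  · right
    refine hG.ts_of_isT h hT fun x hx hxa => ?_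
    rw [hT.eq] at hx
    rcases hx with hx | hx
    · exact hx
    · exact absurd ⟨x, hx, hxa⟩ hex
  left
  obtain ⟨c, hc, hca⟩ := hex
  obtain ⟨d, hd, hdc⟩ := hCn.exists_ne c
  have hcd : c ≠ d := fun e => hdc e.symm
  -- A third vertex `e` of `C` would be a neighbour of `a` off the 4-cycle `a c b d`, on which `c`
  -- is attached next to `a`.
  have hCeq : C = {c, d} := by
    refine Set.Subset.antisymm (fun e he => ?_) (by rintro x (rfl | rfl) <;> assumption)
    by_contra hne
    simp only [Set.mem_insert_iff, Set.mem_singleton_iff, not_or] at hne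
    obtain ⟨w, -, hw, hcw⟩ := hca
    have n0 := hT.adj_left c hc
    have n1 := hT.adj_left d hd
    have n2 := hT.adj_right c hc
    have n3 := hT.adj_right d hd
    have n4 := hT.adj_left e he
    have n5 := hT.adj_right e he
    refine hG.attach_four (x := a) (y := c) (m := b) (m' := d) (w := e) (w' := w) ?_ n0 n2.symm
      n3 n1.symm ?_ ?_ n4 hcw
    · simp [n0.ne, n1.ne, n2.ne', n3.ne, hT.adj.ne, hcd]
    · simp [n4.ne', n5.ne', hne.1, hne.2]
    · simp [ne ha hw, ne hb hw, ne (hC c hc) hw, ne (hC d hd) hw]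
  subst hCeq
  refine ⟨a, b, c, d, hcd, hT, ?_⟩
  have n0 := hT.adj_left c hc
  have n1 := hT.adj_left d hd
  have n2 := hT.adj_right c hc
  have n3 := hT.adj_right d hd
  intro x hx hxa
  rw [hT.eq] at hx
  rcases hx with (rfl | rfl) | rfl | rfl
  · exact (h4 x c b d ha (hC c hc) hb (hC d hd) n0 n2.symm n3 n1.symm hT.adj.ne hcd hxa hca).elim
  · exact (h4 x c a d hb (hC c hc) ha (hC d hd) n2 n0.symm n1 n3.symm hT.adj.ne' hcd hxa hca).elim
  · rfl
  -- With both `c` and the other vertex of `C` attached, `Good.diamond` applies; their outside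
  -- neighbours differ because `B` is a block.
  · exfalso
    obtain ⟨p, hpW, hp, hcp⟩ := hca
    obtain ⟨q, hqW, hq, hdq⟩ := hxa
    refine hG.diamond a b c x p q ?_ hT.adj n0 n1 n2 n3 hcp hdq
    have m1 : p ≠ q := by
      rintro rfl
      exact hcd (h.eq_of_adj (hC c hc) (hC x hd) hpW hp hcp hdq)
    simp only [List.nodup_cons, List.mem_cons, List.not_mem_nil, or_false, not_or,
      List.nodup_nil, and_true, not_false_eq_true]
    exact ⟨⟨hT.adj.ne, n0.ne, n1.ne, (ne ha hp).symm, (ne ha hq).symm⟩,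
      ⟨n2.ne, n3.ne, (ne hb hp).symm, (ne hb hq).symm⟩,
      ⟨hcd, (ne (hC c hc) hp).symm, (ne (hC c hc) hq).symm⟩,
      ⟨(ne (hC x hd) hp).symm, (ne (hC x hd) hq).symm⟩, m1⟩

end Triangles

/-! ### Packings and covers as vertex sets, and removal of a part -/

section Packing
variable {V : Type u} {G : SimpleGraph V} {B W S T P : Set V}

/-- `P` is the vertex set of a path of order four. -/
def IsP4 (G : SimpleGraph V) (P : Set V) : Prop :=
  ∃ a b c d, a ≠ c ∧ a ≠ d ∧ b ≠ d ∧ G.Adj a b ∧ G.Adj b c ∧ G.Adj c d ∧ P = {a, b, c, d}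

namespace IsP4

lemma exists_adj_adj (h : IsP4 G P) {v : V} (hv : v ∈ P) :
    ∃ u ∈ P, G.Adj v u ∧ ∃ u' ∈ P, u' ≠ v ∧ G.Adj u u' := by
  obtain ⟨a, b, c, d, h1, h2, h3, hab, hbc, hcd, rfl⟩ := h
  rcases hv with rfl | rfl | rfl | rfl
  · exact ⟨b, by simp, hab, c, by simp, h1.symm, hbc⟩
  · exact ⟨c, by simp, hbc, d, by simp, h3.symm, hcd⟩
  · exact ⟨b, by simp, hbc.symm, a, by simp, h1, hab.symm⟩
  · exact ⟨c, by simp, hcd.symm, b, by simp, h3, hbc.symm⟩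

lemma subset_of_closed (h : IsP4 G P) {K : Set V} {v : V} (hv : v ∈ P) (hvK : v ∈ K)
    (hK : ∀ x ∈ K, ∀ y ∈ P, G.Adj x y → y ∈ K) : P ⊆ K := by
  obtain ⟨a, b, c, d, h1, h2, h3, hab, hbc, hcd, rfl⟩ := h
  have iab : a ∈ K ↔ b ∈ K :=
    ⟨fun h => hK a h b (by simp) hab, fun h => hK b h a (by simp) hab.symm⟩
  have ibc : b ∈ K ↔ c ∈ K :=
    ⟨fun h => hK b h c (by simp) hbc, fun h => hK c h b (by simp) hbc.symm⟩
  have icd : c ∈ K ↔ d ∈ K :=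
    ⟨fun h => hK c h d (by simp) hcd, fun h => hK d h c (by simp) hcd.symm⟩
  have ha : a ∈ K := by rcases hv with rfl | rfl | rfl | rfl <;> tauto
  rintro x (rfl | rfl | rfl | rfl) <;> tauto

lemma ncard_eq (h : IsP4 G P) : P.ncard = 4 := by
  classical
  obtain ⟨a, b, c, d, h1, h2, h3, hab, hbc, hcd, rfl⟩ := h
  have : ({a, b, c, d} : Set V) = (({a, b, c, d} : Finset V) : Set V) := by simp
  rw [this, Set.ncard_coe_finset]
  have n1 := hab.ne
  have n2 := hbc.ne
  have n3 := hcd.ne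
  rw [Finset.card_insert_of_notMem (by simp [n1, h1, h2]),
    Finset.card_insert_of_notMem (by simp [n2, h3]), Finset.card_insert_of_notMem (by simp [n3]),
    Finset.card_singleton]

lemma nonempty (h : IsP4 G P) : P.Nonempty := by
  obtain ⟨a, b, c, d, -, -, -, -, -, -, rfl⟩ := h
  exact ⟨a, by simp⟩

end IsP4

/-- The set `S` contains no path of order four. -/
def NoP4 (G : SimpleGraph V) (S : Set V) : Prop := ∀ P, IsP4 G P → ¬ P ⊆ S

lemma NoP4.mono (h : NoP4 G T) (hST : S ⊆ T) : NoP4 G S := fun P hP hPS => h P hP (hPS.trans hST)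

/-- Every edge inside `S` contains `b`, but the first and the last edge of a path of order four are
disjoint. -/
lemma NoP4.of_star {b : V} (h : ∀ q ∈ S, q ≠ b → ∀ y ∈ S, G.Adj q y → y = b) : NoP4 G S := by
  rintro P ⟨p, q, r, s, h1, h2, h3, hpq, hqr, hrs, rfl⟩ hP
  have hp := hP (show p ∈ ({p, q, r, s} : Set V) by simp)
  have hq := hP (show q ∈ ({p, q, r, s} : Set V) by simp)
  have hr := hP (show r ∈ ({p, q, r, s} : Set V) by simp)
  have hs := hP (show s ∈ ({p, q, r, s} : Set V) by simp)
  have e1 : p = b ∨ q = b := by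
    by_cases hpb : p = b
    · exact Or.inl hpb
    · exact Or.inr (h p hp hpb q hq hpq)
  have e2 : r = b ∨ s = b := by
    by_cases hrb : r = b
    · exact Or.inl hrb
    · exact Or.inr (h r hr hrb s hs hrs)
  rcases e1 with rfl | rfl <;> rcases e2 with e | e
  · exact h1 e.symm
  · exact h2 e.symm
  · exact hqr.ne e.symm
  · exact h3 e.symm

/-- There are `n` pairwise disjoint paths of order four in `W`. -/
def Pack (G : SimpleGraph V) (W : Set V) (n : ℕ) : Prop :=
  ∃ P : Fin n → Set V, (∀ i, IsP4 G (P i) ∧ P i ⊆ W) ∧ ∀ i j, i ≠ j → Disjoint (P i) (P j)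

/-- There are `n` vertices that meet all paths of order four in `W`. -/
def Cov (G : SimpleGraph V) (W : Set V) (n : ℕ) : Prop :=
  ∃ X : Set V, X.ncard ≤ n ∧ ∀ P, IsP4 G P → P ⊆ W → ∃ x ∈ X, x ∈ P

lemma Pack.of_family {ι : Type*} [Fintype ι] (P : ι → Set V) (h : ∀ i, IsP4 G (P i) ∧ P i ⊆ W)
    (hd : ∀ i j, i ≠ j → Disjoint (P i) (P j)) : Pack G W (Fintype.card ι) :=
  ⟨fun i => P ((Fintype.equivFin ι).symm i), fun _ => h _,
    fun _ _ hij => hd _ _ fun e => hij ((Fintype.equivFin ι).symm.injective e)⟩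

lemma Pack.mono {n : ℕ} (h : Pack G S n) (hST : S ⊆ T) : Pack G T n := by
  obtain ⟨P, hP, hd⟩ := h
  exact ⟨P, fun i => ⟨(hP i).1, (hP i).2.trans hST⟩, hd⟩

lemma Pack.union {m n : ℕ} (h : Pack G S m) (h' : Pack G T n) (hST : Disjoint S T) :
    Pack G (S ∪ T) (m + n) := by
  obtain ⟨P, hP, hd⟩ := h
  obtain ⟨Q, hQ, hd'⟩ := h'
  have := Pack.of_family (G := G) (W := S ∪ T) (Sum.elim P Q) (by
    rintro (i | i)
    · exact ⟨(hP i).1, (hP i).2.trans Set.subset_union_left⟩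
    · exact ⟨(hQ i).1, (hQ i).2.trans Set.subset_union_right⟩) (by
    rintro (i | i) (j | j) hij
    · exact hd i j fun e => hij (by rw [e])
    · exact hST.mono (hP i).2 (hQ j).2
    · exact hST.symm.mono (hQ i).2 (hP j).2
    · exact hd' i j fun e => hij (by rw [e]))
  simpa using this

lemma Pack.one (hP : IsP4 G P) (hPS : P ⊆ S) : Pack G S 1 :=
  ⟨fun _ => P, fun _ => ⟨hP, hPS⟩, fun i j hij => (hij (Subsingleton.elim i j)).elim⟩

/-- The maximum packing and the minimum cover of `W` have the same size. -/
def MinMax (G : SimpleGraph V) (W : Set V) : Prop := ∃ n, Pack G W n ∧ Cov G W n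

lemma MinMax.of_noP4 (h : NoP4 G W) : MinMax G W :=
  ⟨0, ⟨Fin.elim0, fun i => i.elim0, fun i => i.elim0⟩, ∅, by simp,
    fun P hP hPW => (h P hP hPW).elim⟩

/-- If as many disjoint paths in `S` as the set `Y` has elements exist and `Y` meets all paths that
meet `S`, then `S` can be removed. -/
lemma MinMax.of_remove (hSW : S ⊆ W) {m : ℕ} {Y : Set V} (hY : Y.ncard ≤ m)
    (hS : Pack G S m) (hhit : ∀ P, IsP4 G P → P ⊆ W → (P ∩ S).Nonempty → ∃ y ∈ Y, y ∈ P)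
    (h : MinMax G (W \ S)) : MinMax G W := by
  obtain ⟨n, hn, X, hX, hXP⟩ := h
  refine ⟨m + n, (hS.union hn Set.disjoint_sdiff_right).mono ?_, Y ∪ X, ?_, ?_⟩
  · rintro x (hx | hx)
    exacts [hSW hx, hx.1]
  · exact (Set.ncard_union_le Y X).trans (by omega)
  · intro P hP hPW
    by_cases hPS : (P ∩ S).Nonempty
    · obtain ⟨y, hy, hyP⟩ := hhit P hP hPW hPS
      exact ⟨y, Or.inl hy, hyP⟩
    · obtain ⟨x, hx, hxP⟩ := hXP P hP fun p hp => ⟨hPW hp, fun hpS => hPS ⟨p, hp, hpS⟩⟩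
      exact ⟨x, Or.inr hx, hxP⟩

/-- The reduction with a single cover vertex: `S` contains a path, and `x` meets every path that
touches `S`, so both numbers drop by one when `S` is removed. -/
lemma MinMax.of_remove_one (hSW : S ⊆ W) {x : V} (hS : ¬ NoP4 G S)
    (hhit : ∀ P, IsP4 G P → P ⊆ W → (P ∩ S).Nonempty → x ∈ P)
    (h : ∀ W', W' ⊂ W → MinMax G W') : MinMax G W := by
  simp only [NoP4, not_forall, not_not] at hS
  obtain ⟨P, hP, hPS⟩ := hS
  obtain ⟨p, hp⟩ := hP.nonempty
  refine MinMax.of_remove hSW (Y := {x}) (by simp) (Pack.one hP hPS)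
    (fun P hP hPW hPS => ⟨x, rfl, hhit P hP hPW hPS⟩) (h _ ⟨Set.sdiff_subset, fun hsub => ?_⟩)
  exact (hsub (hSW (hPS hp))).2 (hPS hp)

/-- A block with a triangle has a vertex `x` such that everything else close to the block contains
no path of order four. -/
lemma exists_separator [Finite V] (h : IsBlk G W B) (hB : K4S G W B ∨ T2S G W B ∨ TS G W B) :
    ∃ x ∈ B, ∃ Q ⊆ W, B \ {x} ⊆ Q ∧ x ∉ Q ∧
      (∀ q ∈ Q, ∀ w ∈ W, G.Adj q w → w ∈ Q ∨ w = x) ∧ NoP4 G Q := by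
  -- If `B` has four vertices and only `x` is attached, the remaining three vertices are too few for
  -- a path and have no other neighbours.
  have key : ∀ x ∈ B, B.ncard ≤ 4 → (∀ y ∈ B, Att G W B y → y = x) →
      ∃ x ∈ B, ∃ Q ⊆ W, B \ {x} ⊆ Q ∧ x ∉ Q ∧
      (∀ q ∈ Q, ∀ w ∈ W, G.Adj q w → w ∈ Q ∨ w = x) ∧ NoP4 G Q := by
    intro x hx hcard hatt
    refine ⟨x, hx, B \ {x}, fun y hy => h.subset hy.1, Set.Subset.rfl, fun hx => hx.2 rfl, ?_, ?_⟩
    · intro q hq w hw hqw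
      by_cases hwB : w ∈ B
      · by_cases hwx : w = x
        · exact Or.inr hwx
        · exact Or.inl ⟨hwB, hwx⟩
      · exact absurd (hatt q hq.1 ⟨w, hw, hwB, hqw⟩) hq.2
    · intro P hP hPS
      have h1 := Set.ncard_le_ncard hPS
      have h2 := Set.ncard_sdiff_singleton_lt_of_mem hx
      rw [hP.ncard_eq] at h1
      omega
  have four : ∀ a b c d : V, ({a, b, c, d} : Set V).ncard ≤ 4 := by
    intro a b c d
    have h1 := Set.ncard_insert_le a {b, c, d}
    have h2 := Set.ncard_insert_le b {c, d}
    have h3 := Set.ncard_insert_le c {d}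
    rw [Set.ncard_singleton] at h3
    omega
  rcases hB with ⟨a, b, c, d, -, -, -, -, -, -, hB, hatt⟩ | ⟨a, b, c, d, -, hT, hatt⟩ |
    ⟨a, b, C, hT, hatt, hleaf⟩
  · have hcard : B.ncard ≤ 4 := by rw [hB]; exact four a b c d
    by_cases hex : ∃ x ∈ B, Att G W B x
    · obtain ⟨x, hx, hxa⟩ := hex
      exact key x hx hcard fun y hy hya => hatt y hy x hx hya hxa
    · exact key a (by rw [hB]; simp) hcard fun y hy hya => absurd ⟨y, hy, hya⟩ hex
  · have hBeq : B = {a, b, c, d} := by rw [hT.eq]; ext x; simp; tauto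
    exact key c (by rw [hBeq]; simp) (by rw [hBeq]; exact four a b c d) hatt
  · have ha : a ∈ B := by rw [hT.eq]; simp
    have hb : b ∈ B := by rw [hT.eq]; simp
    have hC : ∀ c ∈ C, c ∈ B := fun c hc => by rw [hT.eq]; exact Or.inr hc
    have hBx : ∀ x ∈ B, x = a ∨ x = b ∨ x ∈ C := fun x hx => by
      rw [hT.eq] at hx
      rcases hx with (rfl | rfl) | hx
      exacts [Or.inl rfl, Or.inr (Or.inl rfl), Or.inr (Or.inr hx)]
    have hCa : ∀ c ∈ C, ¬ Att G W B c := by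
      intro c hc hca
      rcases hatt c (hC c hc) hca with rfl | rfl
      exacts [hT.left hc, hT.right hc]
    -- Without the hub `a`, what remains of the block together with the leaves at `b` is a star with
    -- centre `b`.
    refine ⟨a, ha, {x | x = b ∨ x ∈ C ∨ (x ∈ W ∧ x ∉ B ∧ G.Adj b x)}, ?_, ?_, ?_, ?_, ?_⟩
    · rintro x (rfl | hx | hx)
      exacts [h.subset hb, h.subset (hC x hx), hx.1]
    · rintro x ⟨hx, hxa⟩
      rcases hBx x hx with rfl | rfl | hx
      exacts [absurd rfl hxa, Or.inl rfl, Or.inr (Or.inl hx)]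
    · rintro (hab | haC | haB)
      exacts [hT.adj.ne hab, hT.left haC, haB.2.1 ha]
    · rintro q (rfl | hq | ⟨hq, hqB, hbq⟩) w hw hqw
      · by_cases hwB : w ∈ B
        · rcases hBx w hwB with rfl | rfl | hx
          exacts [Or.inr rfl, Or.inl (Or.inl rfl), Or.inl (Or.inr (Or.inl hx))]
        · exact Or.inl (Or.inr (Or.inr ⟨hw, hwB, hqw⟩))
      · by_cases hwB : w ∈ B
        · rcases hBx w hwB with rfl | rfl | hx
          exacts [Or.inr rfl, Or.inl (Or.inl rfl), absurd hqw (hT.indep q hq w hx)]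
        · exact absurd ⟨w, hw, hwB, hqw⟩ (hCa q hq)
      · exact Or.inl (Or.inl (hleaf q hq hqB hbq w hw hqw))
    · refine NoP4.of_star (b := b) ?_
      rintro q (rfl | hq | ⟨hq, hqB, hbq⟩) hqb y hy hqy
      · exact absurd rfl hqb
      · rcases hy with rfl | hy | ⟨hy, hyB, -⟩
        · rfl
        · exact absurd hqy (hT.indep q hq y hy)
        · exact absurd ⟨y, hy, hyB, hqy⟩ (hCa q hq)
      · have hyW : y ∈ W := by
          rcases hy with rfl | hy | hy
          exacts [h.subset hb, h.subset (hC y hy), hy.1]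
        exact hleaf q hq hqB hbq y hyW hqy

end Packing

/-! ### Hall's theorem and a selection from pairs -/

section Hall
variable {V : Type u} {G : SimpleGraph V}

lemma exists_injOn_of_hall [Finite V] (T : Set V) (N : V → Set V)
    (h : ∀ S ⊆ T, S.ncard ≤ {x | ∃ y ∈ S, x ∈ N y}.ncard) :
    ∃ f : V → V, Set.InjOn f T ∧ ∀ y ∈ T, f y ∈ N y := by
  classical
  have := Fintype.ofFinite V
  obtain ⟨f, hf, hfN⟩ := (Finset.all_card_le_biUnion_card_iff_exists_injective
    (fun y : T => (N y).toFinset)).1 (by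
      intro s
      have h1 := h (Subtype.val '' (s : Set T)) (by rintro _ ⟨y, -, rfl⟩; exact y.2)
      rw [Set.ncard_image_of_injective _ Subtype.val_injective, Set.ncard_coe_finset] at h1
      refine h1.trans (le_of_eq ?_)
      rw [← Set.ncard_coe_finset]
      congr 1
      ext x
      simp)
  refine ⟨fun y => if hy : y ∈ T then f ⟨y, hy⟩ else y, ?_, ?_⟩
  · intro y hy y' hy' hyy
    simp only [hy, hy', dif_pos] at hyy
    exact congrArg Subtype.val (hf hyy)
  · intro y hy
    simp only [hy, dif_pos]
    simpa using hfN ⟨y, hy⟩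

/-- A selection from pairs where every element belongs to few pairs. -/
lemma exists_select [Finite V] {Y X₀ : Set V} {ρ g h : V → V}
    (hpair : ∀ y ∈ Y, (y, g y) ≠ (ρ y, h y)) (hρ : ∀ y ∈ Y, ∀ y' ∈ Y, ρ y = ρ y' → y = y')
    (hρ' : ∀ y ∈ Y, ∀ y' ∈ Y, ρ y = y' → y = y')
    (hdeg : ∀ f, ∃ u v, ∀ y ∈ Y, (g y = f → y = u ∨ y = v) ∧ (h y = f → ρ y = u ∨ ρ y = v))
    (hsub : X₀.Subsingleton)
    (hdeg₀ : ∀ f ∈ X₀, ∃ u, ∀ y ∈ Y, (g y = f → y = u) ∧ (h y = f → ρ y = u)) :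
    ∃ s : V → V, Set.InjOn s Y ∧ ∀ y ∈ Y, (s y = g y ∨ s y = h y) ∧ s y ∉ X₀ := by
  classical
  have := Fintype.ofFinite V
  refine (exists_injOn_of_hall Y (fun y => {x | (x = g y ∨ x = h y) ∧ x ∉ X₀}) ?_)
  intro S hS
  set F : Set V := {x | ∃ y ∈ S, (x = g y ∨ x = h y) ∧ x ∉ X₀} with hF
  -- Double counting of incidences for Hall's condition. The elements of `S` give `2 * S.ncard`
  -- distinct pairs (end, candidate), and each candidate occurs in at most two of them.
  set P₁ : Finset (V × V) := S.toFinset.image fun y => (y, g y) with hP₁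
  set P₂ : Finset (V × V) := S.toFinset.image fun y => (ρ y, h y) with hP₂
  have c1 : P₁.card = S.ncard := by
    rw [Finset.card_image_of_injOn, Set.ncard_eq_toFinset_card']
    intro y _ y' _ hyy
    exact congrArg Prod.fst hyy
  have c2 : P₂.card = S.ncard := by
    rw [Finset.card_image_of_injOn, Set.ncard_eq_toFinset_card']
    intro y hy y' hy' hyy
    rw [Set.coe_toFinset] at hy hy'
    exact hρ y (hS hy) y' (hS hy') (congrArg Prod.fst hyy)
  have hdis : Disjoint P₁ P₂ := by
    rw [Finset.disjoint_left]
    intro x hx hx'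
    simp only [hP₁, hP₂, Finset.mem_image, Set.mem_toFinset] at hx hx'
    obtain ⟨y, hy, rfl⟩ := hx
    obtain ⟨y', hy', hyy⟩ := hx'
    have := hρ' y' (hS hy') y (hS hy) (congrArg Prod.fst hyy)
    subst this
    exact hpair y' (hS hy') hyy.symm
  have c3 : (P₁ ∪ P₂).card = 2 * S.ncard := by
    rw [Finset.card_union_of_disjoint hdis, c1, c2]; ring
  have c4 := Finset.card_filter_add_card_filter_not (s := P₁ ∪ P₂) (fun x => x.2 ∈ X₀)
  have mem : ∀ x ∈ P₁ ∪ P₂, ∃ y ∈ S, x = (y, g y) ∨ x = (ρ y, h y) := by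
    intro x hx
    simp only [hP₁, hP₂, Finset.mem_union, Finset.mem_image, Set.mem_toFinset] at hx
    rcases hx with ⟨y, hy, rfl⟩ | ⟨y, hy, rfl⟩
    exacts [⟨y, hy, Or.inl rfl⟩, ⟨y, hy, Or.inr rfl⟩]
  -- The forbidden set `X₀` has at most one element, and that element has only one admissible end,
  -- so it costs a single incidence.
  have c5 : ((P₁ ∪ P₂).filter fun x => x.2 ∈ X₀).card ≤ 1 := by
    rw [Finset.card_le_one]
    have : ∀ x ∈ (P₁ ∪ P₂).filter fun x => x.2 ∈ X₀, ∀ u, (∀ y ∈ Y, (g y = x.2 → y = u) ∧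
        (h y = x.2 → ρ y = u)) → x.1 = u := by
      intro x hx u hu
      obtain ⟨y, hy, rfl | rfl⟩ := mem x (Finset.mem_filter.1 hx).1
      · exact (hu y (hS hy)).1 rfl
      · exact (hu y (hS hy)).2 rfl
    intro x hx x' hx'
    have e := hsub (Finset.mem_filter.1 hx).2 (Finset.mem_filter.1 hx').2
    obtain ⟨u, hu⟩ := hdeg₀ x.2 (Finset.mem_filter.1 hx).2
    have e1 := this x hx u hu
    have e2 := this x' hx' u (by rwa [← e])
    exact Prod.ext (e1.trans e2.symm) e
  have c6 : ((P₁ ∪ P₂).filter fun x => ¬ x.2 ∈ X₀).card ≤ 2 * F.toFinset.card := by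
    refine Finset.card_le_mul_card_image_of_maps_to (f := Prod.snd) ?_ 2 ?_
    · intro x hx
      rw [Finset.mem_filter] at hx
      rw [Set.mem_toFinset]
      obtain ⟨y, hy, rfl | rfl⟩ := mem x hx.1
      · exact ⟨y, hy, Or.inl rfl, hx.2⟩
      · exact ⟨y, hy, Or.inr rfl, hx.2⟩
    · intro f _
      obtain ⟨u, v, huv⟩ := hdeg f
      refine (Finset.card_le_card (t := {(u, f), (v, f)}) ?_).trans Finset.card_le_two
      intro x hx
      rw [Finset.mem_filter, Finset.mem_filter] at hx
      obtain ⟨⟨hx, -⟩, rfl⟩ := hx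
      obtain ⟨y, hy, rfl | rfl⟩ := mem x hx
      · rcases (huv y (hS hy)).1 rfl with e | e <;> simp [← e]
      · rcases (huv y (hS hy)).2 rfl with e | e <;> simp [← e]
  rw [← Set.ncard_eq_toFinset_card'] at c6
  have c7 : F = {x | ∃ y ∈ S, x ∈ {x | (x = g y ∨ x = h y) ∧ x ∉ X₀}} := rfl
  rw [← c7]
  -- From `2 * S.ncard ≤ 1 + 2 * F.ncard`, Hall's condition follows by integrality; this is why one
  -- lost incidence is affordable.
  omega

end Hall

/-! ### From a minimum vertex cover of the multigraph to disjoint paths -/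

section CoverPacking
variable {V : Type u} {G : SimpleGraph V} {W B A₀ A₁ E H Y Z : Set V}

namespace SubS

lemma swap (h : SubS G W B A₀ A₁ E) : SubS G W B A₁ A₀ E where
  union := by rw [h.union, Set.union_comm A₀ A₁]
  disj := h.disj.symm
  disj₀ := h.disj₁
  disj₁ := h.disj₀
  indep x hx := h.indep x hx.symm
  ends e he := by
    obtain ⟨u, hu, v, hv, huv⟩ := h.ends e he
    exact ⟨v, hv, u, hu, fun y hy => (huv y hy).trans Or.comm⟩

lemma mem_of_mem (h : SubS G W B A₀ A₁ E) {x : V} (hx : x ∈ A₀ ∪ A₁) : x ∈ B := by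
  rw [h.union]; exact Or.inl hx

lemma mem_of_mem_E (h : SubS G W B A₀ A₁ E) {x : V} (hx : x ∈ E) : x ∈ B := by
  rw [h.union]; exact Or.inr hx

lemma notMem_E (h : SubS G W B A₀ A₁ E) {x : V} (hx : x ∈ A₀ ∪ A₁) : x ∉ E :=
  hx.elim (fun hx => Set.disjoint_left.1 h.disj₀ hx) fun hx => Set.disjoint_left.1 h.disj₁ hx

lemma mem_or (h : SubS G W B A₀ A₁ E) {x : V} (hx : x ∈ B) : x ∈ A₀ ∪ A₁ ∨ x ∈ E := by
  rw [h.union] at hx; exact hx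

lemma mem_of_adj (h : SubS G W B A₀ A₁ E) {e x : V} (he : e ∈ E) (hx : x ∈ W) (hex : G.Adj e x) :
    x ∈ A₀ ∪ A₁ := by
  obtain ⟨u, hu, v, hv, huv⟩ := h.ends e he
  rcases (huv x hx).1 hex with rfl | rfl
  exacts [Or.inl hu, Or.inr hv]

lemma eq_or_eq (h : SubS G W B A₀ A₁ E) {e x y w : V} (he : e ∈ E) (hx : x ∈ W) (hy : y ∈ W)
    (hw : w ∈ W) (hex : G.Adj e x) (hey : G.Adj e y) (hew : G.Adj e w) (hxy : x ≠ y) :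
    w = x ∨ w = y := by
  obtain ⟨u, hu, v, hv, huv⟩ := h.ends e he
  rw [huv _ hx] at hex
  rw [huv _ hy] at hey
  rw [huv _ hw] at hew
  grind

lemma exists_two (h : SubS G W B A₀ A₁ E) (hB : IsBlk G W B) {x : V} (hx : x ∈ A₀ ∪ A₁) :
    ∃ s ∈ E, ∃ t ∈ E, s ≠ t ∧ G.Adj s x ∧ G.Adj t x := by
  obtain ⟨s, hs, t, ht, hst, hxs, hxt⟩ := hB.two_conn.exists_two_adj hB.card (h.mem_of_mem hx)
  exact ⟨s, h.indep x hx s hs hxs, t, h.indep x hx t ht hxt, hst, hxs.symm, hxt.symm⟩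

end SubS

/-- `Y` is a vertex cover of the multigraph with vertex set `A` and edge set `E` that contains
`H`. -/
def IsCover (G : SimpleGraph V) (A E H Y : Set V) : Prop :=
  Y ⊆ A ∧ H ⊆ Y ∧ ∀ e ∈ E, ∃ y ∈ Y, G.Adj e y

/-- The exchange behind König's theorem. If Hall's condition failed for `T`, replacing `T` in `Y` by
its neighbours outside of `Y` would give another cover. The hypothesis `hmin` says that covers no
larger than `Y` have the same size and avoid `Z`, which allows the partners to avoid `Z` too. -/
lemma SubS.exists_matching_side [Finite V] (hS : SubS G W B A₀ A₁ E) (hBW : B ⊆ W)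
    (hZ : Z.Subsingleton) (hY : IsCover G (A₀ ∪ A₁) E H Y)
    (hmin : ∀ Y', IsCover G (A₀ ∪ A₁) E H Y' → Y'.ncard ≤ Y.ncard →
      Y.ncard ≤ Y'.ncard ∧ Disjoint Y' Z) :
    ∃ f : V → V, Set.InjOn f ((Y \ H) ∩ A₀) ∧ ∀ y ∈ (Y \ H) ∩ A₀,
      f y ∈ A₁ ∧ f y ∉ Y ∧ f y ∉ Z ∧ ∃ e ∈ E, G.Adj e y ∧ G.Adj e (f y) := by
  obtain ⟨f, hf, hfN⟩ := exists_injOn_of_hall ((Y \ H) ∩ A₀)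
    (fun y => {x | x ∈ A₁ ∧ x ∉ Y ∧ x ∉ Z ∧ ∃ e ∈ E, G.Adj e y ∧ G.Adj e x}) (by
      intro T hT
      set N : Set V := {x | ∃ y ∈ T, x ∈ A₁ ∧ x ∉ Y ∧ ∃ e ∈ E, G.Adj e y ∧ G.Adj e x} with hN
      have hNZ : {x | ∃ y ∈ T, x ∈ {x | x ∈ A₁ ∧ x ∉ Y ∧ x ∉ Z ∧ ∃ e ∈ E,
          G.Adj e y ∧ G.Adj e x}} = N \ Z := by
        ext x
        simp only [hN, Set.mem_ofPred_eq, Set.mem_sdiff]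
        constructor
        · rintro ⟨y, hy, h1, h2, h3, h4⟩
          exact ⟨⟨y, hy, h1, h2, h4⟩, h3⟩
        · rintro ⟨⟨y, hy, h1, h2, h4⟩, h3⟩
          exact ⟨y, hy, h1, h2, h3, h4⟩
      rw [hNZ]
      by_contra! hlt
      have hTY : T ⊆ Y := fun y hy => (hT hy).1.1
      -- An edge that loses its covering end in `T` has its other end either in `Y`, and then on the
      -- side of `A₁` and kept, or in `N`.
      have hcov : IsCover G (A₀ ∪ A₁) E H ((Y \ T) ∪ N) := by
        refine ⟨?_, ?_, ?_⟩
        · rintro x (hx | ⟨y, -, hx, -⟩)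
          exacts [hY.1 hx.1, Or.inr hx]
        · intro x hx
          exact Or.inl ⟨hY.2.1 hx, fun hxT => (hT hxT).1.2 hx⟩
        · intro e he
          obtain ⟨u, hu, v, hv, huv⟩ := hS.ends e he
          have hvW := hBW (hS.mem_of_mem (Or.inr hv))
          have huW := hBW (hS.mem_of_mem (Or.inl hu))
          have heu := (huv u huW).2 (Or.inl rfl)
          have hev := (huv v hvW).2 (Or.inr rfl)
          by_cases hvY : v ∈ Y
          · exact ⟨v, Or.inl ⟨hvY, fun hvT => Set.disjoint_left.1 hS.disj (hT hvT).2 hv⟩, hev⟩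
          · have huY : u ∈ Y := by
              obtain ⟨y, hy, hey⟩ := hY.2.2 e he
              rcases (huv y (hBW (hS.mem_of_mem (hY.1 hy)))).1 hey with rfl | rfl
              exacts [hy, absurd hy hvY]
            by_cases huT : u ∈ T
            · exact ⟨v, Or.inr ⟨u, huT, hv, hvY, e, he, heu, hev⟩, hev⟩
            · exact ⟨u, Or.inl ⟨huY, huT⟩, heu⟩
      have c1 := Set.ncard_union_le (Y \ T) N
      have c2 := Set.ncard_sdiff_add_ncard_of_subset hTY
      have c3 : N.ncard ≤ (N \ Z).ncard + Z.ncard := Set.ncard_le_ncard_sdiff_add_ncard N Z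
      have c4 : Z.ncard ≤ 1 := Set.ncard_le_one_iff_subsingleton.2 hZ
      -- As `Z` has at most one element, failure of Hall's condition still gives `N.ncard ≤
      -- T.ncard`. So the new cover is not larger and avoids `Z`; hence `N \ Z = N`, and the new
      -- cover is in fact smaller than `Y`.
      obtain ⟨h1, h2⟩ := hmin _ hcov (by omega)
      have h3 : N \ Z = N := (h2.mono_left Set.subset_union_right).sdiff_eq_left
      rw [h3] at hlt
      omega)
  refine ⟨f, hf, fun y hy => hfN y hy⟩

/-- The matchings of the two sides fit together because their images lie on opposite sides. The map
`m` records the subdivision vertices of the matching edges. -/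
lemma SubS.exists_matching [Finite V] (hS : SubS G W B A₀ A₁ E) (hBW : B ⊆ W)
    (hZ : Z.Subsingleton) (hY : IsCover G (A₀ ∪ A₁) E H Y)
    (hmin : ∀ Y', IsCover G (A₀ ∪ A₁) E H Y' → Y'.ncard ≤ Y.ncard →
      Y.ncard ≤ Y'.ncard ∧ Disjoint Y' Z) :
    ∃ f m : V → V, Set.InjOn f (Y \ H) ∧ ∀ y ∈ Y \ H,
      f y ∈ A₀ ∪ A₁ ∧ f y ∉ Y ∧ f y ∉ Z ∧ m y ∈ E ∧ G.Adj (m y) y ∧ G.Adj (m y) (f y) := by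
  classical
  obtain ⟨f₀, hf₀, h₀⟩ := hS.exists_matching_side hBW hZ hY hmin
  rw [Set.union_comm] at hY hmin
  obtain ⟨f₁, hf₁, h₁⟩ := hS.swap.exists_matching_side hBW hZ hY hmin
  have hside : ∀ y ∈ Y \ H, y ∉ A₀ → y ∈ (Y \ H) ∩ A₁ := fun y hy h =>
    ⟨hy, (hY.1 hy.1).resolve_right h⟩
  have hex : ∀ y, ∃ e, y ∈ Y \ H → e ∈ E ∧ G.Adj e y ∧
      G.Adj e (if y ∈ A₀ then f₀ y else f₁ y) := by
    intro y
    by_cases hy : y ∈ Y \ H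
    · split_ifs with hy0
      · obtain ⟨e, he⟩ := (h₀ y ⟨hy, hy0⟩).2.2.2
        exact ⟨e, fun _ => he⟩
      · obtain ⟨e, he⟩ := (h₁ y (hside y hy hy0)).2.2.2
        exact ⟨e, fun _ => he⟩
    · exact ⟨y, fun h => absurd h hy⟩
  choose m hm using hex
  refine ⟨fun y => if y ∈ A₀ then f₀ y else f₁ y, m, ?_, ?_⟩
  · intro y hy y' hy' hyy
    by_cases h0 : y ∈ A₀ <;> by_cases h1 : y' ∈ A₀ <;> simp only [h0, h1, if_true, if_false] at hyy
    · exact hf₀ ⟨hy, h0⟩ ⟨hy', h1⟩ hyy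
    · exact (Set.disjoint_left.1 hS.disj (hyy ▸ (h₁ y' (hside y' hy' h1)).1)
        (h₀ y ⟨hy, h0⟩).1).elim
    · exact (Set.disjoint_left.1 hS.disj (hyy ▸ (h₁ y (hside y hy h0)).1)
        (h₀ y' ⟨hy', h1⟩).1).elim
    · exact hf₁ (hside y hy h0) (hside y' hy' h1) hyy
  · intro y hy
    obtain ⟨m1, m2, m3⟩ := hm y hy
    by_cases h0 : y ∈ A₀
    · simp only [h0, if_true] at m3 ⊢
      obtain ⟨n1, n2, n3, -⟩ := h₀ y ⟨hy, h0⟩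
      exact ⟨Or.inr n1, n2, n3, m1, m2, m3⟩
    · simp only [h0, if_false] at m3 ⊢
      obtain ⟨n1, n2, n3, -⟩ := h₁ y (hside y hy h0)
      exact ⟨Or.inl n1, n2, n3, m1, m2, m3⟩

/-- From a minimum cover one obtains equally many disjoint paths of order four. -/
theorem SubS.pack_of_cover [Finite V] (hS : SubS G W B A₀ A₁ E) (hB : IsBlk G W B)
    (hZ : Z.Subsingleton) (hZA : Z ⊆ A₀ ∪ A₁) (hY : IsCover G (A₀ ∪ A₁) E H Y)
    (hmin : ∀ Y', IsCover G (A₀ ∪ A₁) E H Y' → Y'.ncard ≤ Y.ncard →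
      Y.ncard ≤ Y'.ncard ∧ Disjoint Y' Z)
    {D X : Set V} {z : V} (hBD : B ⊆ insert z D)
    (hD : ∀ d ∈ D, ∀ w ∈ W, G.Adj d w → w ∈ D ∨ w = z) (hz : z ∈ B)
    (hH : ∀ v ∈ H, v ≠ z ∧ ∃ d d', d ∈ W ∧ d ∉ B ∧ G.Adj v d ∧ d' ∈ W ∧ G.Adj d d' ∧ d' ≠ v)
    (hX : X.Subsingleton) (hXE : X ⊆ E) (hXZ : ∀ e ∈ X, ∃ x ∈ Z, G.Adj e x) :
    Pack G (insert z D \ (Z ∪ X)) Y.ncard := by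
  classical
  have := Fintype.ofFinite V
  obtain ⟨π, m, hπ, hm⟩ := hS.exists_matching hB.subset hZ hY hmin
  have hYZ : ∀ y ∈ Y, y ∉ Z := fun y hy => Set.disjoint_left.1 (hmin Y hY le_rfl).2 hy
  have AW : ∀ {x}, x ∈ A₀ ∪ A₁ → x ∈ W := fun hx => hB.subset (hS.mem_of_mem hx)
  have hYW : ∀ {y}, y ∈ Y → y ∈ W := fun hy => AW (hY.1 hy)
  have hmend : ∀ y ∈ Y \ H, ∀ w ∈ W, G.Adj (m y) w → w = y ∨ w = π y := by
    intro y hy w hw hmw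
    obtain ⟨h1, h2, -, h4, h5, h6⟩ := hm y hy
    exact hS.eq_or_eq h4 (hYW hy.1) (AW h1) hw h5 h6 hmw fun e => h2 (e ▸ hy.1)
  -- candidates for the last vertices of the paths
  have hcand : ∀ y, ∃ r g h : V, y ∈ Y → g ∈ E ∧ h ∈ E ∧ G.Adj g y ∧ G.Adj h r ∧
      (y, g) ≠ (r, h) ∧ ((y ∈ H ∧ r = y) ∨ (y ∉ H ∧ r = π y ∧ g ≠ m y ∧ h ≠ m y)) := by
    intro y
    by_cases hy : y ∈ Y
    swap
    · exact ⟨y, y, y, fun h => absurd h hy⟩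
    by_cases hyH : y ∈ H
    · obtain ⟨s, hs, t, ht, hst, hsy, hty⟩ := hS.exists_two hB (hY.1 hy)
      exact ⟨y, s, t, fun _ => ⟨hs, ht, hsy, hty, fun e => hst (congrArg Prod.snd e),
        Or.inl ⟨hyH, rfl⟩⟩⟩
    · obtain ⟨h1, h2, -⟩ := hm y ⟨hy, hyH⟩
      have hne : ∀ x ∈ A₀ ∪ A₁, ∃ s ∈ E, G.Adj s x ∧ s ≠ m y := by
        intro x hx
        obtain ⟨s, hs, t, ht, hst, hsy, hty⟩ := hS.exists_two hB hx
        by_cases hsm : s = m y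
        · exact ⟨t, ht, hty, fun e => hst (hsm.trans e.symm)⟩
        · exact ⟨s, hs, hsy, hsm⟩
      obtain ⟨s, hs, hsy, hsm⟩ := hne y (hY.1 hy)
      obtain ⟨t, ht, hty, htm⟩ := hne (π y) h1
      exact ⟨π y, s, t, fun _ => ⟨hs, ht, hsy, hty, fun e => h2 ((Prod.mk.inj e).1 ▸ hy),
        Or.inr ⟨hyH, rfl, hsm, htm⟩⟩⟩
  choose ρ g h hc using hcand
  have hρA : ∀ y ∈ Y, ρ y ∈ A₀ ∪ A₁ ∧ ρ y ∉ Z := by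
    intro y hy
    obtain ⟨-, -, -, -, -, ⟨hyH, e⟩ | ⟨hyH, e, -⟩⟩ := hc y hy
    · rw [e]; exact ⟨hY.1 hy, hYZ y hy⟩
    · rw [e]; exact ⟨(hm y ⟨hy, hyH⟩).1, (hm y ⟨hy, hyH⟩).2.2.1⟩
  have hρY : ∀ y ∈ Y, ∀ y' ∈ Y, ρ y = y' → y = y' := by
    intro y hy y' hy' e'
    obtain ⟨-, -, -, -, -, ⟨hyH, e⟩ | ⟨hyH, e, -⟩⟩ := hc y hy
    · exact e.symm.trans e'
    · exact absurd ((e.symm.trans e') ▸ hy') (hm y ⟨hy, hyH⟩).2.1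
  -- Three vertices of the path of `y` are already fixed: a hanging path and `y` if `y ∈ H`, and
  -- `y`, `m y`, `π y` otherwise. The fourth one, `s y`, is `g y` next to `y` or `h y` next to `ρ
  -- y`, where `ρ y` is `y` itself or `π y`, respectively.
  obtain ⟨s, hs, hsel⟩ := exists_select (Y := Y) (X₀ := X) (ρ := ρ) (g := g) (h := h)
    (fun y hy => (hc y hy).2.2.2.2.1) (by
      intro y hy y' hy' hyy
      obtain ⟨-, -, -, -, -, ⟨hyH, e⟩ | ⟨hyH, e, -⟩⟩ := hc y hy
      · exact (hρY y' hy' y hy (hyy.symm.trans e)).symm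
      · obtain ⟨-, -, -, -, -, ⟨hyH', e'⟩ | ⟨hyH', e', -⟩⟩ := hc y' hy'
        · exact hρY y hy y' hy' (hyy.trans e')
        · exact hπ ⟨hy, hyH⟩ ⟨hy', hyH'⟩ (e.symm.trans (hyy.trans e'))) hρY (by
      intro f
      by_cases hf : f ∈ E
      · obtain ⟨u, -, v, -, huv⟩ := hS.ends f hf
        refine ⟨u, v, fun y hy => ⟨?_, ?_⟩⟩
        · rintro rfl
          exact (huv y (hYW hy)).1 (hc y hy).2.2.1
        · rintro rfl
          exact (huv _ (AW (hρA y hy).1)).1 (hc y hy).2.2.2.1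
      · refine ⟨f, f, fun y hy => ⟨?_, ?_⟩⟩
        · rintro rfl
          exact absurd (hc y hy).1 hf
        · rintro rfl
          exact absurd (hc y hy).2.1 hf) hX (by
      intro f hf
      -- One end of `f` is in `Z`, which contains no `y` and no `ρ y`; only the other end can use
      -- `f`.
      obtain ⟨x, hx, hfx⟩ := hXZ f hf
      have hxW : x ∈ W := AW (hZA hx)
      obtain ⟨u, -, v, -, huv⟩ := hS.ends f (hXE hf)
      have hxuv := (huv x hxW).1 hfx
      have hmain : ∃ w, ∀ y ∈ W, y ∉ Z → G.Adj f y → y = w := by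
        rcases hxuv with rfl | rfl
        · exact ⟨v, fun y hy hyZ hfy => ((huv y hy).1 hfy).resolve_left fun e => hyZ (e ▸ hx)⟩
        · exact ⟨u, fun y hy hyZ hfy => ((huv y hy).1 hfy).resolve_right fun e => hyZ (e ▸ hx)⟩
      obtain ⟨w, hw⟩ := hmain
      refine ⟨w, fun y hy => ⟨?_, ?_⟩⟩
      · rintro rfl
        exact hw y (hYW hy) (hYZ y hy) (hc y hy).2.2.1
      · rintro rfl
        exact hw _ (AW (hρA y hy).1) (hρA y hy).2 (hc y hy).2.2.2.1)
  have hsE : ∀ y ∈ Y, s y ∈ E := by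
    intro y hy
    rcases (hsel y hy).1 with e | e <;> rw [e]
    exacts [(hc y hy).1, (hc y hy).2.1]
  -- The ends of `m y'` are `y'` and `π y'`, so only the path of `y'` itself could select it, and
  -- the candidates of `y'` were chosen different from `m y'`.
  have hsm : ∀ y ∈ Y, ∀ y' ∈ Y \ H, s y ≠ m y' := by
    intro y hy y' hy' e
    obtain ⟨h1, h2, h3, h4, h5, h6⟩ := hm y' hy'
    obtain ⟨c1, c2, c3, c4, -, ⟨hyH, e'⟩ | ⟨hyH, e', c6, c7⟩⟩ := hc y hy
    · have hadj : G.Adj (m y') y := by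
        rw [← e]
        rcases (hsel y hy).1 with e'' | e'' <;> rw [e'']
        exacts [c3, by rwa [e'] at c4]
      rcases hmend y' hy' y (hYW hy) hadj with rfl | rfl
      exacts [hy'.2 hyH, h2 hy]
    · rcases (hsel y hy).1 with e'' | e''
      · rcases hmend y' hy' y (hYW hy) (by rw [← e, e'']; exact c3) with rfl | rfl
        exacts [c6 (e''.symm.trans e), h2 hy]
      · have hρ : ρ y ∈ W := AW (hρA y hy).1
        rcases hmend y' hy' (ρ y) hρ (by rw [← e, e'']; exact c4) with e3 | e3
        · have := hρY y hy y' hy'.1 e3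
          subst this
          exact c7 (e''.symm.trans e)
        · have := hπ ⟨hy, hyH⟩ hy' (e'.symm.trans e3)
          subst this
          exact c7 (e''.symm.trans e)
  have hHd : ∀ v, ∃ d d', v ∈ H → d ∈ W ∧ d ∉ B ∧ G.Adj v d ∧ d' ∈ W ∧ G.Adj d d' ∧ d' ≠ v := by
    intro v
    by_cases hv : v ∈ H
    · obtain ⟨-, d, d', hd⟩ := hH v hv
      exact ⟨d, d', fun _ => hd⟩
    · exact ⟨v, v, fun h => absurd h hv⟩
  choose d d' hd using hHd
  have hHB : ∀ {v}, v ∈ H → v ∈ B := fun hv => hS.mem_of_mem (hY.1 (hY.2.1 hv))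
  have hd'B : ∀ v ∈ H, d' v ∉ B := by
    intro v hv hB'
    obtain ⟨h1, h2, h3, h4, h5, h6⟩ := hd v hv
    exact h6 (hB.eq_of_adj hB' (hHB hv) h1 h2 h5.symm h3)
  -- Both possible positions of `s y` for `y ∉ H`, next to `y` or next to `π y`, give the same
  -- vertex set.
  set P : V → Set V := fun y => if y ∈ H then {d' y, d y, y, s y} else {s y, y, m y, π y} with hP
  have hPH : ∀ y, y ∈ H → P y = {d' y, d y, y, s y} := fun y hy => if_pos hy
  have hPN : ∀ y, y ∉ H → P y = {s y, y, m y, π y} := fun y hy => if_neg hy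
  have hBdis : ∀ {x : V}, x ∈ A₀ ∪ A₁ → x ∉ E := fun hx => hS.notMem_E hx
  have cl : ∀ y ∈ Y, ∀ x ∈ P y, (x ∈ A₀ ∪ A₁ ∧ (x = y ∨ (y ∉ H ∧ x = π y))) ∨
      (x ∈ E ∧ (x = s y ∨ (y ∉ H ∧ x = m y))) ∨
      (x ∉ B ∧ y ∈ H ∧ (x = d y ∨ x = d' y)) := by
    intro y hy x hx
    by_cases hyH : y ∈ H
    · rw [hPH y hyH] at hx
      rcases hx with rfl | rfl | rfl | rfl
      · exact Or.inr (Or.inr ⟨hd'B y hyH, hyH, Or.inr rfl⟩)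
      · exact Or.inr (Or.inr ⟨(hd y hyH).2.1, hyH, Or.inl rfl⟩)
      · exact Or.inl ⟨hY.1 hy, Or.inl rfl⟩
      · exact Or.inr (Or.inl ⟨hsE y hy, Or.inl rfl⟩)
    · rw [hPN y hyH] at hx
      have hmy := hm y ⟨hy, hyH⟩
      rcases hx with rfl | rfl | rfl | rfl
      · exact Or.inr (Or.inl ⟨hsE y hy, Or.inl rfl⟩)
      · exact Or.inl ⟨hY.1 hy, Or.inl rfl⟩
      · exact Or.inr (Or.inl ⟨hmy.2.2.2.1, Or.inr ⟨hyH, rfl⟩⟩)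
      · exact Or.inl ⟨hmy.1, Or.inr ⟨hyH, rfl⟩⟩
  have hconn : ∀ y ∈ H, ∀ x, x = d y ∨ x = d' y → Conn G (W \ B) (d y) x := by
    rintro y hy x (rfl | rfl)
    · exact Conn.refl ⟨(hd y hy).1, (hd y hy).2.1⟩
    · exact Conn.of_adj (hd y hy).2.2.2.2.1 ⟨(hd y hy).1, (hd y hy).2.1⟩
        ⟨(hd y hy).2.2.2.1, hd'B y hy⟩
  have hcard : Fintype.card Y = Y.ncard := by
    rw [Set.ncard_eq_toFinset_card', Set.toFinset_card]
  rw [← hcard]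
  refine Pack.of_family (fun y : Y => P y) ?_ ?_
  · rintro ⟨y, hy⟩
    constructor
    · show IsP4 G (P y)
      obtain ⟨c1, c2, c3, c4, -, ⟨hyH, e'⟩ | ⟨hyH, e', c6, c7⟩⟩ := hc y hy
      · rw [hPH y hyH]
        obtain ⟨h1, h2, h3, h4, h5, h6⟩ := hd y hyH
        have hadj : G.Adj (s y) y := by
          rcases (hsel y hy).1 with e'' | e'' <;> rw [e'']
          exacts [c3, by rwa [e'] at c4]
        have hsB := hS.mem_of_mem_E (hsE y hy)
        exact ⟨d' y, d y, y, s y, h6, fun e => hd'B y hyH (e ▸ hsB), fun e => h2 (e ▸ hsB),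
          h5.symm, h3.symm, hadj.symm, rfl⟩
      · rw [hPN y hyH]
        obtain ⟨h1, h2, h3, h4, h5, h6⟩ := hm y ⟨hy, hyH⟩
        have n1 : s y ≠ m y := hsm y hy y ⟨hy, hyH⟩
        have n2 : s y ≠ π y := fun e => hBdis h1 (e ▸ hsE y hy)
        have n3 : s y ≠ y := fun e => hBdis (hY.1 hy) (by have := hsE y hy; rwa [e] at this)
        have n4 : y ≠ π y := fun e => h2 (e ▸ hy)
        rcases (hsel y hy).1 with e'' | e''
        · exact ⟨s y, y, m y, π y, n1, n2, n4, by rw [e'']; exact c3, h5.symm, h6, rfl⟩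
        · refine ⟨s y, π y, m y, y, n1, n3, n4.symm, by rw [e'', ← e']; exact c4, h6.symm, h5, ?_⟩
          ext x
          simp only [Set.mem_insert_iff, Set.mem_singleton_iff]
          tauto
    · show P y ⊆ _
      intro x hx
      have hyD : y ∈ H → y ∈ D := fun hyH =>
        (hBD (hHB hyH)).resolve_left (hH y hyH).1
      rcases cl y hy x hx with ⟨h1, h2⟩ | ⟨h1, h2⟩ | ⟨h1, hyH, h2⟩
      · refine ⟨hBD (hS.mem_of_mem h1), ?_⟩
        rintro (hxZ | hxX)
        · rcases h2 with rfl | ⟨hyH, rfl⟩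
          exacts [hYZ x hy hxZ, (hm y ⟨hy, hyH⟩).2.2.1 hxZ]
        · exact hBdis h1 (hXE hxX)
      · refine ⟨hBD (hS.mem_of_mem_E h1), ?_⟩
        rintro (hxZ | hxX)
        · exact hBdis (hZA hxZ) h1
        · rcases h2 with rfl | ⟨hyH, rfl⟩
          · exact (hsel y hy).2 hxX
          · obtain ⟨w, hw, hmw⟩ := hXZ _ hxX
            rcases hmend y ⟨hy, hyH⟩ w (AW (hZA hw)) hmw with rfl | rfl
            exacts [hYZ w hy hw, (hm y ⟨hy, hyH⟩).2.2.1 hw]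
      · have hdD : d y ∈ D := (hD y (hyD hyH) _ (hd y hyH).1 (hd y hyH).2.2.1).resolve_right
          fun e => (hd y hyH).2.1 (e ▸ hz)
        have hd'D : d' y ∈ D := (hD _ hdD _ (hd y hyH).2.2.2.1
          (hd y hyH).2.2.2.2.1).resolve_right fun e => hd'B y hyH (e ▸ hz)
        refine ⟨Or.inr (by rcases h2 with rfl | rfl <;> assumption), ?_⟩
        rintro (hxZ | hxX)
        exacts [h1 (hS.mem_of_mem (hZA hxZ)), h1 (hS.mem_of_mem_E (hXE hxX))]
  · rintro ⟨y, hy⟩ ⟨y', hy'⟩ hne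
    refine Set.disjoint_left.2 fun x hx hx' => hne (Subtype.ext ?_)
    show y = y'
    rcases cl y hy x hx with ⟨h1, h2⟩ | ⟨h1, h2⟩ | ⟨h1, hyH, h2⟩ <;>
      rcases cl y' hy' x hx' with ⟨h1', h2'⟩ | ⟨h1', h2'⟩ | ⟨h1', hyH', h2'⟩
    · rcases h2 with rfl | ⟨hyH, rfl⟩ <;> rcases h2' with e | ⟨hyH', e⟩
      · exact e
      · exact absurd (e ▸ hy) (hm y' ⟨hy', hyH'⟩).2.1
      · exact absurd (e ▸ hy') (hm y ⟨hy, hyH⟩).2.1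
      · exact hπ ⟨hy, hyH⟩ ⟨hy', hyH'⟩ e
    · exact absurd h1' (hBdis h1)
    · exact absurd (hS.mem_of_mem h1) h1'
    · exact absurd h1 (hBdis h1')
    · rcases h2 with rfl | ⟨hyH, rfl⟩ <;> rcases h2' with e | ⟨hyH', e⟩
      · exact hs hy hy' e
      · exact absurd e (hsm y hy y' ⟨hy', hyH'⟩)
      · exact absurd e.symm (hsm y' hy' y ⟨hy, hyH⟩)
      · have h5' := (hm y' ⟨hy', hyH'⟩).2.2.2.2.1
        rw [← e] at h5'
        rcases hmend y ⟨hy, hyH⟩ y' (hYW hy') h5' with e3 | e3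
        · exact e3.symm
        · exact absurd (e3 ▸ hy') (hm y ⟨hy, hyH⟩).2.1
    · exact absurd (hS.mem_of_mem_E h1) h1'
    · exact absurd (hS.mem_of_mem h1') h1
    · exact absurd (hS.mem_of_mem_E h1') h1
    -- Two hanging paths with a common vertex would join `y` and `y'` outside of the block.
    · exact hB.eq_of_conn Set.Subset.rfl (hHB hyH) (hHB hyH') (hd y hyH).2.2.1
        (hd y' hyH').2.2.1 ((hconn y hyH x h2).trans (hconn y' hyH' x h2').symm)

end CoverPacking

/-! ### Induction on a smallest separated piece -/

section MinMaxTheorem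
variable {V : Type u} {G : SimpleGraph V} {W B A₀ A₁ E D : Set V} {z : V}

/-- The set `D` is separated by `z` from the remaining vertices of `W`. -/
structure Piece (G : SimpleGraph V) (W : Set V) (z : V) (D : Set V) : Prop where
  mem : z ∈ W
  subset : D ⊆ W
  notMem : z ∉ D
  closed : ∀ d ∈ D, ∀ w ∈ W, G.Adj d w → w ∈ D ∨ w = z

lemma Piece.subset_of_notMem (h : Piece G W z D) {P : Set V} (hP : IsP4 G P) (hPW : P ⊆ W)
    (hz : z ∉ P) (hD : (P ∩ D).Nonempty) : P ⊆ D := by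
  obtain ⟨p, hpP, hpD⟩ := hD
  exact hP.subset_of_closed hpP hpD fun x hx y hy hxy =>
    (h.closed x hx y (hPW hy) hxy).resolve_right fun e => hz (e ▸ hy)

/-- A piece of smallest order that, together with its attachment vertex, contains a path. -/
structure MinPiece (G : SimpleGraph V) (W : Set V) (z : V) (D : Set V) : Prop
    extends Piece G W z D where
  not_noP4 : ¬ NoP4 G (insert z D)
  min : ∀ y K, Piece G W y K → K.ncard < D.ncard → NoP4 G (insert y K)

lemma exists_minPiece [Finite V] (h : ¬ NoP4 G W) : ∃ z D, MinPiece G W z D := by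
  classical
  have hex : ∃ n, ∃ z D, Piece G W z D ∧ ¬ NoP4 G (insert z D) ∧ D.ncard = n := by
    have h' := h
    simp only [NoP4, not_forall, not_not] at h'
    obtain ⟨P, hP, hPW⟩ := h'
    obtain ⟨p, hp⟩ := hP.nonempty
    -- For existence, any vertex `p` of a path will do, with everything else as the piece.
    refine ⟨_, p, W \ {p}, ⟨hPW hp, Set.sdiff_subset, fun h => h.2 rfl, ?_⟩, ?_, rfl⟩
    · intro d _ w hw _
      by_cases hwp : w = p
      · exact Or.inr hwp
      · exact Or.inl ⟨hw, hwp⟩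
    · rwa [Set.insert_sdiff_singleton, Set.insert_eq_of_mem (hPW hp)]
  obtain ⟨z, D, hD, hn, hc⟩ := Nat.find_spec hex
  refine ⟨z, D, hD, hn, fun y K hK hlt => ?_⟩
  by_contra hKn
  exact Nat.find_min hex (hc ▸ hlt) ⟨y, K, hK, hKn, rfl⟩

namespace MinPiece

/-- If `z` had no neighbour in `D` besides `y`, then `y` would separate `D \ {y}`. This smaller
piece together with `y` is `D`, which contains a path, against minimality. -/
lemma exists_adj [Finite V] (h : MinPiece G W z D) (hD : ¬ NoP4 G D) :
    ∃ s ∈ D, ∃ t ∈ D, s ≠ t ∧ G.Adj z s ∧ G.Adj z t := by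
  have key : ∀ y ∈ D, ∃ t ∈ D, t ≠ y ∧ G.Adj z t := by
    intro y hy
    by_contra! hcon
    have hlt := Set.ncard_sdiff_singleton_lt_of_mem hy
    refine hD ?_
    have := h.min y (D \ {y}) ⟨h.subset hy, fun x hx => h.subset hx.1, fun h => h.2 rfl, ?_⟩ hlt
    · rwa [Set.insert_sdiff_singleton, Set.insert_eq_of_mem hy] at this
    · intro d hd w hw hdw
      by_cases hwy : w = y
      · exact Or.inr hwy
      · rcases h.closed d hd.1 w hw hdw with hwD | rfl
        · exact Or.inl ⟨hwD, hwy⟩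
        · exact absurd hdw.symm (hcon d hd.1 hd.2)
  have hne : D.Nonempty := by
    by_contra hne
    rw [Set.not_nonempty_iff_eq_empty] at hne
    refine hD fun P hP hPD => ?_
    obtain ⟨p, hp⟩ := hP.nonempty
    have := hPD hp
    rw [hne] at this
    exact this
  obtain ⟨y, hy⟩ := hne
  obtain ⟨s, hs, -, hzs⟩ := key y hy
  obtain ⟨t, ht, hts, hzt⟩ := key s hs
  exact ⟨s, hs, t, ht, hts.symm, hzs, hzt⟩

/-- Otherwise a component of `D` and the rest of `D` are two smaller pieces at `z`. A path in `D`
lies in one of them, against minimality. -/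
lemma conn [Finite V] (h : MinPiece G W z D) (hD : ¬ NoP4 G D) {u v : V} (hu : u ∈ D)
    (hv : v ∈ D) : Conn G D u v := by
  by_contra hcon
  set K : Set V := {w | Conn G D u w} with hK
  have hKD : K ⊆ D := fun w hw => Conn.mem_right hw
  have p1 : Piece G W z K := ⟨h.mem, hKD.trans h.subset, fun hz => h.notMem (hKD hz), by
    intro d hd w hw hdw
    rcases h.closed d (hKD hd) w hw hdw with hwD | e
    · exact Or.inl (hd.trans (Conn.of_adj hdw (hKD hd) hwD))
    · exact Or.inr e⟩
  have p2 : Piece G W z (D \ K) := ⟨h.mem, fun x hx => h.subset hx.1, fun hz => h.notMem hz.1, by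
    intro d hd w hw hdw
    rcases h.closed d hd.1 w hw hdw with hwD | e
    · exact Or.inl ⟨hwD, fun hwK => hd.2 (Conn.trans hwK (Conn.of_adj hdw.symm hwD hd.1))⟩
    · exact Or.inr e⟩
  have n1 := h.min z K p1 (Set.ncard_lt_ncard ⟨hKD, fun hDK => hcon (hDK hv)⟩)
  have n2 := h.min z (D \ K) p2 (Set.ncard_lt_ncard
    ⟨Set.sdiff_subset, fun hDK => (hDK hu).2 (Conn.refl hu)⟩)
  refine hD fun P hP hPD => ?_
  obtain ⟨p, hp⟩ := hP.nonempty
  have hzP : z ∉ P := fun hz => h.notMem (hPD hz)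
  by_cases hpK : p ∈ K
  · exact n1 P hP ((p1.subset_of_notMem hP (hPD.trans h.subset) hzP ⟨p, hp, hpK⟩).trans
      (Set.subset_insert z K))
  · exact n2 P hP ((p2.subset_of_notMem hP (hPD.trans h.subset) hzP ⟨p, hp, hPD hp, hpK⟩).trans
      (Set.subset_insert z _))

end MinPiece

lemma TwoConn.pair {u v : V} (h : G.Adj u v) : TwoConn G {u, v} := by
  constructor
  · rintro x (rfl | rfl) y (rfl | rfl)
    · exact Conn.refl (by simp)
    · exact Conn.of_adj h (by simp) (by simp)
    · exact Conn.of_adj h.symm (by simp) (by simp)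
    · exact Conn.refl (by simp)
  · rintro x u' (rfl | rfl) v' (rfl | rfl) hu hv
    · exact Conn.refl ⟨by simp, hu⟩
    · exact Conn.of_adj h ⟨by simp, hu⟩ ⟨by simp, hv⟩
    · exact Conn.of_adj h.symm ⟨by simp, hu⟩ ⟨by simp, hv⟩
    · exact Conn.refl ⟨by simp, hu⟩

/-- Two neighbours of `z` joined inside the connected set `D` yield a cycle through `z`, hence a
block. This block stays in `insert z D`, because without `z` it is still connected and cannot leave
`D`. -/
lemma MinPiece.exists_block [Finite V] (h : MinPiece G W z D) (hD : ¬ NoP4 G D) :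
    ∃ B, IsBlk G W B ∧ z ∈ B ∧ B ⊆ insert z D := by
  obtain ⟨s, hs, t, ht, hst, hzs, hzt⟩ := h.exists_adj hD
  obtain ⟨p, hp, hpD⟩ := (h.conn hD ht hs).exists_path
  have hq : (Walk.cons hzt p).IsPath := by
    rw [Walk.cons_isPath_iff]
    exact ⟨hp, fun hz => h.notMem (hpD z hz)⟩
  have hC := (TwoConn.pair hzs).union_path (by simp) (by simp) hq
  set C : Set V := {z, s} ∪ {x | x ∈ (Walk.cons hzt p).support} with hCdef
  have hCD : C ⊆ insert z D := by
    rintro x ((rfl | rfl) | hx)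
    · exact Or.inl rfl
    · exact Or.inr hs
    · simp only [Walk.support_cons, Set.mem_ofPred_eq, List.mem_cons] at hx
      exact hx.imp id (hpD x)
  have hinsW : insert z D ⊆ W := Set.insert_subset h.mem h.subset
  have hzC : z ∈ C := Or.inl (by simp)
  have htC : t ∈ C := Or.inr (by simp)
  have hcard : 2 < C.ncard := by
    rw [Set.two_lt_ncard_iff (Set.toFinite C)]
    exact ⟨z, s, t, hzC, Or.inl (by simp), htC, hzs.ne, hzt.ne, hst⟩
  obtain ⟨B, hB, hCB⟩ := IsBlk.exists_of_twoConn hC (hCD.trans hinsW) hcard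
  refine ⟨B, hB, hCB hzC, fun b hb => ?_⟩
  by_cases hbz : b = z
  · exact Or.inl hbz
  · refine Or.inr ((hB.two_conn.2 z t (hCB htC) b hb hzt.ne' hbz).mem_of_closed ht ?_)
    intro x hx y hy hxy
    exact (h.closed x hx y (hB.subset hy.1) hxy).resolve_right hy.2

/-- Let `x` and `Q` come from `exists_separator`. If `x = z`, the connected set `D` lies in `Q` and
contains no path, a contradiction. Otherwise `x` meets all paths that touch `insert z D ∪ Q`: a path
without `x` lies in `Q`, or in the part of `D` outside of `insert x Q`, a smaller piece at `x`, or
is disjoint from both. -/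
lemma MinPiece.minMax_of_separator [Finite V] (h : MinPiece G W z D) (hD : ¬ NoP4 G D)
    (hB : IsBlk G W B) (hz : z ∈ B) (hBD : B ⊆ insert z D)
    (hT : K4S G W B ∨ T2S G W B ∨ TS G W B) (ih : ∀ W', W' ⊂ W → MinMax G W') : MinMax G W := by
  obtain ⟨x, hx, Q, hQW, hBQ, hxQ, hcl, hQ⟩ := exists_separator hB hT
  by_cases hxz : x = z
  · subst hxz
    exfalso
    refine hD (hQ.mono fun d hd => ?_)
    obtain ⟨b, hb, hbx, -⟩ := exists_ne_ne hB.card x x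
    have hbD : b ∈ D := (hBD hb).resolve_left hbx
    refine (h.conn hD hbD hd).mem_of_closed (hBQ ⟨hb, hbx⟩) fun q hq w hw hqw => ?_
    exact (hcl q hq w (h.subset hw) hqw).resolve_right fun e => h.notMem (e ▸ hw)
  · have hxD : x ∈ D := (hBD hx).resolve_left hxz
    have hzQ : z ∈ Q := hBQ ⟨hz, fun e => hxz e.symm⟩
    refine MinMax.of_remove_one (S := insert z D ∪ Q) (x := x) ?_ ?_ ?_ ih
    · exact Set.union_subset (Set.insert_subset h.mem h.subset) hQW
    · exact fun hn => h.not_noP4 (hn.mono Set.subset_union_left)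
    · intro P hP hPW hPS
      by_contra hxP
      have hPQ : ∀ p ∈ P, p ∉ Q := fun p hp hpQ => hQ P hP
        (hP.subset_of_closed hp hpQ fun q hq y hy hqy =>
          (hcl q hq y (hPW hy) hqy).resolve_right fun e => hxP (e ▸ hy))
      obtain ⟨p, hp, hpS⟩ := hPS
      have hpD : p ∈ D := by
        rcases hpS with (rfl | hpD) | hpQ
        exacts [absurd hzQ (hPQ _ hp), hpD, absurd hpQ (hPQ p hp)]
      -- Since `z ∈ Q`, leaving `D` means entering `Q`, and `Q` is left only through `x`.
      have hpiece : Piece G W x (D \ (insert x Q)) := by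
        refine ⟨h.subset hxD, fun y hy => h.subset hy.1, fun hx => hx.2 (Or.inl rfl), ?_⟩
        intro k hk y hy hky
        have hyQ : y ∉ Q := fun hyQ => hk.2 ((hcl y hyQ k (h.subset hk.1) hky.symm).symm)
        have hyD : y ∈ D := (h.closed k hk.1 y hy hky).resolve_right fun e => hyQ (e ▸ hzQ)
        by_cases hyx : y = x
        · exact Or.inr hyx
        · refine Or.inl ⟨hyD, ?_⟩
          rintro (e | e)
          exacts [hyx e, hyQ e]
      have hlt : (D \ (insert x Q)).ncard < D.ncard :=
        Set.ncard_lt_ncard ⟨Set.sdiff_subset, fun hs => (hs hxD).2 (Or.inl rfl)⟩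
      refine h.min x _ hpiece hlt P hP
        ((hpiece.subset_of_notMem hP hPW hxP ⟨p, hp, hpD, ?_⟩).trans (Set.subset_insert _ _))
      rintro (rfl | e)
      exacts [hxP hp, hPQ p hp e]

/-- The vertices of the subdivided multigraph where a path of order two is attached. -/
def heavy (G : SimpleGraph V) (W B A : Set V) (z : V) : Set V :=
  {v | v ∈ A ∧ v ≠ z ∧ ∃ d d', d ∈ W ∧ d ∉ B ∧ G.Adj v d ∧ d' ∈ W ∧ G.Adj d d' ∧ d' ≠ v}

/-- The only way for a path that meets `D` to escape a cover `Y`: its vertices in `D` are neighbours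
of an uncovered `z` and have no other neighbour on the path. So `z` is the only possible leak, and
`MinPiece.minMax_of_subS` has to repair nothing else. -/
lemma MinPiece.uncovered [Finite V] (h : MinPiece G W z D) (hD : ¬ NoP4 G D)
    (hB : IsBlk G W B) (hz : z ∈ B) (hBD : B ⊆ insert z D) (hS : SubS G W B A₀ A₁ E) {Y : Set V}
    (hY : IsCover G (A₀ ∪ A₁) E (heavy G W B (A₀ ∪ A₁) z) Y) {P : Set V} (hP : IsP4 G P)
    (hPW : P ⊆ W) (hPY : ∀ y ∈ Y, y ∉ P) {q : V} (hqP : q ∈ P) (hqD : q ∈ D) :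
    z ∈ A₀ ∪ A₁ ∧ z ∉ Y ∧ z ∈ P ∧ ∀ y ∈ P, G.Adj q y → y = z := by
  -- From `v` the path continues with two vertices `u`, `u'`. If `u` is a subdivision vertex, its
  -- ends are `v` and `u'`, one of which is in `Y`; if `u` is outside of the block, `v` is heavy and
  -- in `Y`.
  have hA : ∀ v ∈ A₀ ∪ A₁, v ≠ z → v ∉ P := by
    intro v hv hvz hvP
    obtain ⟨u, hu, hvu, u', hu', huv, huu⟩ := hP.exists_adj_adj hvP
    by_cases huB : u ∈ B
    · have huE : u ∈ E := hS.indep v hv u huB hvu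
      obtain ⟨y, hy, huy⟩ := hY.2.2 u huE
      rcases hS.eq_or_eq huE (hPW hu') (hPW hvP) (hB.subset (hS.mem_of_mem (hY.1 hy))) huu
        hvu.symm huy huv with rfl | rfl
      exacts [hPY _ hy hu', hPY _ hy hvP]
    · have : v ∈ heavy G W B (A₀ ∪ A₁) z :=
        ⟨hv, hvz, u, u', hPW hu, huB, hvu, hPW hu', huu, huv⟩
      exact hPY v (hY.2.1 this) hvP
  by_cases hqB : q ∈ B
  · have hqz : q ≠ z := fun e => h.notMem (e ▸ hqD)
    have hqE : q ∈ E := (hS.mem_or hqB).resolve_left fun hqA => hA q hqA hqz hqP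
    have hnbr : ∀ y ∈ P, G.Adj q y → y = z := by
      intro y hy hqy
      by_contra hyz
      exact hA y (hS.mem_of_adj hqE (hPW hy) hqy) hyz hy
    obtain ⟨u, hu, hqu, -⟩ := hP.exists_adj_adj hqP
    have := hnbr u hu hqu
    subst this
    exact ⟨hS.mem_of_adj hqE (hPW hu) hqu, fun hY' => hPY _ hY' hu, hu, hnbr⟩
  · exfalso
    -- The part that hangs outside of the block at `v`. For `v ≠ z` it is a smaller piece, so by
    -- minimality it contains no path.
    set K : V → Set V := fun v => {h | ∃ k, G.Adj v k ∧ Conn G (W \ B) k h} with hK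
    have hpiece : ∀ v ∈ B, v ≠ z → Piece G W v (K v) ∧ K v ⊆ D := by
      intro v hv hvz
      have hvD : v ∈ D := (hBD hv).resolve_left hvz
      refine ⟨⟨hB.subset hv, ?_, ?_, ?_⟩, ?_⟩
      · rintro x ⟨k, -, hkx⟩
        exact hkx.mem_right.1
      · rintro ⟨k, -, hkx⟩
        exact hkx.mem_right.2 hv
      · rintro d ⟨k, hvk, hkd⟩ w hw hdw
        by_cases hwB : w ∈ B
        · exact Or.inr (hB.eq_of_conn Set.Subset.rfl hwB hv hdw.symm hvk hkd.symm)
        · exact Or.inl ⟨k, hvk, hkd.trans (Conn.of_adj hdw hkd.mem_right ⟨hw, hwB⟩)⟩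
      · rintro x ⟨k, hvk, hkx⟩
        have hne : ∀ {y}, y ∈ W \ B → y ≠ z := fun hy e => hy.2 (e ▸ hz)
        refine hkx.mem_of_closed ((h.closed v hvD k hkx.mem_left.1 hvk).resolve_right
          (hne hkx.mem_left)) fun a ha b hb hab => ?_
        exact (h.closed a ha b hb.1 hab).resolve_right (hne hb)
    have hmem : ∃ v ∈ B, v ≠ z ∧ q ∈ K v := by
      obtain ⟨b, hb, hbz, -⟩ := exists_ne_ne hB.card z z
      have hbD : b ∈ D := (hBD hb).resolve_left hbz
      have : q ∈ {x | x ∈ D ∧ (x ∈ B ∨ ∃ v ∈ B, v ≠ z ∧ x ∈ K v)} := by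
        refine (h.conn hD hbD hqD).mem_of_closed ⟨hbD, Or.inl hb⟩ ?_
        rintro x ⟨hxD, hx⟩ y hyD hxy
        refine ⟨hyD, ?_⟩
        by_cases hyB : y ∈ B
        · exact Or.inl hyB
        · right
          have hyW : y ∈ W \ B := ⟨h.subset hyD, hyB⟩
          rcases hx with hxB | ⟨v, hv, hvz, k, hvk, hkx⟩
          · exact ⟨x, hxB, fun e => h.notMem (e ▸ hxD), y, hxy, Conn.refl hyW⟩
          · exact ⟨v, hv, hvz, k, hvk, hkx.trans (Conn.of_adj hxy hkx.mem_right hyW)⟩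
      exact this.2.resolve_left hqB
    obtain ⟨v, hv, hvz, hqK⟩ := hmem
    have hvA : v ∈ A₀ ∪ A₁ := by
      refine (hS.mem_or hv).resolve_right fun hvE => ?_
      obtain ⟨k, hvk, hkq⟩ := hqK
      exact hkq.mem_left.2 (hS.mem_of_mem (hS.mem_of_adj hvE hkq.mem_left.1 hvk))
    obtain ⟨hpc, hKD⟩ := hpiece v hv hvz
    have hvD : v ∈ D := (hBD hv).resolve_left hvz
    exact h.min v (K v) hpc (Set.ncard_lt_ncard ⟨hKD, fun hs => hpc.notMem (hs hvD)⟩) P hP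
      ((hpc.subset_of_notMem hP hPW (hA v hvA hvz) ⟨q, hqP, hqK⟩).trans (Set.subset_insert _ _))

/-- If some minimum cover contains `z`, or if `z` is a subdivision vertex, a minimum cover meets all
paths that touch `insert z D`, and this set is removed. Otherwise a minimum cover leaves paths that
start in `D` and run through `z` to the outside. To account for them, a single neighbour `e` of `z`
is kept in the smaller instance, while the packing inside `insert z D` is arranged to avoid `z` and
`e`. -/
lemma MinPiece.minMax_of_subS [Finite V] (h : MinPiece G W z D) (hD : ¬ NoP4 G D)
    (hB : IsBlk G W B) (hz : z ∈ B) (hBD : B ⊆ insert z D) (hS : SubS G W B A₀ A₁ E)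
    (ih : ∀ W', W' ⊂ W → MinMax G W') : MinMax G W := by
  classical
  set A := A₀ ∪ A₁ with hA
  set H := heavy G W B A z with hH
  have hinsW : insert z D ⊆ W := Set.insert_subset h.mem h.subset
  have hexY : ∃ n, ∃ Y, IsCover G A E H Y ∧ Y.ncard = n := by
    refine ⟨_, A, ⟨Set.Subset.rfl, fun v hv => hv.1, fun e he => ?_⟩, rfl⟩
    obtain ⟨u, hu, v, -, huv⟩ := hS.ends e he
    have hu' : u ∈ A := Or.inl hu
    exact ⟨u, hu', (huv u (hB.subset (hS.mem_of_mem hu'))).2 (Or.inl rfl)⟩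
  set k := Nat.find hexY with hk
  have hmin : ∀ Y', IsCover G A E H Y' → k ≤ Y'.ncard :=
    fun Y' hY' => Nat.find_min' hexY ⟨Y', hY', rfl⟩
  have hHp : ∀ v ∈ H, v ≠ z ∧ ∃ d d', d ∈ W ∧ d ∉ B ∧ G.Adj v d ∧ d' ∈ W ∧ G.Adj d d' ∧ d' ≠ v :=
    fun v hv => hv.2
  by_cases hcase : z ∈ A ∧ ∀ Y, IsCover G A E H Y → Y.ncard = k → z ∉ Y
  · obtain ⟨hzA, hzmin⟩ := hcase
    obtain ⟨Y, hY, hYk⟩ := Nat.find_spec hexY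
    rw [← hk] at hYk
    have hzY : z ∉ Y := hzmin Y hY hYk
    -- The vertex `e` is kept; `f` guarantees that the remaining instance is smaller.
    obtain ⟨e, he, f, hf, hef, hez, -⟩ := hS.exists_two hB hzA
    have heD : e ∈ D := (hBD (hS.mem_of_mem_E he)).resolve_left hez.ne
    have hfD : f ∈ D := (hBD (hS.mem_of_mem_E hf)).resolve_left fun e' =>
      hS.notMem_E hzA (e' ▸ hf)
    -- That no minimum cover contains `z` is exactly what the hypothesis of the packing theorem on
    -- `Z` demands.
    have hpack := hS.pack_of_cover (Z := {z}) (X := {e}) hB Set.subsingleton_singleton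
      (by rintro x rfl; exact hzA) hY (fun Y' hY' hle => ⟨by rw [hYk]; exact hmin Y' hY', by
        rw [Set.disjoint_singleton_right]
        exact hzmin Y' hY' (le_antisymm (hYk ▸ hle) (hmin Y' hY'))⟩) hBD h.closed hz hHp
      Set.subsingleton_singleton (by rintro x rfl; exact he) (by rintro x rfl; exact ⟨z, rfl, hez⟩)
    obtain ⟨n, hn, X, hX, hXP⟩ := ih ((W \ D) ∪ {e}) ⟨by
      rintro x (hx | rfl)
      exacts [hx.1, h.subset heD], fun hs => by
        rcases hs (h.subset hfD) with hx | hx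
        exacts [hx.2 hfD, hef hx.symm]⟩
    -- The only neighbour of `e` in the smaller instance is `z`, so `z` can take over the role of
    -- `e` in the cover.
    set X' : Set V := if e ∈ X then insert z (X \ {e}) else X with hX'
    have hX'card : X'.ncard ≤ n := by
      rw [hX']
      split_ifs with heX
      · have h1 := Set.ncard_insert_le z (X \ {e})
        have h2 := Set.ncard_sdiff_singleton_lt_of_mem heX
        omega
      · exact hX
    have hXX' : ∀ x ∈ X, x ≠ e → x ∈ X' := by
      intro x hx hxe
      rw [hX']
      split_ifs
      · exact Or.inr ⟨hx, hxe⟩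
      · exact hx
    refine ⟨Y.ncard + n, (hpack.union hn ?_).mono ?_, Y ∪ X', ?_, ?_⟩
    · rw [Set.disjoint_left]
      rintro x ⟨hx1, hx2⟩ (hx3 | hx3)
      · rcases hx1 with rfl | hx1
        exacts [hx2 (Or.inl rfl), hx3.2 hx1]
      · exact hx2 (Or.inr hx3)
    · rintro x (hx | hx | rfl)
      exacts [hinsW hx.1, hx.1, h.subset heD]
    · exact (Set.ncard_union_le Y X').trans (by omega)
    · intro P hP hPW
      by_contra! hcon
      have hPY : ∀ y ∈ Y, y ∉ P := fun y hy => hcon y (Or.inl hy)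
      have hPX : ∀ x ∈ X', x ∉ P := fun x hx => hcon x (Or.inr hx)
      have hunc := fun q hqP hqD => h.uncovered hD hB hz hBD hS hY hP hPW hPY (q := q) hqP hqD
      by_cases hPD : ∃ q ∈ P, q ∈ D
      · obtain ⟨q, hqP, hqD⟩ := hPD
        obtain ⟨-, -, hzP, hq⟩ := hunc q hqP hqD
        have heX : e ∉ X := fun heX => hPX z (by rw [hX', if_pos heX]; exact Or.inl rfl) hzP
        have hX'X : X' = X := if_neg heX
        -- The end `q` in `D` is next to `z` and the last two vertices are outside of `D`. With `q`
        -- replaced by `e` the path lies in the smaller instance, where a cover vertex other than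
        -- `e` meets it.
        have key : ∀ b c d, P = {q, b, c, d} → q ≠ c → q ≠ d → b ≠ d → G.Adj q b → G.Adj b c →
            G.Adj c d → False := by
          rintro b c d hPeq n1 n2 n3 hqb hbc hcd
          have hbz : b = z := hq b (by rw [hPeq]; simp) hqb
          subst hbz
          have hcP : c ∈ P := by rw [hPeq]; simp
          have hdP : d ∈ P := by rw [hPeq]; simp
          have hcD : c ∉ D := fun hcD => n3 ((hunc c hcP hcD).2.2.2 d hdP hcd).symm
          have hdD : d ∉ D := fun hdD => hbc.ne ((hunc d hdP hdD).2.2.2 c hcP hcd.symm).symm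
          obtain ⟨x, hx, hxP⟩ := hXP {e, b, c, d}
            ⟨e, b, c, d, fun e' => hcD (e' ▸ heD), fun e' => hdD (e' ▸ heD), n3, hez, hbc, hcd, rfl⟩
            (by
              rintro x (rfl | rfl | rfl | rfl)
              exacts [Or.inr rfl, Or.inl ⟨h.mem, h.notMem⟩, Or.inl ⟨hPW hcP, hcD⟩,
                Or.inl ⟨hPW hdP, hdD⟩])
          rcases hxP with rfl | hxP
          · exact heX hx
          · exact hPX x (by rwa [hX'X]) (by rw [hPeq]; exact Or.inr hxP)
        obtain ⟨a, b, c, d, n1, n2, n3, hab, hbc, hcd, hPeq⟩ := id hP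
        have hqP' := hqP
        rw [hPeq] at hqP'
        rcases hqP' with rfl | rfl | rfl | rfl
        · exact key b c d hPeq n1 n2 n3 hab hbc hcd
        · have e1 := hq a (by rw [hPeq]; simp) hab.symm
          have e2 := hq c (by rw [hPeq]; simp) hbc
          exact n1 (e1.trans e2.symm)
        · have e1 := hq b (by rw [hPeq]; simp) hbc.symm
          have e2 := hq d (by rw [hPeq]; simp) hcd
          exact n3 (e1.trans e2.symm)
        · refine key c b a ?_ n3.symm n2.symm n1.symm hcd.symm hbc.symm hab.symm
          rw [hPeq]
          ext x
          simp only [Set.mem_insert_iff, Set.mem_singleton_iff]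
          tauto
      · push Not at hPD
        obtain ⟨x, hx, hxP⟩ := hXP P hP fun p hp => Or.inl ⟨hPW hp, hPD p hp⟩
        exact hPX x (hXX' x hx fun e' => hPD x hxP (e' ▸ heD)) hxP
  · obtain ⟨Y, hY, hYk, hYz⟩ : ∃ Y, IsCover G A E H Y ∧ Y.ncard = k ∧ (z ∈ A → z ∈ Y) := by
      by_cases hzA : z ∈ A
      · have : ∃ Y, IsCover G A E H Y ∧ Y.ncard = k ∧ z ∈ Y := by
          by_contra! hcon
          exact hcase ⟨hzA, fun Y hY hYk => hcon Y hY hYk⟩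
        obtain ⟨Y, hY, hYk, hYz⟩ := this
        exact ⟨Y, hY, hYk, fun _ => hYz⟩
      · obtain ⟨Y, hY, hYk⟩ := Nat.find_spec hexY
        exact ⟨Y, hY, hYk, fun h => absurd h hzA⟩
    have hpack := hS.pack_of_cover (Z := ∅) (X := ∅) hB Set.subsingleton_empty
      (Set.empty_subset _) hY (fun Y' hY' _ => ⟨by rw [hYk]; exact hmin Y' hY',
        Set.disjoint_empty _⟩) hBD h.closed hz hHp
      Set.subsingleton_empty (Set.empty_subset _) (fun e he => he.elim)
    have hWlt : W \ insert z D ⊂ W := ⟨Set.sdiff_subset, fun hs => (hs h.mem).2 (Or.inl rfl)⟩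
    refine MinMax.of_remove hinsW le_rfl (hpack.mono Set.sdiff_subset) ?_ (ih _ hWlt)
    intro P hP hPW hPS
    by_contra! hPY
    have hno : ∀ q ∈ P, q ∉ D := by
      intro q hqP hqD
      obtain ⟨h1, h2, -⟩ := h.uncovered hD hB hz hBD hS hY hP hPW hPY hqP hqD
      exact h2 (hYz h1)
    obtain ⟨q, hqP, rfl | hqD⟩ := hPS
    · obtain ⟨u, hu, hqu, -⟩ := hP.exists_adj_adj hqP
      -- Here `q = z` is a subdivision vertex, and the next vertex on the path is one of its ends,
      -- hence in `D`.
      have hqE : q ∈ E := (hS.mem_or hz).resolve_left fun hqA => hPY q (hYz hqA) hqP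
      exact hno u hu ((hBD (hS.mem_of_mem (hS.mem_of_adj hqE (hPW hu) hqu))).resolve_left hqu.ne')
    · exact hno q hqP hqD

/-- In the graphs of the class, the minimum cover and the maximum packing have the same size. -/
theorem Good.minMax [Finite V] (hG : Good G) (W : Set V) : MinMax G W := by
  induction hn : W.ncard using Nat.strong_induction_on generalizing W with
  | _ n ih =>
    have ih' : ∀ W', W' ⊂ W → MinMax G W' := fun W' hW' =>
      ih _ (hn ▸ Set.ncard_lt_ncard hW') W' rfl
    by_cases hW : NoP4 G W
    · exact MinMax.of_noP4 hW
    obtain ⟨z, D, h⟩ := exists_minPiece hW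
    have hinsW : insert z D ⊆ W := Set.insert_subset h.mem h.subset
    by_cases hD : NoP4 G D
    -- A path that touches `insert z D` but avoids `z` would lie in `D`.
    · refine MinMax.of_remove_one hinsW h.not_noP4 (x := z) ?_ ih'
      intro P hP hPW ⟨p, hpP, hp⟩
      by_contra hzP
      refine hD P hP (h.subset_of_notMem hP hPW hzP ⟨p, hpP, hp.resolve_left ?_⟩)
      rintro rfl
      exact hzP hpP
    obtain ⟨B, hB, hz, hBD⟩ := h.exists_block hD
    by_cases hT : TriFree G B
    · obtain ⟨A₀, A₁, E, hS⟩ := hG.exists_subS hB hT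
      exact h.minMax_of_subS hD hB hz hBD hS ih'
    · exact h.minMax_of_separator hD hB hz hBD (hG.triangle_block hB hT) ih'

end MinMaxTheorem

/-! ### Translation to `kMatchingNumber` and `kVertexCoverNumber` -/

section Numbers
variable {V : Type u} {G : SimpleGraph V} {n k : ℕ}

lemma IsP4.of_isKPath {P : G.Subgraph} (h : IsKPath G 4 P) : IsP4 G P.verts := by
  obtain ⟨φ⟩ := h
  have hne : ∀ i j : Fin 4, i ≠ j → (φ.symm i : V) ≠ φ.symm j := fun i j hij e =>
    hij (φ.symm.injective (Subtype.ext e))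
  have hadj : ∀ i j : Fin 4, i.val + 1 = j.val → G.Adj (φ.symm i) (φ.symm j) := fun i j hij =>
    P.adj_sub (φ.symm.map_adj_iff.2 (pathGraph_adj.2 (Or.inl hij)))
  refine ⟨φ.symm 0, φ.symm 1, φ.symm 2, φ.symm 3, hne _ _ (by decide), hne _ _ (by decide),
    hne _ _ (by decide), hadj _ _ rfl, hadj _ _ rfl, hadj _ _ rfl, ?_⟩
  ext v
  constructor
  · intro hv
    have hx : φ.symm (φ ⟨v, hv⟩) = ⟨v, hv⟩ := φ.symm_apply_apply _
    generalize φ ⟨v, hv⟩ = i at hx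
    fin_cases i <;> simp_all
  · rintro (rfl | rfl | rfl | rfl) <;> exact Subtype.prop _

lemma IsP4.exists_isKPath {P : Set V} (h : IsP4 G P) :
    ∃ Q : G.Subgraph, IsKPath G 4 Q ∧ Q.verts = P := by
  classical
  obtain ⟨a, b, c, d, h1, h2, h3, hab, hbc, hcd, rfl⟩ := h
  let w : G.Walk a d := Walk.cons hab (Walk.cons hbc (Walk.cons hcd Walk.nil))
  have hw : w.IsPath := by simp [w, Walk.isPath_def, h1, h2, h3, hab.ne, hbc.ne, hcd.ne]
  refine ⟨w.toSubgraph, ⟨hw.pathGraphIsoToSubgraph.symm⟩, ?_⟩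
  rw [Walk.verts_toSubgraph]
  ext v
  simp [w]

lemma IsP4.induce {S : Set V} {a b c d : V} (ha : a ∈ S) (hb : b ∈ S) (hc : c ∈ S) (hd : d ∈ S)
    (h1 : a ≠ c) (h2 : a ≠ d) (h3 : b ≠ d) (hab : G.Adj a b) (hbc : G.Adj b c) (hcd : G.Adj c d) :
    IsP4 (G.induce S) {⟨a, ha⟩, ⟨b, hb⟩, ⟨c, hc⟩, ⟨d, hd⟩} :=
  ⟨⟨a, ha⟩, ⟨b, hb⟩, ⟨c, hc⟩, ⟨d, hd⟩, fun e => h1 (congrArg Subtype.val e),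
    fun e => h2 (congrArg Subtype.val e), fun e => h3 (congrArg Subtype.val e), hab, hbc, hcd, rfl⟩

lemma matching_card_le_cover {M : Finset G.Subgraph} {X : Finset V} (hM : IsKMatching G 4 M)
    (hX : IsKVertexCover G 4 X) : M.card ≤ X.card := by
  have : ∀ P : M, ∃ v : X, v.1 ∈ P.1.verts := fun P => by
    obtain ⟨v, hv, hvP⟩ := hX P.1 (hM.1 P.1 P.2)
    exact ⟨⟨v, hv⟩, hvP⟩
  choose v hv using this
  have hinj : Function.Injective v := fun P Q e => by
    by_contra hne
    refine Set.disjoint_left.1 (hM.2 P.1 P.2 Q.1 Q.2 fun e => hne (Subtype.ext e)) (hv P) ?_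
    rw [e]
    exact hv Q
  simpa using Fintype.card_le_of_injective v hinj

lemma four_mul_matching_card_le [Finite V] {M : Finset G.Subgraph} (hM : IsKMatching G 4 M) :
    4 * M.card ≤ Nat.card V := by
  classical
  have := Fintype.ofFinite V
  have h1 : (M.biUnion fun P => P.verts.toFinset).card = ∑ P ∈ M, P.verts.toFinset.card :=
    Finset.card_biUnion fun P hP Q hQ hPQ => by
      simpa using hM.2 P hP Q hQ hPQ
  have h2 : ∑ P ∈ M, P.verts.toFinset.card = ∑ P ∈ M, 4 := by
    refine Finset.sum_congr rfl fun P hP => ?_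
    rw [← Set.ncard_eq_toFinset_card', (IsP4.of_isKPath (hM.1 P hP)).ncard_eq]
  rw [Finset.sum_const, smul_eq_mul, mul_comm] at h2
  rw [← h2, ← h1, Nat.card_eq_fintype_card]
  exact Finset.card_le_univ _

lemma exists_matching_card_eq [Finite V] :
    ∃ M : Finset G.Subgraph, IsKMatching G 4 M ∧ M.card = kMatchingNumber G 4 := by
  have h := Nat.sSup_mem (s := {n : ℕ | ∃ M : Finset G.Subgraph, IsKMatching G 4 M ∧ M.card = n})
    ⟨0, ∅, ⟨by simp, by simp⟩, rfl⟩ ⟨Nat.card V, by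
      rintro _ ⟨M, hM, rfl⟩
      have := four_mul_matching_card_le hM
      omega⟩
  exact h

lemma exists_cover_card_eq [Finite V] :
    ∃ X : Finset V, IsKVertexCover G 4 X ∧ X.card = kVertexCoverNumber G 4 := by
  have := Fintype.ofFinite V
  refine Nat.sInf_mem (s := {n : ℕ | ∃ X : Finset V, IsKVertexCover G 4 X ∧ X.card = n})
    ⟨_, Finset.univ, fun P hP => ?_, rfl⟩
  obtain ⟨v, hv⟩ := (IsP4.of_isKPath hP).nonempty
  exact ⟨v, Finset.mem_univ v, hv⟩

lemma matching_card_le_number [Finite V] {M : Finset G.Subgraph} (hM : IsKMatching G 4 M) :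
    M.card ≤ kMatchingNumber G 4 :=
  le_csSup ⟨Nat.card V, by
      rintro _ ⟨M, hM, rfl⟩
      have := four_mul_matching_card_le hM
      omega⟩ ⟨M, hM, rfl⟩

lemma MinMax.numbers_eq [Finite V] (h : MinMax G Set.univ) :
    kMatchingNumber G 4 = kVertexCoverNumber G 4 := by
  classical
  obtain ⟨n, ⟨P, hP, hd⟩, X, hX, hXP⟩ := h
  refine le_antisymm ?_ (le_trans (b := n) ?_ ?_)
  · obtain ⟨M, hM, e⟩ := exists_matching_card_eq (G := G)
    obtain ⟨Y, hY, e'⟩ := exists_cover_card_eq (G := G)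
    rw [← e, ← e']
    exact matching_card_le_cover hM hY
  · have := Fintype.ofFinite V
    have hcov : IsKVertexCover G 4 X.toFinset := fun Q hQ => by
      obtain ⟨x, hx, hx'⟩ := hXP _ (IsP4.of_isKPath hQ) (Set.subset_univ _)
      exact ⟨x, by simpa using hx, hx'⟩
    have hle : kVertexCoverNumber G 4 ≤ X.toFinset.card := Nat.sInf_le ⟨_, hcov, rfl⟩
    exact hle.trans
      ((Set.ncard_eq_toFinset_card' X).symm.trans_le hX)
  · choose Q hQ hQv using fun i => (hP i).1.exists_isKPath
    have hinj : Function.Injective Q := fun i j hij => by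
      by_contra hne
      obtain ⟨v, hv⟩ := (hP i).1.nonempty
      exact Set.disjoint_left.1 (hd i j hne) hv (by rwa [← hQv j, ← hij, hQv i])
    have hM : IsKMatching G 4 (Finset.univ.image Q) := by
      constructor
      · intro R hR
        obtain ⟨i, -, rfl⟩ := Finset.mem_image.1 hR
        exact hQ i
      · intro R hR R' hR' hne
        obtain ⟨i, -, rfl⟩ := Finset.mem_image.1 hR
        obtain ⟨j, -, rfl⟩ := Finset.mem_image.1 hR'
        rw [hQv, hQv]
        exact hd i j fun e => hne (by rw [e])
    have := matching_card_le_number hM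
    rwa [Finset.card_image_of_injective _ hinj, Finset.card_univ, Fintype.card_fin] at this

theorem Good.mem_classG [Finite V] (hG : Good G) : G ∈ classG 4 V := fun S =>
  ((hG.comap (Embedding.induce S)).minMax Set.univ).numbers_eq

/-- There is no room for `k + 1` disjoint paths in `S`, so the matching number of the induced
subgraph is at most `k`, and for graphs in the class so is the cover number. Every obstruction is
refuted through this bound. -/
lemma cov_of_mem_classG [Finite V] (hG : G ∈ classG 4 V) {S : Set V} (hS : S.ncard < 4 * (k + 1)) :
    Cov G S k := by
  classical
  obtain ⟨M, hM, e⟩ := exists_matching_card_eq (G := G.induce S)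
  obtain ⟨X, hX, e'⟩ := exists_cover_card_eq (G := G.induce S)
  have h1 := four_mul_matching_card_le hM
  rw [Nat.card_coe_set_eq] at h1
  have h2 : X.card ≤ k := by
    rw [e', ← hG S, ← e]
    omega
  refine ⟨Subtype.val '' (X : Set S), ?_, ?_⟩
  · rw [Set.ncard_image_of_injective _ Subtype.val_injective, Set.ncard_coe_finset]
    exact h2
  · rintro P ⟨a, b, c, d, h1, h2, h3, hab, hbc, hcd, rfl⟩ hPS
    obtain ⟨Q, hQ, hQv⟩ := (IsP4.induce (hPS (by simp)) (hPS (by simp)) (hPS (by simp))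
      (hPS (by simp)) h1 h2 h3 hab hbc hcd : IsP4 (G.induce S) _).exists_isKPath
    obtain ⟨v, hv, hvQ⟩ := hX Q hQ
    refine ⟨v, ⟨v, hv, rfl⟩, ?_⟩
    rw [hQv] at hvQ
    rcases hvQ with rfl | rfl | rfl | rfl <;> simp

end Numbers

/-! ### Graphs in 𝒢₄ contain none of the forbidden subgraphs -/

section Obstructions
variable {V : Type u} {G : SimpleGraph V} {n k : ℕ} {f : ℕ → V}

namespace IsCyc

lemma ne_of_lt (hf : IsCyc G f n) {i j : ℕ} (hij : i < j) (hj : j < i + n) : f i ≠ f j := by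
  rw [Ne, hf.eq_iff]
  intro h
  have h1 := (Nat.modEq_iff_dvd' hij.le).1 h
  have h2 := Nat.le_of_dvd (by omega) h1
  omega

lemma isP4 (hf : IsCyc G f n) (hn : 4 ≤ n) (i : ℕ) :
    IsP4 G {f i, f (i + 1), f (i + 2), f (i + 3)} :=
  ⟨_, _, _, _, hf.ne_of_lt (by omega) (by omega), hf.ne_of_lt (by omega) (by omega),
    hf.ne_of_lt (by omega) (by omega), hf.adj _, hf.adj _, hf.adj _, rfl⟩

lemma range_eq (hf : IsCyc G f n) : Set.range f = f '' Set.Iio n := by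
  have := hf.three_le
  ext x
  constructor
  · rintro ⟨i, rfl⟩
    exact ⟨i % n, Nat.mod_lt _ (by omega), hf.apply_mod i⟩
  · rintro ⟨i, -, rfl⟩
    exact ⟨i, rfl⟩

lemma ncard_range (hf : IsCyc G f n) : (Set.range f).ncard = n := by
  have hinj : Set.InjOn f (Set.Iio n) := fun i hi j hj h => hf.inj i hi j hj h
  rw [hf.range_eq, hinj.ncard_image]
  simp

end IsCyc

/-- The indicator function of a set along a sequence. -/
noncomputable def hits (X : Set V) (f : ℕ → V) (i : ℕ) : ℕ :=
  haveI := Classical.propDecidable (f i ∈ X)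
  if f i ∈ X then 1 else 0

lemma hits_pos {X : Set V} {i : ℕ} : 0 < hits X f i ↔ f i ∈ X := by
  unfold hits
  split_ifs <;> simpa

lemma sum_hits_shift {X : Set V} (hf : IsCyc G f n) (t : ℕ) :
    ∑ i ∈ Finset.range n, hits X f (i + t) = ∑ i ∈ Finset.range n, hits X f i := by
  induction t with
  | zero => rfl
  | succ t ih =>
    rw [← ih]
    have h1 := Finset.sum_range_succ (fun i => hits X f (i + t)) n
    have h2 := Finset.sum_range_succ' (fun i => hits X f (i + t)) n
    have h3 : hits X f (n + t) = hits X f (0 + t) := by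
      unfold hits
      rw [Nat.add_comm n t, hf.periodic, Nat.zero_add]
    have h4 : ∀ i, hits X f (i + 1 + t) = hits X f (i + (t + 1)) := fun i => by
      rw [Nat.add_assoc, Nat.add_comm 1 t]
    simp only [h4] at h2
    omega

lemma sum_hits {X : Set V} (hf : IsCyc G f n) :
    ∑ i ∈ Finset.range n, hits X f i = (X ∩ Set.range f).ncard := by
  classical
  have h1 : X ∩ Set.range f = f '' ↑((Finset.range n).filter fun i => f i ∈ X) := by
    rw [hf.range_eq]
    ext x
    constructor
    · rintro ⟨hx, i, hi, rfl⟩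
      exact ⟨i, by simpa using ⟨hi, hx⟩, rfl⟩
    · rintro ⟨i, hi, rfl⟩
      simp only [Finset.coe_filter, Finset.mem_range, Set.mem_ofPred_eq] at hi
      exact ⟨hi.2, i, hi.1, rfl⟩
  rw [h1, Set.InjOn.ncard_image, Set.ncard_coe_finset, Finset.card_filter]
  · refine Finset.sum_congr rfl fun i _ => ?_
    unfold hits
    congr
  · intro i hi j hj h
    simp only [Finset.coe_filter, Finset.mem_range, Set.mem_ofPred_eq] at hi hj
    exact hf.inj i hi.1 j hj.1 h

/-- Every vertex of the cycle lies in exactly four windows of four consecutive vertices. -/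
lemma sum_window {X : Set V} (hf : IsCyc G f n) :
    ∑ i ∈ Finset.range n, (hits X f i + hits X f (i + 1) + hits X f (i + 2) + hits X f (i + 3)) =
      4 * (X ∩ Set.range f).ncard := by
  simp only [Finset.sum_add_distrib, sum_hits_shift hf, sum_hits hf]
  ring

lemma one_le_window {X : Set V} (hf : IsCyc G f n) (hn : 4 ≤ n) {S : Set V}
    (hX : ∀ P, IsP4 G P → P ⊆ S → ∃ x ∈ X, x ∈ P) (hS : Set.range f ⊆ S) (i : ℕ) :
    1 ≤ hits X f i + hits X f (i + 1) + hits X f (i + 2) + hits X f (i + 3) := by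
  obtain ⟨x, hx, hxP⟩ := hX _ (hf.isP4 hn i) (by
    rintro x (rfl | rfl | rfl | rfl) <;> exact hS ⟨_, rfl⟩)
  rcases hxP with rfl | rfl | rfl | rfl <;> have := hits_pos.2 hx <;> omega

/-- All `n` windows must be met and a vertex meets four of them, so a cover has at least `n / 4`
(rounded up) vertices, while only `n / 4` rounded down are available. -/
lemma four_dvd_of_mem_classG [Finite V] (hG : G ∈ classG 4 V) (hf : IsCyc G f n) :
    n = 3 ∨ 4 ∣ n := by
  by_contra! hcon
  have h3 := hf.three_le
  obtain ⟨X, hXk, hX⟩ := cov_of_mem_classG hG (S := Set.range f) (k := n / 4)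
    (by rw [hf.ncard_range]; omega)
  have h1 := Finset.card_nsmul_le_sum (Finset.range n) _ 1 fun i _ =>
    one_le_window hf (by omega) hX Set.Subset.rfl i
  rw [sum_window hf, Finset.card_range, smul_eq_mul, mul_one] at h1
  have h2 := Set.ncard_le_ncard (Set.inter_subset_left : X ∩ Set.range f ⊆ X)
  omega

/-- A cycle with `4 * k` vertices and one or two further vertices has a cover with `k` vertices,
which has to consist of every fourth vertex of the cycle. A neighbour off the cycle at `f i` forces
the residue of these vertices modulo 4 to be that of `i` or `i + 2`, and this is impossible for two
indices of different parity. -/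
lemma attach_of_mem_classG [Finite V] (hG : G ∈ classG 4 V) (hf : IsCyc G f n) (hn : 4 ∣ n)
    {j : ℕ} (hj : Odd j) {w w' : V} (hw : w ∉ Set.range f) (h0 : G.Adj (f 0) w)
    (hw' : w' ∉ Set.range f) (hj' : G.Adj (f j) w') : False := by
  have h3 := hf.three_le
  obtain ⟨k, rfl⟩ := hn
  obtain ⟨X, hXk, hX⟩ := cov_of_mem_classG hG (S := Set.range f ∪ {w, w'}) (k := k) (by
    have h1 := Set.ncard_union_le (Set.range f) {w, w'}
    have h2 := Set.ncard_insert_le w {w'}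
    rw [hf.ncard_range] at h1
    rw [Set.ncard_singleton] at h2
    omega)
  have hge := fun i => one_le_window hf (by omega) hX Set.subset_union_left i
  have hsum := sum_window (X := X) hf
  have hle := Set.ncard_le_ncard (Set.inter_subset_left : X ∩ Set.range f ⊆ X)
  have h1 := Finset.card_nsmul_le_sum (Finset.range (4 * k)) _ 1 fun i _ => hge i
  rw [hsum, Finset.card_range, smul_eq_mul, mul_one] at h1
  -- Meeting all windows takes `k` vertices on the cycle, so nothing of the cover is left for `w`
  -- and `w'`.
  have hXf : X ⊆ Set.range f := by
    have := Set.eq_of_subset_of_ncard_le (Set.inter_subset_left : X ∩ Set.range f ⊆ X) (by omega)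
    exact Set.inter_eq_left.1 this
  have hper : ∀ i, hits X f (i + 4 * k) = hits X f i := fun i => by
    unfold hits
    rw [hf.periodic]
  -- By equality in the double count, each window is met exactly once.
  have heq : ∀ i, hits X f i + hits X f (i + 1) + hits X f (i + 2) + hits X f (i + 3) = 1 := by
    have h2 : ∀ i ∈ Finset.range (4 * k),
        1 = hits X f i + hits X f (i + 1) + hits X f (i + 2) + hits X f (i + 3) := by
      refine (Finset.sum_eq_sum_iff_of_le fun i _ => hge i).1 ?_
      rw [hsum]
      simp
      omega
    intro i
    have hi := h2 (i % (4 * k)) (Finset.mem_range.2 (Nat.mod_lt _ (by omega)))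
    have e : ∀ t, hits X f (i % (4 * k) + t) = hits X f (i + t) := fun t => by
      have : f (i % (4 * k) + t) = f (i + t) := by
        rw [hf.eq_iff]
        simp
      unfold hits
      rw [this]
    have e0 := e 0
    rw [e 1, e 2, e 3, show hits X f (i % (4 * k)) = hits X f i from e0] at hi
    exact hi.symm
  have hfour : ∀ i, hits X f (i + 4) = hits X f i := fun i => by
    have h4 := heq i
    have h5 : hits X f (i + 1) + hits X f (i + 2) + hits X f (i + 3) + hits X f (i + 4) = 1 :=
      heq (i + 1)
    omega
  have hmul : ∀ t i, hits X f (i + 4 * t) = hits X f i := by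
    intro t
    induction t with
    | zero => simp
    | succ t ih => intro i; rw [Nat.mul_succ, ← Nat.add_assoc, hfour, ih]
  -- The paths from `v` through `f i` and two further vertices, in either direction, are met on the
  -- cycle. As a window is met only once, the next vertex in that direction is not in the cover.
  have pend : ∀ i v, v ∉ Set.range f → v ∈ ({w, w'} : Set V) → G.Adj (f i) v →
      hits X f (i + 1) = 0 ∧ hits X f (i + 3) = 0 := by
    intro i v hv hvw hadj
    have hvX : v ∉ X := fun h => hv (hXf h)
    have hvf : ∀ s, v ≠ f s := fun s e => hv ⟨s, e.symm⟩
    constructor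
    -- Going backwards from `f i` is done from index `i + 4 * k`, since `i - 3` could be truncated.
    · have hk : i + 4 * k = i + 4 * k - 3 + 3 := by omega
      have e0 : f (i + 4 * k - 3 + 3) = f i := by rw [← hk, hf.periodic]
      set m := i + 4 * k - 3 with hm
      obtain ⟨x, hx, hxP⟩ := hX {v, f (m + 3), f (m + 2), f (m + 1)} ⟨_, _, _, _, hvf _, hvf _,
        (hf.ne_of_lt (by omega) (by omega)).symm, by rw [e0]; exact hadj.symm, (hf.adj _).symm,
        (hf.adj _).symm, rfl⟩ (by
          rintro x (rfl | rfl | rfl | rfl)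
          exacts [Or.inr hvw, Or.inl ⟨_, rfl⟩, Or.inl ⟨_, rfl⟩, Or.inl ⟨_, rfl⟩])
      have h6 := heq m
      have h7 : hits X f m = hits X f (i + 1) := by
        have : m = i + 1 + 4 * (k - 1) := by omega
        rw [this, hmul]
      rw [← h7]
      rcases hxP with rfl | rfl | rfl | rfl
      · exact absurd hx hvX
      all_goals
        have := hits_pos.2 hx
        omega
    · obtain ⟨x, hx, hxP⟩ := hX {v, f i, f (i + 1), f (i + 2)} ⟨_, _, _, _, hvf _, hvf _,
        (hf.ne_of_lt (by omega) (by omega)), hadj.symm, (hf.adj _), (hf.adj _), rfl⟩ (by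
          rintro x (rfl | rfl | rfl | rfl)
          exacts [Or.inr hvw, Or.inl ⟨_, rfl⟩, Or.inl ⟨_, rfl⟩, Or.inl ⟨_, rfl⟩])
      have h6 := heq i
      rcases hxP with rfl | rfl | rfl | rfl
      · exact absurd hx hvX
      all_goals
        have := hits_pos.2 hx
        omega
  obtain ⟨a1, a3⟩ := pend 0 w hw (by simp) h0
  obtain ⟨b1, b3⟩ := pend j w' hw' (by simp) hj'
  have h8 := heq 0
  obtain ⟨m, rfl⟩ := hj
  obtain ⟨t, rfl | rfl⟩ := Nat.even_or_odd' m
  · rw [show 2 * (2 * t) + 1 + 1 = 2 + 4 * t by ring, hmul] at b1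
    rw [show 2 * (2 * t) + 1 + 3 = 0 + 4 * (t + 1) by ring, hmul] at b3
    simp only [Nat.zero_add] at *
    omega
  · rw [show 2 * (2 * t + 1) + 1 + 1 = 0 + 4 * (t + 1) by ring, hmul] at b1
    rw [show 2 * (2 * t + 1) + 1 + 3 = 2 + 4 * (t + 1) by ring, hmul] at b3
    simp only [Nat.zero_add] at *
    omega

/-- At most seven vertices leave no room for two disjoint paths, so a single vertex meets all paths.
It lies on the given path, which makes its exclusion a finite check. -/
lemma exists_common_of_mem_classG [Finite V] (hG : G ∈ classG 4 V) {S : Set V} (hS : S.ncard < 8)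
    {a b c d : V} (h0 : IsP4 G {a, b, c, d}) (hP : {a, b, c, d} ⊆ S) :
    ∃ x, (x = a ∨ x = b ∨ x = c ∨ x = d) ∧ ∀ P, IsP4 G P → P ⊆ S → x ∈ P := by
  obtain ⟨X, hXk, hX⟩ := cov_of_mem_classG hG (S := S) (k := 1) hS
  obtain ⟨x, hx, hxP⟩ := hX _ h0 hP
  refine ⟨x, hxP, fun P hP hPS => ?_⟩
  obtain ⟨y, hy, hyP⟩ := hX P hP hPS
  rwa [(Set.ncard_le_one (Set.toFinite X)).1 hXk x hx y hy]

lemma ncard_list_le (l : List V) : {x | x ∈ l}.ncard ≤ l.length := by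
  classical
  have : {x | x ∈ l} = (l.toFinset : Set V) := by ext; simp
  rw [this, Set.ncard_coe_finset]
  exact l.toFinset_card_le

/-- The three triangle obstructions have six, six and seven vertices, and in each of them the paths
of order four have no common vertex. -/
theorem good_of_mem_classG [Finite V] (hG : G ∈ classG 4 V) : Good G where
  cyc f n hf := four_dvd_of_mem_classG hG hf
  attach := by
    rintro f n j hf hn hj ⟨w, hw, hw0⟩ ⟨w', hw', hwj⟩
    exact attach_of_mem_classG hG hf hn hj hw hw0 hw' hwj
  diamond a b c d p q hn hab hac had hbc hbd hcp hdq := by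
    simp only [List.nodup_cons, List.mem_cons, List.not_mem_nil, or_false, not_or, not_false_eq_true,
      List.nodup_nil, and_true] at hn
    obtain ⟨⟨n1, n2, n3, n4, n5⟩, ⟨n6, n7, n8, n9⟩, ⟨n10, n11, n12⟩, ⟨n13, n14⟩, n15⟩ := hn
    have hS := (ncard_list_le [a, b, c, d, p, q]).trans_lt (show 6 < 8 by decide)
    obtain ⟨x, hx, hxP⟩ := exists_common_of_mem_classG hG hS (a := p) (b := c) (c := a) (d := d)
      ⟨_, _, _, _, Ne.symm n4, Ne.symm n13, n10, hcp.symm, hac.symm, had, rfl⟩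
      (by rintro x (rfl | rfl | rfl | rfl) <;> simp)
    have key : ∀ s t u v, s ≠ u → s ≠ v → t ≠ v → G.Adj s t → G.Adj t u → G.Adj u v →
        {s, t, u, v} ⊆ {x | x ∈ [a, b, c, d, p, q]} → x = s ∨ x = t ∨ x = u ∨ x = v :=
      fun s t u v h1 h2 h3 h4 h5 h6 hs => hxP _ ⟨s, t, u, v, h1, h2, h3, h4, h5, h6, rfl⟩ hs
    -- For each vertex of the path `p c a d` there is a path that avoids it.
    rcases hx with rfl | rfl | rfl | rfl
    · have := key c a d q n10 n12 n5 hac.symm had hdq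
        (by rintro x (rfl | rfl | rfl | rfl) <;> simp)
      grind
    · have := key a b d q n3 n5 n9 hab hbd hdq
        (by rintro x (rfl | rfl | rfl | rfl) <;> simp)
      grind
    · have := key p c b d (Ne.symm n8) (Ne.symm n13) n10 hcp.symm hbc.symm hbd
        (by rintro x (rfl | rfl | rfl | rfl) <;> simp)
      grind
    · have := key p c a b (Ne.symm n4) (Ne.symm n8) (Ne.symm n6) hcp.symm hac.symm hab
        (by rintro x (rfl | rfl | rfl | rfl) <;> simp)
      grind
  net a b c p q r hn hab hac hbc hap hbq hcr := by
    simp only [List.nodup_cons, List.mem_cons, List.not_mem_nil, or_false, not_or, not_false_eq_true,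
      List.nodup_nil, and_true] at hn
    obtain ⟨⟨n1, n2, n3, n4, n5⟩, ⟨n6, n7, n8, n9⟩, ⟨n10, n11, n12⟩, ⟨n13, n14⟩, n15⟩ := hn
    have hS := (ncard_list_le [a, b, c, p, q, r]).trans_lt (show 6 < 8 by decide)
    obtain ⟨x, hx, hxP⟩ := exists_common_of_mem_classG hG hS (a := p) (b := a) (c := b) (d := q)
      ⟨_, _, _, _, Ne.symm n7, n13, n4, hap.symm, hab, hbq, rfl⟩
      (by rintro x (rfl | rfl | rfl | rfl) <;> simp)
    have h1 := hxP {q, b, c, r} ⟨_, _, _, _, Ne.symm n11, n15, n9, hbq.symm, hbc, hcr, rfl⟩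
      (by rintro x (rfl | rfl | rfl | rfl) <;> simp)
    have h2 := hxP {p, a, c, r} ⟨_, _, _, _, Ne.symm n10, n14, n5, hap.symm, hac, hcr, rfl⟩
      (by rintro x (rfl | rfl | rfl | rfl) <;> simp)
    -- The paths `p a b q`, `q b c r` and `p a c r` have no common vertex.
    simp only [Set.mem_insert_iff, Set.mem_singleton_iff] at h1 h2
    clear hG hxP hS
    grind
  long a b c x x' y y' hn hab hac hbc hax hxx hby hyy := by
    simp only [List.nodup_cons, List.mem_cons, List.not_mem_nil, or_false, not_or, not_false_eq_true,
      List.nodup_nil, and_true] at hn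
    obtain ⟨⟨n1, n2, n3, n4, n5, n5'⟩, ⟨n6, n7, n8, n9, n9'⟩, ⟨n10, n11, n12, n12'⟩,
      ⟨n13, n14, n14'⟩, ⟨n15, n16⟩, n17⟩ := hn
    have hS := (ncard_list_le [a, b, c, x, x', y, y']).trans_lt (show 7 < 8 by decide)
    obtain ⟨z, hz, hzP⟩ := exists_common_of_mem_classG hG hS (a := x') (b := x) (c := a) (d := c)
      ⟨_, _, _, _, Ne.symm n4, Ne.symm n11, Ne.symm n10, hxx.symm, hax.symm, hac, rfl⟩
      (by rintro x (rfl | rfl | rfl | rfl) <;> simp)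
    have h1 := hzP {c, b, y, y'} ⟨_, _, _, _, n12, n12', n9', hbc.symm, hby, hyy, rfl⟩
      (by rintro x (rfl | rfl | rfl | rfl) <;> simp)
    have h2 := hzP {x', x, a, b} ⟨_, _, _, _, Ne.symm n4, Ne.symm n8, Ne.symm n7, hxx.symm,
      hax.symm, hab, rfl⟩ (by rintro x (rfl | rfl | rfl | rfl) <;> simp)
    -- The paths `x' x a c` and `c b y y'` share only `c`, which is not on `x' x a b`.
    simp only [Set.mem_insert_iff, Set.mem_singleton_iff] at h1 h2
    clear hG hzP hS
    grind

end Obstructions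

/-! ### Cutvertices in terms of walks, and of neighbours outside of a block -/

section Cutvertices
variable {V : Type u} {G : SimpleGraph V}

lemma Conn.reachable {S : Set V} {u v : V} (h : Conn G S u v) : G.Reachable u v := by
  obtain ⟨p, -⟩ := h
  exact ⟨p⟩

lemma Conn.of_reachable {u v : V} (h : G.Reachable u v) : Conn G Set.univ u v := by
  obtain ⟨p⟩ := h
  exact ⟨p, fun _ _ => trivial⟩

lemma conn_iff_induce_reachable {S : Set V} {u v : V} (hu : u ∈ S) (hv : v ∈ S) :
    Conn G S u v ↔ (G.induce S).Reachable ⟨u, hu⟩ ⟨v, hv⟩ := by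
  constructor
  · rintro ⟨p, hp⟩
    exact ⟨p.induce S hp⟩
  · rintro ⟨p⟩
    refine ⟨p.map (Embedding.induce S).toHom, fun w hw => ?_⟩
    have hw' : w ∈ (p.map (Embedding.induce S).toHom).support := hw
    rw [Walk.support_map, List.mem_map] at hw'
    obtain ⟨z, -, rfl⟩ := hw'
    exact z.2

/-- A walk between two vertices that are not joined in `G - x` visits `x`. -/
lemma reachable_of_not_conn {x u v : V} (h : G.Reachable u v) (hc : ¬ Conn G {x}ᶜ u v) :
    G.Reachable u x := by
  classical
  obtain ⟨p⟩ := h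
  by_cases hx : x ∈ p.support
  · exact ⟨p.takeUntil x hx⟩
  · exact absurd ⟨p, fun w hw e => hx (e ▸ hw)⟩ hc

/-- Consider the natural map `Φ` from the components of `G - x` to those of `G`. More components of
`G - x` prevent injectivity. Conversely, two separated vertices of one component of `G` show that
`x` is not isolated, so `Φ` is surjective but not injective, and for finite sets this means more
components. -/
theorem isCutvertex_iff [Finite V] {x : V} : IsCutvertex G x ↔
    ∃ u v, u ≠ x ∧ v ≠ x ∧ G.Reachable u v ∧ ¬ Conn G {x}ᶜ u v := by
  let Φ : (G.induce ({x}ᶜ : Set V)).ConnectedComponent → G.ConnectedComponent :=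
    ConnectedComponent.map (Embedding.induce _).toHom
  constructor
  · intro h
    by_contra! hcon
    refine h.not_ge (Nat.card_le_card_of_injective Φ fun c d => ?_)
    induction c using ConnectedComponent.ind with | _ c =>
    induction d using ConnectedComponent.ind with | _ d =>
    intro hcd
    have hr : G.Reachable c.1 d.1 := ConnectedComponent.exact hcd
    exact ConnectedComponent.sound
      ((conn_iff_induce_reachable c.2 d.2).1 (hcon c.1 d.1 c.2 d.2 hr))
  · rintro ⟨u, v, hu, hv, huv, hc⟩
    by_contra! hle
    have hsurj : Function.Surjective Φ := by
      intro c
      induction c using ConnectedComponent.ind with | _ y =>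
      by_cases hy : y = x
      · refine ⟨connectedComponentMk _ ⟨u, hu⟩, ConnectedComponent.sound ?_⟩
        rw [hy]
        exact reachable_of_not_conn huv hc
      · exact ⟨connectedComponentMk _ ⟨y, hy⟩, rfl⟩
    have hbij := hsurj.bijective_of_nat_card_le (not_lt.1 hle)
    refine hc ((conn_iff_induce_reachable hu hv).2 (ConnectedComponent.exact (hbij.1 ?_)))
    exact ConnectedComponent.sound huv

/-- A neighbour of `x` that is joined to `u` without using `x`. -/
lemma exists_adj_conn {x u : V} (h : G.Reachable x u) (hu : u ≠ x) :
    ∃ s, G.Adj x s ∧ Conn G {x}ᶜ s u := by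
  obtain ⟨p, hp, -⟩ := (Conn.of_reachable h).exists_path
  cases p with
  | nil => exact absurd rfl hu
  | cons hs q =>
    rw [Walk.cons_isPath_iff] at hp
    exact ⟨_, hs, q, fun w hw e => hp.2 (e ▸ hw)⟩

/-- If all neighbours of `x` are in `B`, then `B \ {x}` joins them and nothing is separated by `x`.
If `w` is a neighbour outside of `B`, a route from `w` to `B` that avoids `x` would be an ear of
`B`, so `x` separates `w` from `B`. -/
lemma IsBlk.isCutvertex_iff [Finite V] {B : Set V} (hB : IsBlk G Set.univ B) {x : V} (hx : x ∈ B) :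
    IsCutvertex G x ↔ Att G Set.univ B x := by
  rw [FourPath.isCutvertex_iff]
  constructor
  · rintro ⟨u, v, hu, hv, huv, hc⟩
    by_contra hatt
    have hnb : ∀ s, G.Adj x s → s ∈ B := fun s hs => by
      by_contra hsB
      exact hatt ⟨s, trivial, hsB, hs⟩
    have hux := reachable_of_not_conn huv hc
    obtain ⟨s, hs, hsu⟩ := exists_adj_conn hux.symm hu
    obtain ⟨t, ht, htv⟩ := exists_adj_conn (hux.symm.trans huv) hv
    exact hc ((hsu.symm.trans ((hB.two_conn.2 x s (hnb s hs) t (hnb t ht) hs.ne' ht.ne').mono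
      fun y hy => hy.2)).trans htv)
  · rintro ⟨w, -, hw, hxw⟩
    obtain ⟨b, hb, hbx, -⟩ := exists_ne_ne hB.card x x
    refine ⟨w, b, hxw.ne', hbx, hxw.reachable.symm.trans (hB.two_conn.1 x hx b hb).reachable,
      fun hc => ?_⟩
    obtain ⟨t, ht, p, hp, hpx, -⟩ := hc.exists_path_first hb
    have hq : (Walk.cons hxw p).IsPath := by
      rw [Walk.cons_isPath_iff]
      exact ⟨hp, fun h => hpx x h rfl⟩
    exact hw (hB.max _ Set.subset_union_left (Set.subset_univ _)
      (hB.two_conn.union_path hx ht hq) (Or.inr (by simp)))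

end Cutvertices

/-! ### Blocks as subgraphs and blocks as vertex sets -/

section Blocks
variable {V : Type u} {G : SimpleGraph V}

lemma Conn.map_coe {C : G.Subgraph} {S : Set C.verts} {u v : C.verts} (h : Conn C.coe S u v) :
    Conn G (Subtype.val '' S) u.1 v.1 := by
  obtain ⟨p, hp⟩ := h
  refine ⟨p.map C.hom, fun w hw => ?_⟩
  have hw' : w ∈ (p.map C.hom).support := hw
  rw [Walk.support_map, List.mem_map] at hw'
  obtain ⟨z, hz, rfl⟩ := hw'
  exact ⟨z, hp z hz, rfl⟩

lemma Conn.coe {C : G.Subgraph} (hC : ∀ x ∈ C.verts, ∀ y ∈ C.verts, G.Adj x y → C.Adj x y)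
    {S : Set V} (hS : S ⊆ C.verts) {u v : V} (h : Conn G S u v) :
    Conn C.coe (Subtype.val ⁻¹' S) ⟨u, hS h.mem_left⟩ ⟨v, hS h.mem_right⟩ := by
  obtain ⟨p, hp⟩ := h
  induction p with
  | nil => exact Conn.refl (hp _ (by simp))
  | @cons a b c hab p ih =>
    have ha := hp a (by simp)
    have hb := hp b (by simp)
    exact (Conn.of_adj (S := Subtype.val ⁻¹' S) (u := (⟨a, hS ha⟩ : C.verts)) (v := ⟨b, hS hb⟩)
      (hC a (hS ha) b (hS hb) hab) ha hb).trans (ih fun w hw => hp w (by simp [hw]))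

lemma twoConn_verts [Finite V] {C : G.Subgraph} (hC : C.Connected)
    (hcut : ∀ x : C.verts, ¬ IsCutvertex C.coe x) : TwoConn G C.verts := by
  have h1 : ∀ u ∈ C.verts, ∀ v ∈ C.verts, Conn G C.verts u v := fun u hu v hv =>
    ((Conn.of_reachable (hC.coe.preconnected ⟨u, hu⟩ ⟨v, hv⟩)).map_coe).mono (by
      rintro _ ⟨z, -, rfl⟩
      exact z.2)
  refine ⟨h1, fun x u hu v hv hux hvx => ?_⟩
  by_cases hx : x ∈ C.verts
  · have := hcut ⟨x, hx⟩
    rw [isCutvertex_iff] at this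
    push Not at this
    refine ((this ⟨u, hu⟩ ⟨v, hv⟩ (fun e => hux (congrArg Subtype.val e))
      (fun e => hvx (congrArg Subtype.val e)) (hC.coe.preconnected _ _)).map_coe).mono ?_
    rintro _ ⟨z, hz, rfl⟩
    exact ⟨z.2, fun e => hz (Subtype.ext e)⟩
  · exact (h1 u hu v hv).mono fun y hy => ⟨hy, fun e => hx (e ▸ hy)⟩

lemma TwoConn.connected_and {C : G.Subgraph} [Finite V]
    (hC : ∀ x ∈ C.verts, ∀ y ∈ C.verts, G.Adj x y → C.Adj x y) (h : TwoConn G C.verts)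
    (hne : C.verts.Nonempty) : C.Connected ∧ ∀ x : C.verts, ¬ IsCutvertex C.coe x := by
  have := hne.to_subtype
  refine ⟨⟨⟨fun u v => ((h.1 u u.2 v v.2).coe hC Set.Subset.rfl).reachable⟩⟩, fun x => ?_⟩
  rw [isCutvertex_iff]
  rintro ⟨u, v, hux, hvx, -, hc⟩
  refine hc (((h.2 x u u.2 v v.2 (fun e => hux (Subtype.ext e))
    fun e => hvx (Subtype.ext e)).coe hC Set.sdiff_subset).mono ?_)
  rintro y hy e
  exact hy.2 (congrArg Subtype.val e)

lemma nonempty_iso_top {C : G.Subgraph} {m : ℕ}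
    (hC : ∀ x ∈ C.verts, ∀ y ∈ C.verts, x ≠ y → C.Adj x y) (hm : Nat.card C.verts = m)
    (h0 : m ≠ 0) : Nonempty (C.coe ≃g (⊤ : SimpleGraph (Fin m))) := by
  have : Finite C.verts := Nat.finite_of_card_ne_zero (hm ▸ h0)
  refine ⟨⟨Finite.equivFinOfCardEq hm, @fun a b => ?_⟩⟩
  rw [top_adj, (Finite.equivFinOfCardEq hm).injective.ne_iff]
  exact ⟨fun h => hC a a.2 b b.2 fun e => h (Subtype.ext e), fun h => h.ne⟩

/-- For `S = B.verts` this shows that blocks are induced subgraphs; for larger `S` it gives the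
maximality required in `IsBlk`. -/
lemma isBlock_le [Finite V] {B : G.Subgraph} (hB : IsBlock G B) {S : Set V} (hS : B.verts ⊆ S)
    (h : TwoConn G S) : (⊤ : G.Subgraph).induce S ≤ B := by
  refine hB.le_of_ge (h.connected_and (C := (⊤ : G.Subgraph).induce S)
    (fun x hx y hy hxy => ⟨hx, hy, hxy⟩) (hB.prop.1.nonempty.mono hS)) ?_
  exact ⟨hS, fun x y hxy => ⟨hS (B.edge_vert hxy), hS (B.edge_vert hxy.symm), B.adj_sub hxy⟩⟩

lemma isBlock_adj [Finite V] {B : G.Subgraph} (hB : IsBlock G B) {x y : V} (hx : x ∈ B.verts)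
    (hy : y ∈ B.verts) (h : G.Adj x y) : B.Adj x y :=
  (isBlock_le hB Set.Subset.rfl (twoConn_verts hB.prop.1 hB.prop.2)).2 ⟨hx, hy, h⟩

lemma isBlk_of_isBlock [Finite V] {B : G.Subgraph} (hB : IsBlock G B) (ht : ¬ IsTrivialBlock B) :
    IsBlk G Set.univ B.verts where
  subset := Set.subset_univ _
  two_conn := twoConn_verts hB.prop.1 hB.prop.2
  card := by
    by_contra! hle
    have hpos : 0 < B.verts.ncard := (Set.ncard_pos (Set.toFinite _)).2 hB.prop.1.nonempty
    have h12 : B.verts.ncard = 1 ∨ B.verts.ncard = 2 := by omega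
    rcases h12 with h | h
    · refine ht (Or.inl (nonempty_iso_top (fun x hx y hy hxy => ?_) h (by simp)))
      exact absurd ((Set.ncard_le_one (Set.toFinite _)).1 h.le x hx y hy) hxy
    · refine ht (Or.inr (nonempty_iso_top (fun x hx y hy hxy => ?_) h (by simp)))
      refine isBlock_adj hB hx hy ?_
      obtain ⟨s, hs, hxs⟩ := ((twoConn_verts hB.prop.1 hB.prop.2).1 x hx y hy).exists_adj hxy
      have : s = y := by
        by_contra hsy
        have h3 : ({x, y, s} : Set V) ⊆ B.verts := by
          rintro z (rfl | rfl | rfl) <;> assumption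
        have h4 := Set.ncard_le_ncard h3 (Set.toFinite _)
        have h5 : ({x, y, s} : Set V).ncard = 3 := Set.ncard_eq_three.2
          ⟨x, y, s, hxy, hxs.ne, Ne.symm hsy, rfl⟩
        omega
      exact this ▸ hxs
  max S hS _ h := (isBlock_le hB hS h).1

lemma IsBlk.isBlock [Finite V] {S : Set V} (hS : IsBlk G Set.univ S) :
    IsBlock G ((⊤ : G.Subgraph).induce S) := by
  have hne : S.Nonempty := Set.nonempty_of_ncard_ne_zero (by have := hS.card; omega)
  refine ⟨TwoConn.connected_and (C := (⊤ : G.Subgraph).induce S)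
    (fun x hx y hy hxy => ⟨hx, hy, hxy⟩) hS.two_conn hne, fun C hC hle => ?_⟩
  have hsub : C.verts ⊆ S := hS.max _ hle.1 (Set.subset_univ _) (twoConn_verts hC.1 hC.2)
  exact ⟨hsub, fun x y hxy => ⟨hsub (C.edge_vert hxy), hsub (C.edge_vert hxy.symm), C.adj_sub hxy⟩⟩

lemma IsBlk.not_isTrivialBlock {S : Set V} (hS : IsBlk G Set.univ S) :
    ¬ IsTrivialBlock ((⊤ : G.Subgraph).induce S) := by
  have h := hS.card
  rintro (⟨⟨φ⟩⟩ | ⟨⟨φ⟩⟩)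
  all_goals
    have h1 := Nat.card_congr φ.toEquiv
    rw [Nat.card_fin] at h1
    change S.ncard = _ at h1
    omega

lemma cutverticesIn_eq [Finite V] {B : G.Subgraph} (hB : IsBlk G Set.univ B.verts) :
    cutverticesIn B = {x | x ∈ B.verts ∧ Att G Set.univ B.verts x} := by
  ext x
  exact and_congr_right fun hx => hB.isCutvertex_iff hx

end Blocks

/-! ### `SubS` and condition (i) -/

section Subdivisions
variable {V : Type u} {G : SimpleGraph V} {B : G.Subgraph} {A₀ A₁ E : Set V}

lemma SubS.exists_ends {B : Set V} (h : SubS G Set.univ B A₀ A₁ E) {e : V} (he : e ∈ E) :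
    ∃ u ∈ A₀, ∃ v ∈ A₁, u ≠ v ∧ ∀ y, G.Adj e y ↔ y = u ∨ y = v := by
  obtain ⟨u, hu, v, hv, huv⟩ := h.ends e he
  exact ⟨u, hu, v, hv, fun e => Set.disjoint_left.1 h.disj hu (e ▸ hv), fun y => huv y trivial⟩

/-- The multigraph of which a block is the subdivision. -/
def SubS.toGraph {B : Set V} (h : SubS G Set.univ B A₀ A₁ E) : Graph V V where
  vertexSet := A₀ ∪ A₁
  -- Without `x ≠ y`, an edge would also link each of its ends to itself, and its pair of ends would
  -- not be unique.
  IsLink e x y := e ∈ E ∧ x ≠ y ∧ G.Adj e x ∧ G.Adj e y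
  isLink_symm := fun _ _ => ⟨fun _ _ ⟨h1, h2, h3, h4⟩ => ⟨h1, h2.symm, h4, h3⟩⟩
  eq_or_eq_of_isLink_of_isLink := by
    rintro e x y v w ⟨he, hxy, h1, h2⟩ ⟨-, hvw, h3, h4⟩
    obtain ⟨a, -, b, -, -, hab⟩ := h.exists_ends he
    rw [hab] at h1 h2 h3 h4
    grind
  left_mem_of_isLink := by
    rintro e x y ⟨he, hxy, h1, h2⟩
    obtain ⟨a, ha, b, hb, -, hab⟩ := h.exists_ends he
    rcases (hab x).1 h1 with rfl | rfl
    exacts [Or.inl ha, Or.inr hb]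

lemma SubS.inc_iff {B : Set V} (h : SubS G Set.univ B A₀ A₁ E) {e x : V} :
    h.toGraph.Inc e x ↔ e ∈ E ∧ G.Adj e x := by
  constructor
  · rintro ⟨y, he, -, hx, -⟩
    exact ⟨he, hx⟩
  · rintro ⟨he, hx⟩
    obtain ⟨a, ha, b, hb, hne, hab⟩ := h.exists_ends he
    rcases (hab x).1 hx with rfl | rfl
    · exact ⟨b, he, hne, hx, (hab b).2 (Or.inr rfl)⟩
    · exact ⟨a, he, hne.symm, hx, (hab a).2 (Or.inl rfl)⟩

lemma SubS.edgeSet_eq {B : Set V} (h : SubS G Set.univ B A₀ A₁ E) : E(h.toGraph) = E := by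
  ext e
  constructor
  · rintro ⟨x, y, he, -⟩
    exact he
  · intro he
    obtain ⟨a, ha, b, hb, hne, hab⟩ := h.exists_ends he
    exact ⟨a, b, he, hne, (hab a).2 (Or.inl rfl), (hab b).2 (Or.inr rfl)⟩

theorem SubS.isSubdivisionBlock [Finite V] (hB : IsBlk G Set.univ B.verts)
    (hI : ∀ x ∈ B.verts, ∀ y ∈ B.verts, G.Adj x y → B.Adj x y)
    (h : SubS G Set.univ B.verts A₀ A₁ E) : IsSubdivisionBlock B := by
  have hE : ∀ e, e ∈ E(h.toGraph) ↔ e ∈ E := fun e => by rw [h.edgeSet_eq]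
  have hA : ∀ x, x ∈ V(h.toGraph) ↔ x ∈ A₀ ∪ A₁ := fun x => Iff.rfl
  have hAE : ∀ x ∈ A₀ ∪ A₁, x ∉ E := by
    rintro x (hx | hx) hxE
    exacts [Set.disjoint_left.1 h.disj₀ hx hxE, Set.disjoint_left.1 h.disj₁ hx hxE]
  have hAB : ∀ x ∈ A₀ ∪ A₁, x ∈ B.verts := fun x hx => by rw [h.union]; exact Or.inl hx
  have hEB : ∀ x ∈ E, x ∈ B.verts := fun x hx => by rw [h.union]; exact Or.inr hx
  let g : V(h.toGraph) ⊕ E(h.toGraph) → B.verts :=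
    Sum.elim (fun v => ⟨v.1, hAB _ v.2⟩) (fun e => ⟨e.1, hEB _ ((hE _).1 e.2)⟩)
  have hg : Function.Bijective g := by
    constructor
    · rintro (x | x) (y | y) hxy
      · have e : (g (Sum.inl x)).1 = (g (Sum.inl y)).1 := congrArg Subtype.val hxy
        exact congrArg Sum.inl (Subtype.ext e)
      · have e : x.1 = y.1 := Subtype.ext_iff.1 hxy
        exact absurd (e ▸ (hE _).1 y.2) (hAE x.1 x.2)
      · have e : x.1 = y.1 := Subtype.ext_iff.1 hxy
        exact absurd (e ▸ (hE _).1 x.2) (hAE y.1 y.2)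
      · have e : (g (Sum.inr x)).1 = (g (Sum.inr y)).1 := congrArg Subtype.val hxy
        exact congrArg Sum.inr (Subtype.ext e)
    · rintro ⟨x, hx⟩
      rcases (h.union ▸ hx : x ∈ A₀ ∪ A₁ ∪ E) with hx' | hx'
      · exact ⟨Sum.inl ⟨x, hx'⟩, rfl⟩
      · exact ⟨Sum.inr ⟨x, (hE x).2 hx'⟩, rfl⟩
  have hadj : ∀ a b, B.coe.Adj (g a) (g b) ↔ (sub2 h.toGraph).Adj a b := by
    have hBG : ∀ x y : B.verts, B.coe.Adj x y ↔ G.Adj x y := fun x y =>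
      ⟨fun h => B.adj_sub h, fun h => hI x x.2 y y.2 h⟩
    rintro (x | x) (y | y)
    · rw [hBG]
      exact ⟨fun hxy => hAE _ y.2 (h.indep _ x.2 _ (hAB _ y.2) hxy), False.elim⟩
    · rw [hBG]
      change G.Adj x.1 y.1 ↔ h.toGraph.Inc y.1 x.1
      rw [h.inc_iff, G.adj_comm]
      exact ⟨fun h => ⟨(hE _).1 y.2, h⟩, fun h => h.2⟩
    · rw [hBG]
      change G.Adj x.1 y.1 ↔ h.toGraph.Inc x.1 y.1
      rw [h.inc_iff]
      exact ⟨fun h => ⟨(hE _).1 x.2, h⟩, fun h => h.2⟩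
    · rw [hBG]
      refine ⟨fun hxy => ?_, False.elim⟩
      obtain ⟨a, ha, b, hb, -, hab⟩ := h.exists_ends ((hE _).1 x.2)
      have hy := (hE _).1 y.2
      rcases (hab y.1).1 hxy with e | e
      · exact hAE a (Or.inl ha) (e ▸ hy)
      · exact hAE b (Or.inr hb) (e ▸ hy)
  let φ : sub2 h.toGraph ≃g B.coe := ⟨Equiv.ofBijective g hg, fun {a b} => hadj a b⟩
  refine ⟨V, V, h.toGraph, φ.symm, ⟨A₀, ?_⟩, fun x hx => ?_⟩
  · rintro e x y ⟨he, hxy, h1, h2⟩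
    obtain ⟨a, ha, b, hb, -, hab⟩ := h.exists_ends he
    have hb0 : b ∉ A₀ := fun h0 => Set.disjoint_left.1 h.disj h0 hb
    rw [hab] at h1 h2
    rcases h1 with rfl | rfl <;> rcases h2 with rfl | rfl <;> simp_all
  -- A cutvertex has a neighbour outside of the block, whereas both neighbours of a subdivision
  -- vertex belong to it.
  · rw [hB.isCutvertex_iff x.2] at hx
    obtain ⟨w, -, hwB, hxw⟩ := hx
    rcases he : φ.symm x with v | e
    · exact ⟨v, rfl⟩
    · exfalso
      have hxe : x = g (Sum.inr e) := by
        rw [← φ.apply_symm_apply x, he]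
        rfl
      have hxE : x.1 ∈ E := by
        rw [hxe]
        exact (hE _).1 e.2
      obtain ⟨a, ha, b, hb, -, hab⟩ := h.exists_ends hxE
      rcases (hab w).1 hxw with rfl | rfl
      · exact hwB (hAB _ (Or.inl ha))
      · exact hwB (hAB _ (Or.inr hb))

/-- The bipartition of the multigraph provides `A₀` and `A₁`. The condition on cutvertices is what
guarantees that a subdivision vertex has no neighbours in `G` besides its two ends. -/
theorem exists_subS_of_isSubdivisionBlock [Finite V] (hB : IsBlk G Set.univ B.verts)
    (hI : ∀ x ∈ B.verts, ∀ y ∈ B.verts, G.Adj x y → B.Adj x y) (h : IsSubdivisionBlock B) :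
    ∃ A₀ A₁ E, SubS G Set.univ B.verts A₀ A₁ E := by
  obtain ⟨α, β, H, φ, ⟨A, hA⟩, hcut⟩ := h
  have hBG : ∀ x y : B.verts, G.Adj x y ↔ (sub2 H).Adj (φ x) (φ y) := fun x y => by
    rw [φ.map_adj_iff]
    exact ⟨fun h => hI x x.2 y y.2 h, fun h => B.adj_sub h⟩
  refine ⟨{x | ∃ hx : x ∈ B.verts, ∃ v : V(H), φ ⟨x, hx⟩ = Sum.inl v ∧ v.1 ∈ A},
    {x | ∃ hx : x ∈ B.verts, ∃ v : V(H), φ ⟨x, hx⟩ = Sum.inl v ∧ v.1 ∉ A},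
    {x | ∃ hx : x ∈ B.verts, ∃ e : E(H), φ ⟨x, hx⟩ = Sum.inr e}, ?_, ?_, ?_, ?_, ?_, ?_⟩
  · ext x
    constructor
    · intro hx
      rcases he : φ ⟨x, hx⟩ with v | e
      · by_cases hv : v.1 ∈ A
        · exact Or.inl (Or.inl ⟨hx, v, he, hv⟩)
        · exact Or.inl (Or.inr ⟨hx, v, he, hv⟩)
      · exact Or.inr ⟨hx, e, he⟩
    · rintro ((⟨hx, -⟩ | ⟨hx, -⟩) | ⟨hx, -⟩) <;> exact hx
  · rw [Set.disjoint_left]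
    rintro x ⟨hx, v, hv, hvA⟩ ⟨_, v', hv', hvA'⟩
    rw [hv] at hv'
    obtain rfl := Sum.inl.inj hv'
    exact hvA' hvA
  · rw [Set.disjoint_left]
    rintro x ⟨hx, v, hv, hvA⟩ ⟨_, v', hv'⟩
    rw [hv] at hv'
    cases hv'
  · rw [Set.disjoint_left]
    rintro x ⟨hx, v, hv, hvA⟩ ⟨_, v', hv'⟩
    rw [hv] at hv'
    cases hv'
  · intro x hx y hy hxy
    obtain ⟨hxB, v, hv⟩ : ∃ hx : x ∈ B.verts, ∃ v : V(H), φ ⟨x, hx⟩ = Sum.inl v := by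
      rcases hx with ⟨hx, v, hv, -⟩ | ⟨hx, v, hv, -⟩ <;> exact ⟨hx, v, hv⟩
    have h1 := (hBG ⟨x, hxB⟩ ⟨y, hy⟩).1 hxy
    rw [hv] at h1
    rcases he : φ ⟨y, hy⟩ with w | e
    · rw [he] at h1
      exact h1.elim
    · exact ⟨hy, e, he⟩
  · rintro x ⟨hx, e, he⟩
    obtain ⟨a, b, hab⟩ := H.exists_isLink_of_mem_edgeSet e.2
    have key : ∀ a b, H.IsLink e.1 a b → a ∈ A → ∃ u ∈ {x | ∃ hx : x ∈ B.verts, ∃ v : V(H),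
        φ ⟨x, hx⟩ = Sum.inl v ∧ v.1 ∈ A}, ∃ v ∈ {x | ∃ hx : x ∈ B.verts, ∃ v : V(H),
        φ ⟨x, hx⟩ = Sum.inl v ∧ v.1 ∉ A}, ∀ y ∈ Set.univ, G.Adj x y ↔ y = u ∨ y = v := by
      intro a b hab ha
      have hb : b ∉ A := (hA _ _ _ hab).1 ha
      have hφ : ∀ v : V(H), φ (φ.symm (Sum.inl v)) = Sum.inl v := fun v => φ.apply_symm_apply _
      refine ⟨φ.symm (Sum.inl ⟨a, hab.left_mem⟩), ⟨Subtype.prop _, _, hφ _, ha⟩,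
        φ.symm (Sum.inl ⟨b, hab.right_mem⟩), ⟨Subtype.prop _, _, hφ _, hb⟩, fun y _ => ?_⟩
      constructor
      · intro hxy
        have hyB : y ∈ B.verts := by
          by_contra hyB
          obtain ⟨v, hv⟩ := hcut ⟨x, hx⟩ ((hB.isCutvertex_iff hx).2 ⟨y, trivial, hyB, hxy⟩)
          rw [he] at hv
          cases hv
        have h1 := (hBG ⟨x, hx⟩ ⟨y, hyB⟩).1 hxy
        rw [he] at h1
        rcases hy : φ ⟨y, hyB⟩ with w | f
        · rw [hy] at h1
          obtain ⟨z, hz⟩ : H.Inc e.1 w.1 := h1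
          have hyw : (⟨y, hyB⟩ : B.verts) = φ.symm (Sum.inl w) := by
            rw [← hy, φ.symm_apply_apply]
          rcases hz.left_eq_or_eq hab with h2 | h2
          · left
            have : w = ⟨a, hab.left_mem⟩ := Subtype.ext h2
            rw [← this, ← hyw]
          · right
            have : w = ⟨b, hab.right_mem⟩ := Subtype.ext h2
            rw [← this, ← hyw]
        · rw [hy] at h1
          exact h1.elim
      · rintro (rfl | rfl)
        · rw [hBG ⟨x, hx⟩, hφ, he]
          exact ⟨b, hab⟩
        · rw [hBG ⟨x, hx⟩, hφ, he]
          exact ⟨a, hab.symm⟩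
    by_cases ha : a ∈ A
    · exact key a b hab ha
    · exact key b a hab.symm (by
        by_contra hb
        exact ha ((hA _ _ _ hab).2 hb))

end Subdivisions

/-! ### `K4S`, `T2S`, `TS` and conditions (ii) to (iv) -/

section Shapes
variable {V : Type u} {G : SimpleGraph V} {B : G.Subgraph} {p : ℕ}

theorem K4S.isK4Endblock [Finite V] (hB : IsBlk G Set.univ B.verts)
    (hI : ∀ x ∈ B.verts, ∀ y ∈ B.verts, G.Adj x y → B.Adj x y) (h : K4S G Set.univ B.verts) :
    IsK4Endblock B := by
  obtain ⟨a, b, c, d, hab, hac, had, hbc, hbd, hcd, hBe, hatt⟩ := h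
  refine ⟨nonempty_iso_top (fun x hx y hy hxy => hI x hx y hy ?_) ?_ (by simp), ?_⟩
  · rw [hBe] at hx hy
    rcases hx with rfl | rfl | rfl | rfl <;> rcases hy with rfl | rfl | rfl | rfl <;>
      first | exact absurd rfl hxy | assumption | (apply Adj.symm; assumption)
  · have h4 : IsP4 G B.verts := ⟨a, b, c, d, hac.ne, had.ne, hbd.ne, hab, hbc, hcd, hBe⟩
    exact h4.ncard_eq
  · rw [cutverticesIn_eq hB, Set.ncard_le_one (Set.toFinite _)]
    rintro x ⟨hx, hxa⟩ y ⟨hy, hya⟩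
    exact hatt x hx y hy hxa hya

theorem k4S_of_isK4Endblock [Finite V] (hB : IsBlk G Set.univ B.verts) (h : IsK4Endblock B) :
    K4S G Set.univ B.verts := by
  obtain ⟨⟨φ⟩, hcut⟩ := h
  have hadj : ∀ i j : Fin 4, i ≠ j → G.Adj (φ.symm i) (φ.symm j) := fun i j hij =>
    B.adj_sub (φ.symm.map_adj_iff.2 hij)
  refine ⟨φ.symm 0, φ.symm 1, φ.symm 2, φ.symm 3, hadj _ _ (by decide), hadj _ _ (by decide),
    hadj _ _ (by decide), hadj _ _ (by decide), hadj _ _ (by decide), hadj _ _ (by decide), ?_, ?_⟩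
  · ext v
    constructor
    · intro hv
      have hx : φ.symm (φ ⟨v, hv⟩) = ⟨v, hv⟩ := φ.symm_apply_apply _
      generalize φ ⟨v, hv⟩ = i at hx
      fin_cases i <;> simp_all
    · rintro (rfl | rfl | rfl | rfl) <;> exact Subtype.prop _
  · rw [cutverticesIn_eq hB, Set.ncard_le_one (Set.toFinite _)] at hcut
    exact fun x hx y hy hxa hya => hcut x ⟨hx, hxa⟩ y ⟨hy, hya⟩

lemma graphT_adj_inl {i j : Fin 2} : (graphT p).Adj (Sum.inl i) (Sum.inl j) ↔ i ≠ j := by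
  fin_cases i <;> fin_cases j <;> simp [graphT, edge_adj]

lemma graphT_adj_inl_inr {i : Fin 2} {j : Fin p} : (graphT p).Adj (Sum.inl i) (Sum.inr j) := by
  simp [graphT]

lemma not_graphT_adj_inr {i j : Fin p} : ¬ (graphT p).Adj (Sum.inr i) (Sum.inr j) := by
  simp [graphT, edge_adj]

lemma IsT.nonempty_iso [Finite V] {a b : V} {C : Set V} (h : IsT G B.verts a b C)
    (hI : ∀ x ∈ B.verts, ∀ y ∈ B.verts, G.Adj x y → B.Adj x y) (hp : C.ncard = p) :
    Nonempty (B.coe ≃g graphT p) := by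
  have hCB : ∀ x ∈ C, x ∈ B.verts := fun x hx => by rw [h.eq]; exact Or.inr hx
  have haB : a ∈ B.verts := by rw [h.eq]; simp
  have hbB : b ∈ B.verts := by rw [h.eq]; simp
  let ψ : Fin p ≃ C := (Finite.equivFinOfCardEq hp).symm
  let g : Fin 2 ⊕ Fin p → B.verts :=
    Sum.elim ![⟨a, haB⟩, ⟨b, hbB⟩] (fun i => ⟨ψ i, hCB _ (ψ i).2⟩)
  have hg0 : (g (Sum.inl 0)).1 = a := rfl
  have hg1 : (g (Sum.inl 1)).1 = b := rfl
  have hgC : ∀ i, (g (Sum.inr i)).1 = ψ i := fun i => rfl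
  have hab := h.adj.ne
  have haC : ∀ i, a ≠ ψ i := fun i e => h.left (e ▸ (ψ i).2)
  have hbC : ∀ i, b ≠ ψ i := fun i e => h.right (e ▸ (ψ i).2)
  have h2 : ∀ i, (g (Sum.inl i)).1 = a ∨ (g (Sum.inl i)).1 = b := fun i => by
    fin_cases i
    exacts [Or.inl rfl, Or.inr rfl]
  have hg : Function.Bijective g := by
    constructor
    · rintro (i | i) (j | j) hij
      · have e := congrArg Subtype.val hij
        fin_cases i <;> fin_cases j
        exacts [rfl, absurd e hab, absurd e hab.symm, rfl]
      · have e := congrArg Subtype.val hij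
        rw [hgC] at e
        rcases h2 i with h3 | h3 <;> rw [h3] at e
        exacts [absurd e (haC j), absurd e (hbC j)]
      · have e := congrArg Subtype.val hij
        rw [hgC] at e
        rcases h2 j with h3 | h3 <;> rw [h3] at e
        exacts [absurd e.symm (haC i), absurd e.symm (hbC i)]
      · have e := congrArg Subtype.val hij
        rw [hgC, hgC] at e
        exact congrArg Sum.inr (ψ.injective (Subtype.ext e))
    · rintro ⟨x, hx⟩
      rcases (h.eq ▸ hx : x ∈ {a, b} ∪ C) with (rfl | rfl) | hx'
      · exact ⟨Sum.inl 0, rfl⟩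
      · exact ⟨Sum.inl 1, rfl⟩
      · exact ⟨Sum.inr (ψ.symm ⟨x, hx'⟩), Subtype.ext (by rw [hgC, ψ.apply_symm_apply])⟩
  have hBG : ∀ x y : B.verts, B.coe.Adj x y ↔ G.Adj x y := fun x y =>
    ⟨fun h => B.adj_sub h, fun h => hI x x.2 y y.2 h⟩
  have hadj : ∀ x y, B.coe.Adj (g x) (g y) ↔ (graphT p).Adj x y := by
    rintro (i | i) (j | j) <;> rw [hBG]
    · rw [graphT_adj_inl]
      fin_cases i <;> fin_cases j
      · exact iff_of_false (fun e => e.ne rfl) (by decide)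
      · exact iff_of_true h.adj (by decide)
      · exact iff_of_true h.adj.symm (by decide)
      · exact iff_of_false (fun e => e.ne rfl) (by decide)
    · refine iff_of_true ?_ graphT_adj_inl_inr
      rcases h2 i with h3 | h3 <;> rw [h3]
      exacts [h.adj_left _ (ψ j).2, h.adj_right _ (ψ j).2]
    · refine iff_of_true ?_ graphT_adj_inl_inr.symm
      rcases h2 j with h3 | h3 <;> rw [h3]
      exacts [(h.adj_left _ (ψ i).2).symm, (h.adj_right _ (ψ i).2).symm]
    · exact iff_of_false (h.indep _ (ψ i).2 _ (ψ j).2) not_graphT_adj_inr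
  exact ⟨(⟨Equiv.ofBijective g hg, fun {a b} => hadj a b⟩ : graphT p ≃g B.coe).symm⟩

lemma exists_isT_of_iso (hI : ∀ x ∈ B.verts, ∀ y ∈ B.verts, G.Adj x y → B.Adj x y)
    (φ : B.coe ≃g graphT p) (hp : 0 < p) :
    ∃ a b C, IsT G B.verts a b C ∧ C.ncard = p := by
  have hadj : ∀ x y, G.Adj (φ.symm x) (φ.symm y) ↔ (graphT p).Adj x y := fun x y => by
    rw [← φ.symm.map_adj_iff]
    exact ⟨fun h => hI _ (Subtype.prop _) _ (Subtype.prop _) h, fun h => B.adj_sub h⟩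
  have hne : ∀ x y, x ≠ y → (φ.symm x : V) ≠ φ.symm y := fun x y hxy e =>
    hxy (φ.symm.injective (Subtype.ext e))
  have hinj : Function.Injective fun i : Fin p => (φ.symm (Sum.inr i) : V) := fun i j e => by
    by_contra hij
    exact hne _ _ (fun e => hij (Sum.inr.inj e)) e
  refine ⟨φ.symm (Sum.inl 0), φ.symm (Sum.inl 1), Set.range fun i : Fin p => (φ.symm (Sum.inr i) : V),
    ⟨?_, ⟨_, ⟨0, hp⟩, rfl⟩, ?_, ?_, (hadj _ _).2 (graphT_adj_inl.2 (by decide)), ?_, ?_, ?_⟩, ?_⟩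
  · ext v
    constructor
    · intro hv
      have hx : φ.symm (φ ⟨v, hv⟩) = ⟨v, hv⟩ := φ.symm_apply_apply _
      generalize φ ⟨v, hv⟩ = z at hx
      rcases z with i | i
      · left
        fin_cases i
        · left
          exact (congrArg Subtype.val hx).symm
        · right
          exact (congrArg Subtype.val hx).symm
      · right
        exact ⟨i, congrArg Subtype.val hx⟩
    · rintro ((rfl | rfl) | ⟨i, rfl⟩) <;> exact Subtype.prop _
  · rintro ⟨i, hi⟩
    exact hne _ _ (by simp) hi
  · rintro ⟨i, hi⟩
    exact hne _ _ (by simp) hi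
  · rintro _ ⟨i, rfl⟩
    exact (hadj _ _).2 graphT_adj_inl_inr
  · rintro _ ⟨i, rfl⟩
    exact (hadj _ _).2 graphT_adj_inl_inr
  · rintro _ ⟨i, rfl⟩ _ ⟨j, rfl⟩
    rw [hadj]
    exact not_graphT_adj_inr
  · rw [Set.ncard_range_of_injective hinj, Nat.card_fin]

lemma IsT.ncard_neighborSet_left [Finite V] {a b : V} {C : Set V} (h : IsT G B.verts a b C)
    (hI : ∀ x ∈ B.verts, ∀ y ∈ B.verts, G.Adj x y → B.Adj x y) :
    (B.neighborSet a).ncard = C.ncard + 1 := by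
  have haB : a ∈ B.verts := by rw [h.eq]; simp
  have hbB : b ∈ B.verts := by rw [h.eq]; simp
  have hCB : ∀ x ∈ C, x ∈ B.verts := fun x hx => by rw [h.eq]; exact Or.inr hx
  have : B.neighborSet a = insert b C := by
    ext y
    constructor
    · intro hy
      have hyB := B.edge_vert (Subgraph.Adj.symm hy)
      rw [h.eq] at hyB
      rcases hyB with (rfl | rfl) | hyC
      · exact absurd rfl (B.adj_sub hy).ne
      · exact Or.inl rfl
      · exact Or.inr hyC
    · rintro (rfl | hy)
      · exact hI _ haB _ hbB h.adj
      · exact hI _ haB _ (hCB _ hy) (h.adj_left _ hy)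
  rw [this, Set.ncard_insert_of_notMem h.right]

lemma IsT.ncard_neighborSet [Finite V] {a b : V} {C : Set V} (h : IsT G B.verts a b C)
    (hI : ∀ x ∈ B.verts, ∀ y ∈ B.verts, G.Adj x y → B.Adj x y) {c : V} (hc : c ∈ C) :
    (B.neighborSet c).ncard = 2 := by
  have haB : a ∈ B.verts := by rw [h.eq]; simp
  have hbB : b ∈ B.verts := by rw [h.eq]; simp
  have hCB : ∀ x ∈ C, x ∈ B.verts := fun x hx => by rw [h.eq]; exact Or.inr hx
  have : B.neighborSet c = {a, b} := by
    ext y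
    constructor
    · intro hy
      have hyB := B.edge_vert (Subgraph.Adj.symm hy)
      rw [h.eq] at hyB
      rcases hyB with (rfl | rfl) | hyC
      · exact Or.inl rfl
      · exact Or.inr rfl
      · exact absurd (B.adj_sub hy) (h.indep _ hc _ hyC)
    · rintro (rfl | rfl)
      · exact hI _ (hCB _ hc) _ haB (h.adj_left _ hc).symm
      · exact hI _ (hCB _ hc) _ hbB (h.adj_right _ hc).symm
  rw [this, Set.ncard_pair h.adj.ne]

theorem T2S.isT2Endblock [Finite V] (hB : IsBlk G Set.univ B.verts)
    (hI : ∀ x ∈ B.verts, ∀ y ∈ B.verts, G.Adj x y → B.Adj x y) (h : T2S G Set.univ B.verts) :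
    IsT2Endblock B := by
  obtain ⟨a, b, c, d, hcd, hT, hatt⟩ := h
  refine ⟨hT.nonempty_iso hI (Set.ncard_pair hcd), ?_, ?_⟩
  · rw [cutverticesIn_eq hB, Set.ncard_le_one (Set.toFinite _)]
    rintro x ⟨hx, hxa⟩ y ⟨hy, hya⟩
    rw [hatt x hx hxa, hatt y hy hya]
  · rw [cutverticesIn_eq hB]
    rintro x ⟨hx, hxa⟩
    rw [hatt x hx hxa]
    exact hT.ncard_neighborSet hI (by simp)

theorem t2S_of_isT2Endblock [Finite V] (hB : IsBlk G Set.univ B.verts)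
    (hI : ∀ x ∈ B.verts, ∀ y ∈ B.verts, G.Adj x y → B.Adj x y) (h : IsT2Endblock B) :
    T2S G Set.univ B.verts := by
  obtain ⟨⟨φ⟩, hle, hdeg⟩ := h
  obtain ⟨a, b, C, hT, hC⟩ := exists_isT_of_iso hI φ (by decide)
  rw [cutverticesIn_eq hB, Set.ncard_le_one (Set.toFinite _)] at hle
  rw [cutverticesIn_eq hB] at hdeg
  -- In T(2) the hubs have degree three, so the degree condition places a cutvertex in `C`.
  have hatt : ∀ x ∈ B.verts, Att G Set.univ B.verts x → x ∈ C := by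
    intro x hx hxa
    have h2 := hdeg x ⟨hx, hxa⟩
    rw [hT.eq] at hx
    rcases hx with (rfl | rfl) | hx
    · rw [hT.ncard_neighborSet_left hI] at h2
      omega
    · rw [hT.swap.ncard_neighborSet_left hI] at h2
      omega
    · exact hx
  obtain ⟨c, d, hcd, rfl⟩ := Set.ncard_eq_two.1 hC
  by_cases hd : Att G Set.univ B.verts d
  · have hdB : d ∈ B.verts := by rw [hT.eq]; simp
    refine ⟨a, b, d, c, hcd.symm, by rwa [Set.pair_comm], fun x hx hxa => ?_⟩
    exact hle x ⟨hx, hxa⟩ d ⟨hdB, hd⟩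
  · refine ⟨a, b, c, d, hcd, hT, fun x hx hxa => ?_⟩
    rcases hatt x hx hxa with rfl | rfl
    · rfl
    · exact absurd hxa hd

theorem TS.isTBlock [Finite V] (hB : IsBlk G Set.univ B.verts)
    (hI : ∀ x ∈ B.verts, ∀ y ∈ B.verts, G.Adj x y → B.Adj x y) (h : TS G Set.univ B.verts) :
    IsTBlock B := by
  obtain ⟨a, b, C, hT, hatt, hleaf⟩ := h
  have hsub : cutverticesIn B ⊆ {a, b} := by
    rw [cutverticesIn_eq hB]
    rintro x ⟨hx, hxa⟩
    exact hatt x hx hxa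
  refine ⟨C.ncard, (Set.ncard_pos (Set.toFinite _)).2 hT.nonempty, hT.nonempty_iso hI rfl, ?_, ?_,
    ?_⟩
  · rw [← Set.ncard_pair hT.adj.ne]
    exact Set.ncard_le_ncard hsub
  · intro x hx
    rcases hsub hx with rfl | rfl
    · exact hT.ncard_neighborSet_left hI
    · exact hT.swap.ncard_neighborSet_left hI
  · intro h2
    have heq := Set.eq_of_subset_of_ncard_le hsub (by rw [h2, Set.ncard_pair hT.adj.ne])
    refine ⟨b, by rw [heq]; simp, fun y hy => ?_⟩
    rw [Set.ncard_eq_one]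
    refine ⟨b, ?_⟩
    ext z
    constructor
    · intro hz
      exact hleaf y trivial hy.2 hy.1 z trivial hz
    · rintro rfl
      exact hy.1.symm

theorem tS_of_isTBlock [Finite V] (hB : IsBlk G Set.univ B.verts)
    (hI : ∀ x ∈ B.verts, ∀ y ∈ B.verts, G.Adj x y → B.Adj x y) (h : IsTBlock B) :
    TS G Set.univ B.verts := by
  obtain ⟨p, hp, ⟨φ⟩, hle, hdeg, hleaf⟩ := h
  have hT : ∃ a b C, IsT G B.verts a b C ∧ cutverticesIn B ⊆ {a, b} := by
    obtain ⟨a, b, C, hT, hC⟩ := exists_isT_of_iso hI φ hp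
    -- For `p = 1` all three degrees equal `p + 1`, so the degree condition is empty and the hubs
    -- have to be chosen to contain the at most two cutvertices. For `p ≥ 2` the vertices of `C`
    -- have the wrong degree.
    rcases (show p = 1 ∨ 2 ≤ p by omega) with rfl | hp2
    · obtain ⟨c, rfl⟩ := Set.ncard_eq_one.1 hC
      have hac := hT.adj_left c rfl
      have hbc := hT.adj_right c rfl
      have hcut : ∀ x ∈ cutverticesIn B, x = a ∨ x = b ∨ x = c := by
        rintro x ⟨hx, -⟩
        rw [hT.eq] at hx
        rcases hx with (rfl | rfl) | rfl <;> simp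
      have hBe : B.verts = {a, b, c} := by
        rw [hT.eq]
        ext w
        simp only [Set.mem_insert_iff, Set.mem_singleton_iff, Set.mem_union, or_assoc]
      by_cases hc : c ∈ cutverticesIn B
      · by_cases ha : a ∈ cutverticesIn B
        · refine ⟨a, c, {b}, IsT.triangle hac hT.adj hbc.symm ?_, fun x hx => ?_⟩
          · rw [hBe]
            ext w
            simp only [Set.mem_insert_iff, Set.mem_singleton_iff]
            tauto
          · rcases hcut x hx with rfl | rfl | rfl
            · simp
            · exfalso
              have h3 : ({a, x, c} : Set V) ⊆ cutverticesIn B := by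
                rintro y (rfl | rfl | rfl) <;> assumption
              have h4 := Set.ncard_le_ncard h3 (Set.toFinite _)
              have h5 : ({a, x, c} : Set V).ncard = 3 := Set.ncard_eq_three.2
                ⟨a, x, c, hT.adj.ne, hac.ne, hbc.ne, rfl⟩
              omega
            · simp
        · refine ⟨b, c, {a}, IsT.triangle hbc hT.adj.symm hac.symm ?_, fun x hx => ?_⟩
          · rw [hBe]
            ext w
            simp only [Set.mem_insert_iff, Set.mem_singleton_iff]
            tauto
          · rcases hcut x hx with rfl | rfl | rfl
            · exact absurd hx ha
            · simp
            · simp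
      · refine ⟨a, b, {c}, hT, fun x hx => ?_⟩
        rcases hcut x hx with rfl | rfl | rfl
        · simp
        · simp
        · exact absurd hx hc
    · refine ⟨a, b, C, hT, fun x hx => ?_⟩
      have h2 := hdeg x hx
      have hxB := hx.1
      rw [hT.eq] at hxB
      rcases hxB with hxB | hxC
      · exact hxB
      · rw [hT.ncard_neighborSet hI hxC] at h2
        omega
  obtain ⟨a, b, C, hT, hsub⟩ := hT
  have key : ∀ a b C, IsT G B.verts a b C → cutverticesIn B ⊆ {a, b} →
      (∀ y ∈ G.neighborSet b \ B.verts, (G.neighborSet y).ncard = 1) →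
      TS G Set.univ B.verts := by
    intro a b C hT hsub hb
    refine ⟨a, b, C, hT, fun x hx hxa => ?_, fun w _ hw hbw w' _ hww' => ?_⟩
    · exact hsub (by rw [cutverticesIn_eq hB]; exact ⟨hx, hxa⟩)
    · have h1 := hb w ⟨hbw, hw⟩
      exact (Set.ncard_le_one (Set.toFinite _)).1 h1.le w' hww' b hbw.symm
  -- A hub that is no cutvertex has no neighbours outside, so with fewer than two cutvertices the
  -- leaf condition holds vacuously at one hub.
  have hvac : ∀ x ∈ B.verts, x ∉ cutverticesIn B →
      ∀ y ∈ G.neighborSet x \ B.verts, (G.neighborSet y).ncard = 1 := by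
    intro x hx hxc y hy
    rw [cutverticesIn_eq hB] at hxc
    exact absurd ⟨hx, y, trivial, hy.2, hy.1⟩ hxc
  have haB : a ∈ B.verts := by rw [hT.eq]; simp
  have hbB : b ∈ B.verts := by rw [hT.eq]; simp
  have hsub' : cutverticesIn B ⊆ {b, a} := by rwa [Set.pair_comm]
  by_cases hb : b ∈ cutverticesIn B
  · by_cases ha : a ∈ cutverticesIn B
    · have heq : cutverticesIn B = {a, b} := Set.Subset.antisymm hsub (by
        rintro x (rfl | rfl) <;> assumption)
      obtain ⟨x, hx, hxl⟩ := hleaf (by rw [heq, Set.ncard_pair hT.adj.ne])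
      rcases hsub hx with rfl | rfl
      · exact key b x C hT.swap hsub' hxl
      · exact key a x C hT hsub hxl
    · exact key b a C hT.swap hsub' (hvac a haB ha)
  · exact key a b C hT hsub (hvac b hbB hb)

end Shapes

/-! ### Cycles are two-connected; cycles in a subdivision -/

section Cycles
variable {V : Type u} {G : SimpleGraph V} {S : Set V} {f : ℕ → V} {n : ℕ}

lemma conn_arc (hf : ∀ i, G.Adj (f i) (f (i + 1))) {i j : ℕ} (hij : i ≤ j) :
    Conn G (f '' Set.Icc i j) (f i) (f j) := by
  induction j, hij using Nat.le_induction with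
  | base => exact Conn.refl ⟨i, by simp, rfl⟩
  | succ j hij ih =>
    refine (ih.mono (Set.image_mono (Set.Icc_subset_Icc_right j.le_succ))).trans
      (Conn.of_adj (hf j) ⟨j, ⟨hij, j.le_succ⟩, rfl⟩ ⟨j + 1, ⟨by omega, le_rfl⟩, rfl⟩)

lemma IsCyc.twoConn (hf : IsCyc G f n) : TwoConn G (Set.range f) := by
  have h1 : ∀ u ∈ Set.range f, ∀ v ∈ Set.range f, Conn G (Set.range f) u v := by
    rintro _ ⟨i, rfl⟩ _ ⟨j, rfl⟩
    rcases le_total i j with h | h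
    · exact (conn_arc hf.adj h).mono (Set.image_subset_range _ _)
    · exact ((conn_arc hf.adj h).mono (Set.image_subset_range _ _)).symm
  refine ⟨h1, fun x u hu v hv hux hvx => ?_⟩
  by_cases hx : x ∈ Set.range f
  · obtain ⟨m, rfl⟩ := hx
    have hg := hf.shift m
    have key : ∀ u ∈ Set.range f, u ≠ f m → ∃ i, 0 < i ∧ i < n ∧ f (i + m) = u := by
      intro u hu hum
      rw [← hf.range_shift m, hg.range_eq] at hu
      obtain ⟨i, hi, rfl⟩ := hu
      refine ⟨i, Nat.pos_of_ne_zero ?_, hi, rfl⟩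
      rintro rfl
      exact hum (by simp)
    obtain ⟨i, hi0, hin, rfl⟩ := key u hu hux
    obtain ⟨j, hj0, hjn, rfl⟩ := key v hv hvx
    have arc : ∀ i j, 0 < i → j < n → i ≤ j →
        Conn G (Set.range f \ {f m}) (f (i + m)) (f (j + m)) := by
      intro i j hi hj hij
      refine (conn_arc hg.adj hij).mono ?_
      rintro _ ⟨k, hk, rfl⟩
      exact ⟨⟨_, rfl⟩, (hf.ne_of_lt (by have := hk.1; omega) (by have := hk.2; omega)).symm⟩
    rcases le_total i j with h | h
    · exact arc i j hi0 hjn h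
    · exact (arc j i hj0 hin h).symm
  · exact (h1 u hu v hv).mono fun y hy => ⟨hy, fun e => hx (e ▸ hy)⟩

namespace SubS
variable {A₀ A₁ E : Set V}

lemma mem_succ_iff (h : SubS G Set.univ S A₀ A₁ E) (hf : IsCyc G f n) (hS : Set.range f ⊆ S)
    (i : ℕ) : f (i + 1) ∈ E ↔ f i ∉ E := by
  constructor
  · intro h1 h2
    obtain ⟨u, hu, v, hv, -, huv⟩ := h.exists_ends h2
    rcases (huv _).1 (hf.adj i) with e | e
    · exact Set.disjoint_left.1 h.disj₀ hu (e ▸ h1)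
    · exact Set.disjoint_left.1 h.disj₁ hv (e ▸ h1)
  · intro h1
    have h2 := hS ⟨i, rfl⟩
    rw [h.union] at h2
    exact h.indep _ (h2.resolve_right h1) _ (hS ⟨i + 1, rfl⟩) (hf.adj i)

lemma mem_two_mul_iff (h : SubS G Set.univ S A₀ A₁ E) (hf : IsCyc G f n) (hS : Set.range f ⊆ S)
    (i : ℕ) : f (2 * i) ∈ E ↔ f 0 ∈ E := by
  induction i with
  | zero => rfl
  | succ i ih =>
    rw [Nat.mul_succ, h.mem_succ_iff hf hS (2 * i + 1), h.mem_succ_iff hf hS, not_not, ih]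

lemma mem_add_two (h : SubS G Set.univ S A₀ A₁ E) (hf : IsCyc G f n) (hS : Set.range f ⊆ S)
    {i : ℕ} (hi : f i ∉ E) : (f i ∈ A₀ → f (i + 2) ∈ A₁) ∧ (f i ∈ A₁ → f (i + 2) ∈ A₀) := by
  have h3 := hf.three_le
  obtain ⟨u, hu, v, hv, -, huv⟩ := h.exists_ends ((h.mem_succ_iff hf hS i).2 hi)
  have hne : f i ≠ f (i + 2) := hf.ne_of_lt (by omega) (by omega)
  have h1 := (huv _).1 (hf.adj i).symm
  have h2 := (huv _).1 (hf.adj (i + 1))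
  have h2' : f (i + 2) = u ∨ f (i + 2) = v := h2
  constructor
  · intro hA
    have e1 : f i = u := h1.resolve_right fun e => Set.disjoint_left.1 h.disj (e ▸ hA) hv
    rw [h2'.resolve_left fun e => hne (e1.trans e.symm)]
    exact hv
  · intro hA
    have e1 : f i = v := h1.resolve_left fun e => Set.disjoint_left.1 h.disj hu (e ▸ hA)
    rw [h2'.resolve_right fun e => hne (e1.trans e.symm)]
    exact hu

/-- Along the cycle, vertices of `E` and of `A₀ ∪ A₁` alternate, and among the latter those of `A₀`
and of `A₁`; so the pattern repeats after four steps. -/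
lemma four_dvd (h : SubS G Set.univ S A₀ A₁ E) (hf : IsCyc G f n) (hS : Set.range f ⊆ S) :
    4 ∣ n := by
  have hA : ∀ i, f i ∉ E → f i ∈ A₀ ∨ f i ∈ A₁ := fun i hi => by
    have := hS ⟨i, rfl⟩
    rw [h.union] at this
    exact this.resolve_right hi
  have h0 : ∃ i, f i ∈ A₀ := by
    have h1 : ∃ i, f i ∉ E := by
      by_cases h0 : f 0 ∈ E
      · exact ⟨1, fun h1 => (h.mem_succ_iff hf hS 0).1 h1 h0⟩
      · exact ⟨0, h0⟩
    obtain ⟨i, hi⟩ := h1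
    rcases hA i hi with h1 | h1
    · exact ⟨i, h1⟩
    · exact ⟨i + 2, (h.mem_add_two hf hS hi).2 h1⟩
  obtain ⟨m, hm⟩ := h0
  have hg := hf.shift m
  have hgS : Set.range (fun i => f (i + m)) ⊆ S := by rwa [hf.range_shift]
  set g := fun i => f (i + m) with hgdef
  have hg0 : g 0 ∈ A₀ := by simpa [g] using hm
  have hgE : g 0 ∉ E := Set.disjoint_left.1 h.disj₀ hg0
  have hev : ∀ i, g (2 * i) ∉ E := fun i => by rwa [h.mem_two_mul_iff hg hgS]
  have h4 : ∀ k, g (4 * k) ∈ A₀ := by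
    intro k
    induction k with
    | zero => exact hg0
    | succ k ih =>
      have e1 : 4 * k = 2 * (2 * k) := by ring
      have h1 := (h.mem_add_two hg hgS (i := 4 * k) (e1 ▸ hev _)).1 ih
      have h2 := (h.mem_add_two hg hgS (i := 4 * k + 2)
        (by rw [show 4 * k + 2 = 2 * (2 * k + 1) by ring]; exact hev _)).2 h1
      exact h2
  have hn : g n = g 0 := by
    have := hg.periodic 0
    rwa [Nat.zero_add] at this
  have hpar : Even n := by
    by_contra hodd
    obtain ⟨k, rfl⟩ := Nat.not_even_iff_odd.1 hodd
    exact hgE (hn ▸ (h.mem_succ_iff hg hgS _).2 (hev k))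
  obtain ⟨k, rfl⟩ := hpar
  obtain ⟨t, rfl | rfl⟩ := Nat.even_or_odd' k
  · exact ⟨t, by ring⟩
  · exfalso
    have h1 := (h.mem_add_two hg hgS (i := 4 * t)
      (by rw [show 4 * t = 2 * (2 * t) by ring]; exact hev _)).1 (h4 t)
    rw [show 4 * t + 2 = 2 * t + 1 + (2 * t + 1) by ring, hn] at h1
    exact Set.disjoint_left.1 h.disj hg0 h1

/-- Both neighbours of a subdivision vertex already are its neighbours on the cycle. -/
lemma not_adj_of_mem (h : SubS G Set.univ S A₀ A₁ E) (hf : IsCyc G f n) {i : ℕ} (hi : f i ∈ E)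
    {w : V} (hw : w ∉ Set.range f) (hiw : G.Adj (f i) w) : False := by
  have h3 := hf.three_le
  obtain ⟨u, hu, v, hv, -, huv⟩ := h.exists_ends hi
  have h1 := (huv _).1 (hf.adj i)
  have h2 : G.Adj (f i) (f (i + n - 1)) := by
    have h4 := hf.adj (i + n - 1)
    rw [show i + n - 1 + 1 = i + n by omega, hf.periodic] at h4
    exact h4.symm
  rw [huv] at h2
  have hne : f (i + 1) ≠ f (i + n - 1) := hf.ne_of_lt (by omega) (by omega)
  have hw1 : w ≠ f (i + 1) := fun e => hw ⟨_, e.symm⟩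
  have hw2 : w ≠ f (i + n - 1) := fun e => hw ⟨_, e.symm⟩
  have h5 := (huv w).1 hiw
  clear huv hf h
  grind

lemma triFree (h : SubS G Set.univ S A₀ A₁ E) : TriFree G S := by
  have hE : ∀ x ∈ E, ∀ y ∈ E, ¬ G.Adj x y := by
    intro x hx y hy hxy
    obtain ⟨u, hu, v, hv, -, huv⟩ := h.exists_ends hx
    rcases (huv y).1 hxy with rfl | rfl
    exacts [Set.disjoint_left.1 h.disj₀ hu hy, Set.disjoint_left.1 h.disj₁ hv hy]
  have hA : ∀ x ∈ S, ∀ y ∈ S, G.Adj x y → x ∉ E → y ∈ E := fun x hx y hy hxy hxE => by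
    rw [h.union] at hx
    exact h.indep x (hx.resolve_right hxE) y hy hxy
  intro a ha b hb c hc hab hbc hca
  by_cases h1 : a ∈ E
  · have h2 : b ∉ E := fun h2 => hE a h1 b h2 hab
    exact hE c (hA b hb c hc hbc h2) a h1 hca
  · exact hE b (hA a ha b hb hab h1) c (hA a ha c hc hca.symm h1) hbc

/-- Of two vertices at odd distance along the cycle, one is a subdivision vertex. -/
lemma attach (h : SubS G Set.univ S A₀ A₁ E) (hf : IsCyc G f n) (hS : Set.range f ⊆ S) {j : ℕ}
    (hj : Odd j) {w w' : V} (hw : w ∉ Set.range f) (h0 : G.Adj (f 0) w) (hw' : w' ∉ Set.range f)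
    (hj' : G.Adj (f j) w') : False := by
  by_cases hE : f 0 ∈ E
  · exact h.not_adj_of_mem hf hE hw h0
  · obtain ⟨m, rfl⟩ := hj
    refine h.not_adj_of_mem hf ?_ hw' hj'
    rwa [h.mem_succ_iff hf hS, h.mem_two_mul_iff hf hS]

end SubS
end Cycles

/-! ### The admissible blocks contain no forbidden subgraph -/

section Converse
variable {V : Type u} {G : SimpleGraph V} {S : Set V} {f : ℕ → V} {n : ℕ}

/-- The four possible structures of a block. -/
def Shape (G : SimpleGraph V) (S : Set V) : Prop :=
  (∃ A₀ A₁ E, SubS G Set.univ S A₀ A₁ E) ∨ K4S G Set.univ S ∨ T2S G Set.univ S ∨ TS G Set.univ S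

/-- The set `S` has four elements of which at most one is attached. -/
def SmallEnd (G : SimpleGraph V) (S : Set V) : Prop :=
  S.ncard = 4 ∧ ∀ x ∈ S, ∀ y ∈ S, Att G Set.univ S x → Att G Set.univ S y → x = y

lemma K4S.smallEnd (h : K4S G Set.univ S) : SmallEnd G S := by
  obtain ⟨a, b, c, d, hab, hac, had, hbc, hbd, hcd, hBe, hatt⟩ := h
  have h4 : IsP4 G S := ⟨a, b, c, d, hac.ne, had.ne, hbd.ne, hab, hbc, hcd, hBe⟩
  exact ⟨h4.ncard_eq, hatt⟩

lemma T2S.smallEnd (h : T2S G Set.univ S) : SmallEnd G S := by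
  obtain ⟨a, b, c, d, hcd, hT, hatt⟩ := h
  have hac := hT.adj_left c (by simp)
  have hbd := hT.adj_right d (by simp)
  have h4 : IsP4 G S := ⟨c, a, b, d, (hT.adj_right c (by simp)).ne', hcd,
    (hT.adj_left d (by simp)).ne, hac.symm, hT.adj, hbd, by rw [hT.eq]; ext x; simp; tauto⟩
  exact ⟨h4.ncard_eq, fun x hx y hy hxa hya => by rw [hatt x hx hxa, hatt y hy hya]⟩

lemma length_le_ncard [Finite V] {l : List V} (hl : l.Nodup) (h : ∀ x ∈ l, x ∈ S) :
    l.length ≤ S.ncard := by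
  classical
  have h1 : (l.toFinset : Set V) ⊆ S := fun x hx => h x (by simpa using hx)
  have h2 := Set.ncard_le_ncard h1 (Set.toFinite _)
  rwa [Set.ncard_coe_finset, List.toFinset_card_of_nodup hl] at h2

namespace SmallEnd

lemma mem_of_nodup [Finite V] (h : SmallEnd G S) {a b c d e : V} (hn : [a, b, c, d, e].Nodup)
    (ha : a ∈ S) (hb : b ∈ S) (hc : c ∈ S) (hd : d ∈ S) : e ∉ S := fun he => by
  have h5 := length_le_ncard hn (S := S) (by simp [ha, hb, hc, hd, he])
  rw [h.1] at h5
  simp at h5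

lemma eq_of_adj (h : SmallEnd G S) {x y p q : V} (hx : x ∈ S) (hy : y ∈ S) (hp : p ∉ S)
    (hq : q ∉ S) (hxp : G.Adj x p) (hyq : G.Adj y q) : x = y :=
  h.2 x hx y hy ⟨p, trivial, hp, hxp⟩ ⟨q, trivial, hq, hyq⟩

lemma cyc [Finite V] (h : SmallEnd G S) (hf : IsCyc G f n) (hS : Set.range f ⊆ S) :
    n = 3 ∨ n = 4 := by
  have h1 := Set.ncard_le_ncard hS (Set.toFinite S)
  rw [hf.ncard_range, h.1] at h1
  have := hf.three_le
  omega

lemma attach [Finite V] (h : SmallEnd G S) (hf : IsCyc G f n) (hS : Set.range f ⊆ S) (hn : 4 ∣ n)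
    {j : ℕ} (hj : Odd j) {w w' : V} (hw : w ∉ Set.range f) (h0 : G.Adj (f 0) w)
    (hw' : w' ∉ Set.range f) (hj' : G.Adj (f j) w') : False := by
  have hn4 : n = 4 := by
    rcases h.cyc hf hS with rfl | rfl
    · omega
    · rfl
  subst hn4
  have hSe := Set.eq_of_subset_of_ncard_le hS (by rw [hf.ncard_range, h.1]) (Set.toFinite S)
  rw [hSe] at hw hw'
  have e := h.eq_of_adj (hS ⟨0, rfl⟩) (hS ⟨j, rfl⟩) hw hw' h0 hj'
  rw [hf.eq_iff] at e
  obtain ⟨m, rfl⟩ := hj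
  omega

end SmallEnd

/-- The content of `TS` for the whole graph. -/
lemma TS.exists_nbrs (h : TS G Set.univ S) : ∃ a b C, IsT G S a b C ∧
    (∀ c ∈ C, ∀ w, G.Adj c w → w = a ∨ w = b) ∧
    (∀ w, G.Adj b w → w = a ∨ w ∈ C ∨ ∀ w', G.Adj w w' → w' = b) := by
  obtain ⟨a, b, C, hT, hatt, hleaf⟩ := h
  have hCB : ∀ x ∈ C, x ∈ S := fun x hx => by rw [hT.eq]; exact Or.inr hx
  refine ⟨a, b, C, hT, fun c hc w hcw => ?_, fun w hbw => ?_⟩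
  · by_cases hw : w ∈ S
    · rw [hT.eq] at hw
      rcases hw with hw | hw
      · exact hw
      · exact absurd hcw (hT.indep c hc w hw)
    · rcases hatt c (hCB c hc) ⟨w, trivial, hw, hcw⟩ with rfl | rfl
      exacts [absurd hc hT.left, absurd hc hT.right]
  · by_cases hw : w ∈ S
    · rw [hT.eq] at hw
      rcases hw with (rfl | rfl) | hw
      exacts [Or.inl rfl, absurd rfl hbw.ne, Or.inr (Or.inl hw)]
    · exact Or.inr (Or.inr fun w' hw' => hleaf w trivial hw hbw w' trivial hw')

lemma IsT.mem {a b : V} {C : Set V} (h : IsT G S a b C) {x : V} (hx : x ∈ S) :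
    x = a ∨ x = b ∨ x ∈ C := by
  rw [h.eq] at hx
  rcases hx with (rfl | rfl) | hx
  exacts [Or.inl rfl, Or.inr (Or.inl rfl), Or.inr (Or.inr hx)]

namespace IsT
variable {a b : V} {C : Set V}

lemma succ_mem (h : IsT G S a b C) (hf : IsCyc G f n) (hS : Set.range f ⊆ S) (i : ℕ) :
    (f i = a ∨ f i = b) ∨ (f (i + 1) = a ∨ f (i + 1) = b) := by
  by_contra! hcon
  obtain ⟨⟨h1, h2⟩, h3, h4⟩ := hcon
  exact h.indep _ (((h.mem (hS ⟨i, rfl⟩)).resolve_left h1).resolve_left h2) _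
    (((h.mem (hS ⟨i + 1, rfl⟩)).resolve_left h3).resolve_left h4) (hf.adj i)

lemma not_three {x y z : V} (hxy : x ≠ y) (hxz : x ≠ z) (hyz : y ≠ z) (hx : x = a ∨ x = b)
    (hy : y = a ∨ y = b) (hz : z = a ∨ z = b) : False := by
  grind

/-- As `C` is independent, the two hubs meet every edge of the cycle. Each of them meets two edges,
so there are at most four. -/
lemma cyc (h : IsT G S a b C) (hf : IsCyc G f n) (hS : Set.range f ⊆ S) : n = 3 ∨ n = 4 := by
  by_contra! hcon
  have h3 := hf.three_le
  have no : ∀ i j k, i < j → j < k → k < i + n → (f i = a ∨ f i = b) → (f j = a ∨ f j = b) →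
      (f k = a ∨ f k = b) → False := fun i j k hij hjk hk =>
    not_three (hf.ne_of_lt hij (by omega)) (hf.ne_of_lt (by omega) hk)
      (hf.ne_of_lt hjk (by omega))
  have s0 := h.succ_mem hf hS 0
  have s1 := h.succ_mem hf hS 1
  have s2 := h.succ_mem hf hS 2
  have s3 := h.succ_mem hf hS 3
  have s4 := h.succ_mem hf hS 4
  rcases s1 with h1 | h2
  · rcases s2 with h2 | h3
    · rcases s3 with h3 | h4
      · exact no 1 2 3 (by omega) (by omega) (by omega) h1 h2 h3
      · exact no 1 2 4 (by omega) (by omega) (by omega) h1 h2 h4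
    · rcases s4 with h4 | h5
      · exact no 1 3 4 (by omega) (by omega) (by omega) h1 h3 h4
      · exact no 1 3 5 (by omega) (by omega) (by omega) h1 h3 h5
  · rcases s0 with h0 | h1 <;> rcases s3 with h3 | h4
    · exact no 0 2 3 (by omega) (by omega) (by omega) h0 h2 h3
    · exact no 0 2 4 (by omega) (by omega) (by omega) h0 h2 h4
    · exact no 1 2 3 (by omega) (by omega) (by omega) h1 h2 h3
    · exact no 1 2 4 (by omega) (by omega) (by omega) h1 h2 h4

/-- A vertex of `C` has both of its neighbours on the 4-cycle, so vertices with a neighbour off the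
cycle are hubs. If the two hubs are consecutive, the opposite edge of the cycle contains no hub. -/
lemma attach (h : IsT G S a b C) (hC : ∀ c ∈ C, ∀ w, G.Adj c w → w = a ∨ w = b)
    (hf : IsCyc G f n) (hS : Set.range f ⊆ S) (hn : 4 ∣ n) {j : ℕ} (hj : Odd j) {w w' : V}
    (hw : w ∉ Set.range f) (h0 : G.Adj (f 0) w) (hw' : w' ∉ Set.range f)
    (hj' : G.Adj (f j) w') : False := by
  have hn4 : n = 4 := by
    rcases h.cyc hf hS with rfl | rfl
    · omega
    · rfl
  subst hn4
  have no : ∀ i j k, i < j → j < k → k < i + 4 → (f i = a ∨ f i = b) → (f j = a ∨ f j = b) →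
      (f k = a ∨ f k = b) → False := fun i j k hij hjk hk =>
    not_three (hf.ne_of_lt hij (by omega)) (hf.ne_of_lt (by omega) hk)
      (hf.ne_of_lt hjk (by omega))
  have key : ∀ i v, v ∉ Set.range f → G.Adj (f i) v → f i = a ∨ f i = b := by
    intro i v hv hiv
    by_contra! hcon
    have hi : f i ∈ C := ((h.mem (hS ⟨i, rfl⟩)).resolve_left hcon.1).resolve_left hcon.2
    have hi1 := (h.succ_mem hf hS i).resolve_left (by simpa using hcon)
    have hi3 := h.succ_mem hf hS (i + 3)
    rw [show i + 3 + 1 = i + 4 by ring, hf.periodic] at hi3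
    have hi3' := hi3.resolve_right (by simpa using hcon)
    have hv1 : v ≠ f (i + 1) := fun e => hv ⟨_, e.symm⟩
    have hv3 : v ≠ f (i + 3) := fun e => hv ⟨_, e.symm⟩
    exact not_three hv1 hv3 (hf.ne_of_lt (by omega) (by omega)) (hC _ hi v hiv) hi1 hi3'
  have k0 := key 0 w hw h0
  have kj := key j w' hw' hj'
  rw [← hf.apply_mod j] at kj
  have hj4 : j % 4 = 1 ∨ j % 4 = 3 := by
    obtain ⟨m, rfl⟩ := hj
    omega
  rcases hj4 with e | e <;> rw [e] at kj
  · rcases h.succ_mem hf hS 2 with h2 | h2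
    · exact no 0 1 2 (by omega) (by omega) (by omega) k0 kj h2
    · exact no 0 1 3 (by omega) (by omega) (by omega) k0 kj h2
  · rcases h.succ_mem hf hS 1 with h2 | h2
    · exact no 0 1 3 (by omega) (by omega) (by omega) k0 h2 kj
    · exact no 0 2 3 (by omega) (by omega) (by omega) k0 h2 kj

lemma triangle_cases (h : IsT G S a b C) {x y z : V} (hx : x ∈ S) (hy : y ∈ S) (hz : z ∈ S)
    (hxy : G.Adj x y) (hxz : G.Adj x z) (hyz : G.Adj y z) :
    (x ∈ C ∧ y ∉ C ∧ z ∉ C) ∨ (y ∈ C ∧ x ∉ C ∧ z ∉ C) ∨ (z ∈ C ∧ x ∉ C ∧ y ∉ C) := by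
  have h1 : ¬ (x ∈ C ∧ y ∈ C) := fun ⟨h1, h2⟩ => h.indep _ h1 _ h2 hxy
  have h2 : ¬ (x ∈ C ∧ z ∈ C) := fun ⟨h1, h2⟩ => h.indep _ h1 _ h2 hxz
  have h3 : ¬ (y ∈ C ∧ z ∈ C) := fun ⟨h1, h2⟩ => h.indep _ h1 _ h2 hyz
  have h4 : x ∈ C ∨ y ∈ C ∨ z ∈ C := by
    by_contra! hcon
    have e1 := (h.mem hx)
    have e2 := (h.mem hy)
    have e3 := (h.mem hz)
    exact not_three hxy.ne hxz.ne hyz.ne (by tauto) (by tauto) (by tauto : z = a ∨ z = b)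
  tauto

end IsT

/-- A triangle has one vertex in `C` and the two hubs. Neither `a` nor `b` is in `C`, as `x` or `y`
would be a third neighbour. So they are the hubs, and the tail at the second hub does not end in a
leaf. -/
lemma TS.false_of_long (h : TS G Set.univ S) {a b c x x' y y' : V}
    (hn : [a, b, c, x, x', y, y'].Nodup) (ha : a ∈ S) (hb : b ∈ S) (hc : c ∈ S) (hab : G.Adj a b)
    (hac : G.Adj a c) (hbc : G.Adj b c) (hax : G.Adj a x) (hxx : G.Adj x x') (hby : G.Adj b y)
    (hyy : G.Adj y y') : False := by
  obtain ⟨a', b', C, hT, hC, hleaf⟩ := h.exists_nbrs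
  have ma := hT.mem ha
  have mb := hT.mem hb
  have mc := hT.mem hc
  have hn' := hT.adj.ne
  have hCx := hC x
  have hCy := hC y
  have hCa := hC a
  have hCb := hC b
  have hlx := hleaf x
  have hly := hleaf y
  have t := hT.triangle_cases ha hb hc hab hac hbc
  clear hC hleaf hT
  grind

/-- One vertex of the triangle is in `C` and has no neighbours besides the hubs. -/
lemma TS.false_of_net (h : TS G Set.univ S) {a b c p q r : V}
    (hn : [a, b, c, p, q, r].Nodup) (ha : a ∈ S) (hb : b ∈ S) (hc : c ∈ S) (hab : G.Adj a b)
    (hac : G.Adj a c) (hbc : G.Adj b c) (hap : G.Adj a p) (hbq : G.Adj b q) (hcr : G.Adj c r) :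
    False := by
  obtain ⟨a', b', C, hT, hC, -⟩ := h.exists_nbrs
  have ma := hT.mem ha
  have mb := hT.mem hb
  have mc := hT.mem hc
  have hCa := hC a
  have hCb := hC b
  have hCc := hC c
  have t := hT.triangle_cases ha hb hc hab hac hbc
  clear hC hT
  grind

/-- The vertex of the triangle `a b c` that lies in `C` would have three neighbours; for `c` the
third is `p`. -/
lemma TS.false_of_diamond (h : TS G Set.univ S) {a b c d p q : V}
    (hn : [a, b, c, d, p, q].Nodup) (ha : a ∈ S) (hb : b ∈ S) (hc : c ∈ S) (hd : d ∈ S)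
    (hab : G.Adj a b) (hac : G.Adj a c) (had : G.Adj a d) (hbc : G.Adj b c) (hbd : G.Adj b d)
    (hcp : G.Adj c p) : False := by
  obtain ⟨a', b', C, hT, hC, -⟩ := h.exists_nbrs
  have ma := hT.mem ha
  have mb := hT.mem hb
  have mc := hT.mem hc
  have md := hT.mem hd
  have hCa := hC a
  have hCb := hC b
  have hCc := hC c
  have t := hT.triangle_cases ha hb hc hab hac hbc
  have t' := hT.triangle_cases ha hb hd hab had hbd
  clear hC hT
  grind

end Converse

/-! ### The class `Good` equals both classes -/

section Main
variable {V : Type u} {G : SimpleGraph V} {S : Set V}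

lemma twoConn_triangle {a b c : V} (hab : G.Adj a b) (hac : G.Adj a c) (hbc : G.Adj b c) :
    TwoConn G {a, b, c} := by
  have hq : (Walk.cons hac (Walk.cons hbc.symm Walk.nil)).IsPath := by
    simp [Walk.isPath_def, hac.ne, hbc.ne', hab.ne]
  convert (TwoConn.pair hab).union_path (by simp) (by simp) hq using 1
  ext x
  simp
  tauto

lemma twoConn_diamond {a b c d : V} (hab : G.Adj a b) (hac : G.Adj a c) (had : G.Adj a d)
    (hbc : G.Adj b c) (hbd : G.Adj b d) : TwoConn G {a, b, c, d} := by
  have hq : (Walk.cons had (Walk.cons hbd.symm Walk.nil)).IsPath := by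
    simp [Walk.isPath_def, had.ne, hbd.ne', hab.ne]
  convert (twoConn_triangle hab hac hbc).union_path (by simp) (by simp) hq using 1
  ext x
  simp
  tauto

lemma exists_isBlk_of_triangle [Finite V] {T : Set V} (hT : TwoConn G T) {a b c : V}
    (hab : G.Adj a b) (hac : G.Adj a c) (hbc : G.Adj b c) (ha : a ∈ T) (hb : b ∈ T) (hc : c ∈ T) :
    ∃ S, IsBlk G Set.univ S ∧ T ⊆ S := by
  have h3 := length_le_ncard (S := T) (l := [a, b, c]) (by simp [hab.ne, hac.ne, hbc.ne])
    (by simp [ha, hb, hc])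
  exact IsBlk.exists_of_twoConn hT (Set.subset_univ T) h3

lemma Shape.smallEnd_or_tS (h : Shape G S) {a b c : V} (ha : a ∈ S) (hb : b ∈ S) (hc : c ∈ S)
    (hab : G.Adj a b) (hac : G.Adj a c) (hbc : G.Adj b c) :
    SmallEnd G S ∨ TS G Set.univ S := by
  rcases h with ⟨A₀, A₁, E, h⟩ | h | h | h
  · exact (h.triFree a ha b hb c hc hab hbc hac.symm).elim
  · exact Or.inl h.smallEnd
  · exact Or.inl h.smallEnd
  · exact Or.inr h

/-- The cycle, diamond or triangle inside an obstruction is two-connected and hence contained in a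
block. A triangle excludes subdivisions; a block with four vertices has room for at most one further
vertex of the obstruction, and then two attached vertices remain; T(p) is treated separately. -/
theorem good_of_shape [Finite V] (hG : ∀ S, IsBlk G Set.univ S → Shape G S) : Good G where
  cyc f n hf := by
    obtain ⟨S, hS, hfS⟩ := IsBlk.exists_of_twoConn hf.twoConn (Set.subset_univ _)
      (hf.ncard_range.symm ▸ hf.three_le)
    rcases hG S hS with ⟨A₀, A₁, E, h⟩ | h | h | ⟨a, b, C, h, -⟩
    · exact Or.inr (h.four_dvd hf hfS)
    · exact (h.smallEnd.cyc hf hfS).imp_right fun e => by rw [e]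
    · exact (h.smallEnd.cyc hf hfS).imp_right fun e => by rw [e]
    · exact (h.cyc hf hfS).imp_right fun e => by rw [e]
  attach := by
    rintro f n j hf hn hj ⟨w, hw, hw0⟩ ⟨w', hw', hwj⟩
    obtain ⟨S, hS, hfS⟩ := IsBlk.exists_of_twoConn hf.twoConn (Set.subset_univ _)
      (hf.ncard_range.symm ▸ hf.three_le)
    rcases hG S hS with ⟨A₀, A₁, E, h⟩ | h | h | h
    · exact h.attach hf hfS hj hw hw0 hw' hwj
    · exact h.smallEnd.attach hf hfS hn hj hw hw0 hw' hwj
    · exact h.smallEnd.attach hf hfS hn hj hw hw0 hw' hwj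
    · obtain ⟨a, b, C, hT, hC, -⟩ := h.exists_nbrs
      exact hT.attach hC hf hfS hn hj hw hw0 hw' hwj
  diamond a b c d p q hn hab hac had hbc hbd hcp hdq := by
    obtain ⟨S, hS, hTS⟩ := exists_isBlk_of_triangle (twoConn_diamond hab hac had hbc hbd)
      hab hac hbc (by simp) (by simp) (by simp)
    have ha : a ∈ S := hTS (by simp)
    have hb : b ∈ S := hTS (by simp)
    have hc : c ∈ S := hTS (by simp)
    have hd : d ∈ S := hTS (by simp)
    rcases (hG S hS).smallEnd_or_tS ha hb hc hab hac hbc with h | h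
    · have hp : p ∉ S := h.mem_of_nodup (by grind) ha hb hc hd
      have hq : q ∉ S := h.mem_of_nodup (by grind) ha hb hc hd
      obtain rfl := h.eq_of_adj hc hd hp hq hcp hdq
      simp at hn
    · exact h.false_of_diamond hn ha hb hc hd hab hac had hbc hbd hcp
  net a b c p q r hn hab hac hbc hap hbq hcr := by
    obtain ⟨S, hS, hTS⟩ := exists_isBlk_of_triangle (twoConn_triangle hab hac hbc)
      hab hac hbc (by simp) (by simp) (by simp)
    have ha : a ∈ S := hTS (by simp)
    have hb : b ∈ S := hTS (by simp)
    have hc : c ∈ S := hTS (by simp)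
    rcases (hG S hS).smallEnd_or_tS ha hb hc hab hac hbc with h | h
    · by_cases hp : p ∈ S
      · have hq : q ∉ S := h.mem_of_nodup (by grind) ha hb hc hp
        have hr : r ∉ S := h.mem_of_nodup (by grind) ha hb hc hp
        exact hbc.ne (h.eq_of_adj hb hc hq hr hbq hcr)
      · by_cases hq : q ∈ S
        · have hr : r ∉ S := h.mem_of_nodup (by grind) ha hb hc hq
          exact hac.ne (h.eq_of_adj ha hc hp hr hap hcr)
        · exact hab.ne (h.eq_of_adj ha hb hp hq hap hbq)
    · exact h.false_of_net hn ha hb hc hab hac hbc hap hbq hcr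
  long a b c x x' y y' hn hab hac hbc hax hxx hby hyy := by
    obtain ⟨S, hS, hTS⟩ := exists_isBlk_of_triangle (twoConn_triangle hab hac hbc)
      hab hac hbc (by simp) (by simp) (by simp)
    have ha : a ∈ S := hTS (by simp)
    have hb : b ∈ S := hTS (by simp)
    have hc : c ∈ S := hTS (by simp)
    rcases (hG S hS).smallEnd_or_tS ha hb hc hab hac hbc with h | h
    · by_cases hx : x ∈ S
      · have hx' : x' ∉ S := h.mem_of_nodup (by grind) ha hb hc hx
        have hy : y ∉ S := h.mem_of_nodup (by grind) ha hb hc hx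
        obtain rfl := h.eq_of_adj hx hb hx' hy hxx hby
        simp at hn
      · by_cases hy : y ∈ S
        · have hy' : y' ∉ S := h.mem_of_nodup (by grind) ha hb hc hy
          obtain rfl := h.eq_of_adj ha hy hx hy' hax hyy
          simp at hn
        · exact hab.ne (h.eq_of_adj ha hb hx hy hax hby)
    · exact h.false_of_long hn ha hb hc hab hac hbc hax hxx hby hyy

theorem Good.shape (hG : Good G) (hS : IsBlk G Set.univ S) : Shape G S := by
  by_cases h : TriFree G S
  · exact Or.inl (hG.exists_subS hS h)
  · exact Or.inr (hG.triangle_block hS h)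

theorem good_iff_mem_classH4 [Finite V] : Good G ↔ G ∈ classH4 V := by
  constructor
  · intro hG B hB ht
    have hBlk := isBlk_of_isBlock hB ht
    have hI : ∀ x ∈ B.verts, ∀ y ∈ B.verts, G.Adj x y → B.Adj x y := fun x hx y hy h =>
      isBlock_adj hB hx hy h
    rcases hG.shape hBlk with ⟨A₀, A₁, E, h⟩ | h | h | h
    · exact Or.inl (h.isSubdivisionBlock hBlk hI)
    · exact Or.inr (Or.inl (h.isK4Endblock hBlk hI))
    · exact Or.inr (Or.inr (Or.inl (h.isT2Endblock hBlk hI)))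
    · exact Or.inr (Or.inr (Or.inr (h.isTBlock hBlk hI)))
  · refine fun hG => good_of_shape fun S hS => ?_
    have hI : ∀ x ∈ ((⊤ : G.Subgraph).induce S).verts, ∀ y ∈ ((⊤ : G.Subgraph).induce S).verts,
        G.Adj x y → ((⊤ : G.Subgraph).induce S).Adj x y := fun x hx y hy h => ⟨hx, hy, h⟩
    rcases hG _ hS.isBlock hS.not_isTrivialBlock with h | h | h | h
    · exact Or.inl (exists_subS_of_isSubdivisionBlock (B := (⊤ : G.Subgraph).induce S) hS hI h)
    · exact Or.inr (Or.inl (k4S_of_isK4Endblock (B := (⊤ : G.Subgraph).induce S) hS h))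
    · exact Or.inr (Or.inr (Or.inl
        (t2S_of_isT2Endblock (B := (⊤ : G.Subgraph).induce S) hS hI h)))
    · exact Or.inr (Or.inr (Or.inr (tS_of_isTBlock (B := (⊤ : G.Subgraph).induce S) hS hI h)))

theorem good_iff_mem_classG [Finite V] : Good G ↔ G ∈ classG 4 V :=
  ⟨Good.mem_classG, good_of_mem_classG⟩

end Main

end FourPath

theorem theorem3 {V : Type u} [Finite V] : classG 4 V = classH4 V := by
  ext G
  rw [← FourPath.good_iff_mem_classG, FourPath.good_iff_mem_classH4]
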